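/- Let $k$ be a field complete with respect to a non-trivial non-Archimedean absolute value, let $\mathbb{P}^{1,\mathrm{an}}_k$ be the Berkovich projective line, $\mathbb{H}_k\subset\mathbb{P}^{1,\mathrm{an}}_k$ the set of points that are not of type 1, and $\rho$ the interval-length metric on $\mathbb{H}_k$. Let $\Gamma\subseteq \mathrm{PGL}_2(k)$ be generated by $\gamma_1,\dots,\gamma_g$, and suppose there is a Schottky figure adapted to $(\gamma_1,\dots,\gamma_g)$ (so that $\Gamma$ is a Schottky group): pairwise disjoint closed disks $D_a$ and maximal open disks $D_a^\circ\subset D_a$, indexed by the $2g$ letters $a\in\{\gamma_i^{\pm1}\}$, such that $a\big(\mathbb{P}^{1,\mathrm{an}}_k\setminus D_{a^{-1}}\big)=D_a^\circ$ for every $a$. Let $x_a$ be the unique boundary point of $D_a$, let $F=\mathbb{P}^{1,\mathrm{an}}_k\setminus\big(\bigcup_i D_{\gamma_i}\cup\bigcup_i D_{\gamma_i^{-1}}^\circ\big)$, and let $x,y\in\mathbb{H}_k\cap F$. Put $$\mathcal P_{x,y}(s)=\sum_{\gamma\in\Gamma}e^{-s\rho(x,\gamma y)},\qquad X_x(s)=\big(e^{-s\rho(x,x_a)}\big)_a,\qquad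 Y_y(s)=\big(e^{-s\rho(y,x_{a^{-1}})}\big)_a,$$ and let $M(s)$ be the $2g\times 2g$ matrix with entries $M(s)_{a,c}=e^{-s\rho(x_{a^{-1}},x_c)}$ if $c\ne a^{-1}$ and $M(s)_{a,a^{-1}}=0$. Then: 1. As formal series in $q=e^{-s}$ with integer coefficients and well-ordered sets of real exponents, all sums below are well defined, $I-M(s)$ is invertible, and $$\mathcal{P}_{x,y}(s)=\sum_{n=0}^{\infty} X_x(s)M(s)^n Y_y(s)^{t}+ e^{-s\rho(x,y)} =X_x(s)(I - M(s))^{-1} Y_y(s)^{t}+ e^{-s\rho(x,y)}.$$ The first equality also holds in $[0,+\infty]$ for every real $s\ge 0$. 2. The function $f(s)=X_x(s)(I-M(s))^{-1}Y_y(s)^t+e^{-s\rho(x,y)}$ is meromorphic on $\mathbb{C}$, and there is $s_0\in\mathbb{R}$ such that for all $s\in\mathbb{C}$ with $\mathrm{Re}(s)>s_0$ the matrix $I-M(s)$ is invertible, the series $\mathcal P_{x,y}(s)$ and $\sum_n X_x(s)M(s)^nY_y(s)^t$ converge, $\sum_n X_x(s)M(s)^nY_y(s)^t=X_x(s)(I-M(s))^{-1}Y_y(s)^t$,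 and $\mathcal P_{x,y}(s)=f(s)$. Thus $f$ is the meromorphic continuation of $\mathcal P_{x,y}$ to $\mathbb{C}$. 3. The continuation is a ratio of multivariate exponential polynomials: there are $m\ge 0$, real numbers $l_1,\dots,l_m>0$ and polynomials $P,Q\in\mathbb{Z}[T_1,\dots,T_m]$, with $Q(e^{-sl_1},\dots,e^{-sl_m})\neq0$ for $\mathrm{Re}(s)>s_0$, such that $f(s)=P(e^{-sl_1},\dots,e^{-sl_m})/Q(e^{-sl_1},\dots,e^{-sl_m})$ wherever the denominator does not vanish. -/

import Mathlib

open scoped MatrixGroups Matrix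

noncomputable section

/-! ## The Berkovich projective line -/

/-- The Berkovich affine line over a normed field `F`: the multiplicative seminorms on `F[T]`
which extend the norm of `F`. -/
structure BerkovichA1 (F : Type*) [NormedField F] where
  /-- the seminorm `P ↦ |P|_z` -/
  seminorm : MulRingSeminorm (Polynomial F)
  map_C : ∀ a : F, seminorm (Polynomial.C a) = ‖a‖

/-- The Berkovich projective line: the Berkovich affine line together with the point `∞`. -/
inductive BerkovichP1 (F : Type*) [NormedField F] where
  /-- the point `∞` -/
  | infty : BerkovichP1 F
  /-- the points of the affine line -/
  | aff (z : BerkovichA1 F) : BerkovichP1 F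

namespace BerkovichA1

variable {F : Type*} [NormedField F]

instance : CoeFun (BerkovichA1 F) (fun _ => Polynomial F → ℝ) := ⟨fun z => z.seminorm⟩

theorem ext' {z w : BerkovichA1 F} (h : ∀ P : Polynomial F, z P = w P) : z = w := by
  cases z; cases w
  congr 1
  exact DFunLike.ext _ _ h

end BerkovichA1

namespace BerkovichP1

open Polynomial

variable {F : Type*} [NormedField F]

/-- The absolute value at `p` of the binary form `∑ cᵢ Uⁱ V^(n-i)` of degree `n` whose
dehomogenization (`U = T`, `V = 1`) is `P = ∑ cᵢ Tⁱ`. At `∞`, where `V` vanishes, it is `|cₙ|`. -/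
def formAbs (p : BerkovichP1 F) (n : ℕ) (P : F[X]) : ℝ :=
  match p with
  | infty => ‖P.coeff n‖
  | aff z => z P

/-- The linear form `a T + b` (numerator of the Möbius transformation of `γ = (a b; c d)`). -/
def num (γ : GL (Fin 2) F) : F[X] := C (γ 0 0) * X + C (γ 0 1)

/-- The linear form `c T + d` (denominator of the Möbius transformation of `γ = (a b; c d)`). -/
def den (γ : GL (Fin 2) F) : F[X] := C (γ 1 0) * X + C (γ 1 1)

/-- For `P = ∑ cᵢ Tⁱ` of degree at most `n`, the polynomial
`(c T + d)ⁿ P((a T + b) / (c T + d)) = ∑ cᵢ (a T + b)ⁱ (c T + d)^(n-i)`. -/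
def subst (γ : GL (Fin 2) F) (n : ℕ) (P : F[X]) : F[X] :=
  MvPolynomial.aeval ![num γ, den γ] (P.homogenize n)

theorem subst_add (γ : GL (Fin 2) F) (n : ℕ) (P Q : F[X]) :
    subst γ n (P + Q) = subst γ n P + subst γ n Q := by
  simp [subst]

theorem subst_neg (γ : GL (Fin 2) F) (n : ℕ) (P : F[X]) :
    subst γ n (-P) = -subst γ n P := by
  have h := subst_add γ n P (-P)
  rw [add_neg_cancel] at h
  rw [show subst γ n (0 : F[X]) = 0 by simp [subst]] at h
  exact (neg_eq_of_add_eq_zero_right h.symm).symm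

theorem subst_zero (γ : GL (Fin 2) F) (n : ℕ) : subst γ n (0 : F[X]) = 0 := by
  simp [subst]

theorem subst_C (γ : GL (Fin 2) F) (n : ℕ) (a : F) :
    subst γ n (C a) = C a * den γ ^ n := by
  simp [subst]

theorem subst_mul (γ : GL (Fin 2) F) {n m : ℕ} {P Q : F[X]} (hP : P.natDegree ≤ n)
    (hQ : Q.natDegree ≤ m) : subst γ (n + m) (P * Q) = subst γ n P * subst γ m Q := by
  simp [subst, homogenize_mul P Q hP hQ]

theorem subst_pow (γ : GL (Fin 2) F) {L : F[X]} (hL : L.natDegree ≤ 1) (n : ℕ) :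
    subst γ n (L ^ n) = subst γ 1 L ^ n := by
  induction n with
  | zero => simpa using subst_C γ 0 (1 : F)
  | succ n ih =>
    rw [pow_succ, pow_succ, subst_mul γ (by simpa using natDegree_pow_le_of_le n hL) hL, ih]

theorem natDegree_num (γ : GL (Fin 2) F) : (num γ).natDegree ≤ 1 := natDegree_linear_le

theorem natDegree_den (γ : GL (Fin 2) F) : (den γ).natDegree ≤ 1 := natDegree_linear_le

theorem subst_monomial (γ : GL (Fin 2) F) {n i : ℕ} (h : i ≤ n) (a : F) :
    subst γ n (C a * X ^ i) = C a * (num γ ^ i * den γ ^ (n - i)) := by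
  simp [subst, h]

theorem natDegree_subst (γ : GL (Fin 2) F) {n : ℕ} {P : F[X]} (hP : P.natDegree ≤ n) :
    (subst γ n P).natDegree ≤ n := by
  refine Polynomial.induction_with_natDegree_le (fun P => (subst γ n P).natDegree ≤ n) n ?_ ?_ ?_ P hP
  · simp [subst]
  · intro i a ha hi
    rw [subst_monomial γ hi]
    refine (natDegree_C_mul_le _ _).trans (natDegree_mul_le.trans ?_)
    have h1 := natDegree_pow_le_of_le i (natDegree_num γ)
    have h2 := natDegree_pow_le_of_le (n - i) (natDegree_den γ)
    omega
  · intro P Q hPQ hQ h1 h2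
    rw [subst_add]
    exact natDegree_add_le_of_degree_le h1 h2

/-- Substitution is compatible with products of matrices. -/
theorem subst_subst (γ δ : GL (Fin 2) F) {n : ℕ} {P : F[X]} (hP : P.natDegree ≤ n) :
    subst δ n (subst γ n P) = subst (γ * δ) n P := by
  have hnum : subst δ 1 (num γ) = num (γ * δ) := by
    simp [num, den, subst, Matrix.mul_apply, Fin.sum_univ_two]
    ring
  have hden : subst δ 1 (den γ) = den (γ * δ) := by
    simp [num, den, subst, Matrix.mul_apply, Fin.sum_univ_two]
    ring
  refine Polynomial.induction_with_natDegree_le (fun P => subst δ n (subst γ n P) = subst (γ * δ) n P) n ?_ ?_ ?_ P hP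
  · simp [subst_zero]
  · intro i a ha hi
    rw [subst_monomial γ hi, subst_monomial (γ * δ) hi]
    have h1 := natDegree_pow_le_of_le i (natDegree_num γ)
    have h2 := natDegree_pow_le_of_le (n - i) (natDegree_den γ)
    rw [mul_one] at h1 h2
    have h3 := subst_mul δ h1 h2
    have h4 := subst_mul δ (n := 0) (natDegree_C a).le (natDegree_mul_le_of_le h1 h2)
    rw [Nat.add_sub_cancel' hi] at h3 h4
    rw [Nat.zero_add, subst_C, pow_zero, mul_one, h3, subst_pow δ (natDegree_num γ),
      subst_pow δ (natDegree_den γ), hnum, hden] at h4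
    exact h4
  · intro P Q hPQ hQ h1 h2
    rw [subst_add, subst_add, subst_add, h1, h2]

theorem subst_scalar (u : Fˣ) {n : ℕ} {P : F[X]} (hP : P.natDegree ≤ n) :
    subst (Matrix.GeneralLinearGroup.scalar (Fin 2) u) n P = C ((u : F) ^ n) * P := by
  refine Polynomial.induction_with_natDegree_le (fun P => subst (Matrix.GeneralLinearGroup.scalar (Fin 2) u) n P = C ((u : F) ^ n) * P) n ?_ ?_ ?_ P hP
  · simp [subst_zero]
  · intro i a ha hi
    obtain ⟨m, rfl⟩ := Nat.exists_eq_add_of_le hi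
    rw [subst_monomial _ hi]
    simp [num, den, mul_pow, pow_add]
    ring
  · intro P Q hPQ hQ h1 h2
    rw [subst_add, h1, h2, mul_add]

theorem formAbs_add (p : BerkovichP1 F) (n : ℕ) (P Q : F[X]) :
    formAbs p n (P + Q) ≤ formAbs p n P + formAbs p n Q := by
  cases p with
  | infty => simpa [formAbs] using norm_add_le _ _
  | aff z => exact map_add_le_add z.seminorm P Q

theorem formAbs_neg (p : BerkovichP1 F) (n : ℕ) (P : F[X]) :
    formAbs p n (-P) = formAbs p n P := by
  cases p with
  | infty => simp [formAbs]
  | aff z => exact map_neg_eq_map z.seminorm P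

theorem formAbs_mul (p : BerkovichP1 F) {n m : ℕ} {P Q : F[X]} (hP : P.natDegree ≤ n)
    (hQ : Q.natDegree ≤ m) :
    formAbs p (n + m) (P * Q) = formAbs p n P * formAbs p m Q := by
  cases p with
  | infty => simp [formAbs, coeff_mul_add_eq_of_natDegree_le hP hQ]
  | aff z => exact map_mul z.seminorm P Q

theorem formAbs_C (p : BerkovichP1 F) (a : F) : formAbs p 0 (C a) = ‖a‖ := by
  cases p with
  | infty => simp [formAbs]
  | aff z => exact z.map_C a

theorem formAbs_zero (p : BerkovichP1 F) (n : ℕ) : formAbs p n 0 = 0 := by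
  cases p with
  | infty => simp [formAbs]
  | aff z => exact map_zero z.seminorm

theorem formAbs_C_mul (p : BerkovichP1 F) (n : ℕ) (a : F) {P : F[X]} (hP : P.natDegree ≤ n) :
    formAbs p n (C a * P) = ‖a‖ * formAbs p n P := by
  have h := formAbs_mul p (n := 0) (P := C a) (natDegree_C a).le hP
  rwa [formAbs_C, Nat.zero_add] at h

theorem formAbs_add_eq (p : BerkovichP1 F) (n : ℕ) (P : F[X]) {Q : F[X]}
    (hQ : formAbs p n Q = 0) : formAbs p n (P + Q) = formAbs p n P := by
  refine le_antisymm ?_ ?_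
  · simpa [hQ] using formAbs_add p n P Q
  · simpa [hQ, formAbs_neg] using formAbs_add p n (P + Q) (-Q)

theorem formAbs_pow (p : BerkovichP1 F) {L : F[X]} (hL : L.natDegree ≤ 1) (n : ℕ) :
    formAbs p n (L ^ n) = formAbs p 1 L ^ n := by
  induction n with
  | zero => simpa using formAbs_C p (1 : F)
  | succ n ih =>
    rw [pow_succ, pow_succ, formAbs_mul p (by simpa using natDegree_pow_le_of_le n hL) hL, ih]

theorem formAbs_nonneg (p : BerkovichP1 F) (n : ℕ) (P : F[X]) : 0 ≤ formAbs p n P := by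
  cases p with
  | infty => exact norm_nonneg _
  | aff z => exact apply_nonneg z.seminorm P

/-- Raising the formal degree of `P` multiplies its transform by a power of `c T + d`. -/
theorem formAbs_subst_of_le (p : BerkovichP1 F) (γ : GL (Fin 2) F) {n : ℕ} {P : F[X]}
    (h : P.natDegree ≤ n) :
    formAbs p n (subst γ n P) =
      formAbs p 1 (den γ) ^ (n - P.natDegree) *
        formAbs p P.natDegree (subst γ P.natDegree P) := by
  obtain ⟨m, rfl⟩ := Nat.exists_eq_add_of_le h
  have h1 : subst γ (P.natDegree + m) P = subst γ P.natDegree P * den γ ^ m := by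
    have := subst_mul γ (P := P) (Q := C 1) le_rfl (m := m) (by simp)
    rwa [subst_C, C_1, mul_one, one_mul] at this
  rw [h1, formAbs_mul p (natDegree_subst γ le_rfl)
    (by simpa using natDegree_pow_le_of_le m (natDegree_den γ)), formAbs_pow p (natDegree_den γ)]
  simp [mul_comm]

/-- The image of `p` by the Möbius transformation of `γ = (a b; c d)`: the point of the affine line
`P ↦ |P((a T + b) / (c T + d))|_p`, or `∞` if `c T + d` vanishes at `p`. -/
def mobius (γ : GL (Fin 2) F) (p : BerkovichP1 F) : BerkovichP1 F :=
  open Classical in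
  if h : formAbs p 1 (den γ) = 0 then infty
  else aff
    { seminorm :=
        { toFun := fun P =>
            formAbs p P.natDegree (subst γ P.natDegree P) / formAbs p 1 (den γ) ^ P.natDegree
          map_zero' := by simp [subst_zero, formAbs_zero]
          map_one' := by
            have := formAbs_C p (1 : F)
            simpa [subst] using this
          neg' := fun P => by simp [subst_neg, formAbs_neg]
          map_mul' := fun P Q => by
            by_cases hP : P = 0
            · simp [hP, subst_zero, formAbs_zero]
            by_cases hQ : Q = 0
            · simp [hQ, subst_zero, formAbs_zero]
            rw [natDegree_mul hP hQ, subst_mul γ le_rfl le_rfl,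
              formAbs_mul p (natDegree_subst γ le_rfl) (natDegree_subst γ le_rfl), pow_add,
              mul_div_mul_comm]
          add_le' := fun P Q => by
            have key : ∀ (R : F[X]) (n : ℕ), R.natDegree ≤ n →
                formAbs p R.natDegree (BerkovichP1.subst γ R.natDegree R) /
                  formAbs p 1 (den γ) ^ R.natDegree =
                formAbs p n (BerkovichP1.subst γ n R) / formAbs p 1 (den γ) ^ n := by
              intro R n hn
              rw [formAbs_subst_of_le p γ hn]
              obtain ⟨m, rfl⟩ := Nat.exists_eq_add_of_le hn
              rw [pow_add, Nat.add_sub_cancel_left]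
              field_simp
            have hn := natDegree_add_le P Q
            rw [key (P + Q) _ hn, key P _ (le_max_left _ _), key Q _ (le_max_right _ _), ← add_div,
              subst_add]
            exact div_le_div_of_nonneg_right (formAbs_add p _ _ _)
              (pow_nonneg (formAbs_nonneg _ _ _) _) }
      map_C := fun a => by
        change formAbs p (C a).natDegree (subst γ (C a).natDegree (C a)) /
          formAbs p 1 (den γ) ^ (C a).natDegree = ‖a‖
        rw [natDegree_C, subst_C, pow_zero, pow_zero, mul_one, div_one, formAbs_C] }

/-- The defining property of the Möbius action in terms of binary forms. -/
theorem exists_formAbs_subst (γ : GL (Fin 2) F) (p : BerkovichP1 F) :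
    ∃ c : ℝ, 0 < c ∧ ∀ (n : ℕ) (P : F[X]), P.natDegree ≤ n →
      formAbs p n (subst γ n P) = c ^ n * formAbs (mobius γ p) n P := by
  by_cases h : formAbs p 1 (den γ) = 0
  · refine ⟨formAbs p 1 (num γ), lt_of_le_of_ne (formAbs_nonneg _ _ _) ?_, ?_⟩
    · intro h'
      have hdet : γ 0 0 * γ 1 1 - γ 0 1 * γ 1 0 ≠ 0 := by
        rw [← Matrix.det_fin_two]
        exact γ.det_ne_zero
      have e1 : formAbs p 1 (C (γ 1 1) * num γ + C (-γ 0 1) * den γ) = 0 := by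
        rw [formAbs_add_eq, formAbs_C_mul p 1 _ (natDegree_num γ), ← h', mul_zero]
        rw [formAbs_C_mul p 1 _ (natDegree_den γ), h, mul_zero]
      have e2 : formAbs p 1 (C (γ 0 0) * den γ + C (-γ 1 0) * num γ) = 0 := by
        rw [formAbs_add_eq, formAbs_C_mul p 1 _ (natDegree_den γ), h, mul_zero]
        rw [formAbs_C_mul p 1 _ (natDegree_num γ), ← h', mul_zero]
      have f1 : C (γ 1 1) * num γ + C (-γ 0 1) * den γ =
          C (γ 0 0 * γ 1 1 - γ 0 1 * γ 1 0) * X := by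
        simp [num, den]
        ring
      have f2 : C (γ 0 0) * den γ + C (-γ 1 0) * num γ =
          C (γ 0 0 * γ 1 1 - γ 0 1 * γ 1 0) := by
        simp [num, den]
        ring
      rw [f1] at e1
      rw [f2] at e2
      cases p with
      | infty => exact hdet (by simpa [formAbs] using e1)
      | aff z =>
        have e3 : z (C (γ 0 0 * γ 1 1 - γ 0 1 * γ 1 0)) = 0 := e2
        rw [z.map_C] at e3
        exact hdet (norm_eq_zero.mp e3)
    · intro n P hP
      have hm : mobius γ p = infty := by simp [mobius, h]
      rw [hm]
      cases n with
      | zero =>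
        obtain ⟨a, rfl⟩ := natDegree_eq_zero.mp (Nat.le_zero.mp hP)
        simp only [subst_C, pow_zero, mul_one, one_mul, formAbs_C]
      | succ m =>
        have hR : (P.erase (m + 1)).natDegree ≤ m := by
          refine natDegree_le_iff_coeff_eq_zero.mpr fun j hj => ?_
          rw [coeff_erase]
          split_ifs with hjm
          · rfl
          · exact coeff_eq_zero_of_natDegree_lt (by omega)
        have hPe : P = C (P.coeff (m + 1)) * X ^ (m + 1) + P.erase (m + 1) := by
          rw [C_mul_X_pow_eq_monomial, monomial_add_erase]
        have hz : formAbs p (m + 1) (subst γ (m + 1) (P.erase (m + 1))) = 0 := by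
          rw [formAbs_subst_of_le p γ (hR.trans m.le_succ), h, zero_pow (by omega), zero_mul]
        conv_lhs => rw [hPe]
        have hd : (num γ ^ (m + 1)).natDegree ≤ m + 1 := by
          simpa using natDegree_pow_le_of_le (m + 1) (natDegree_num γ)
        rw [subst_add, formAbs_add_eq p _ _ hz, subst_monomial γ le_rfl, Nat.sub_self, pow_zero,
          mul_one, formAbs_C_mul p _ _ hd, formAbs_pow p (natDegree_num γ), mul_comm]
        rfl
  · refine ⟨formAbs p 1 (den γ), lt_of_le_of_ne (formAbs_nonneg _ _ _) (Ne.symm h), ?_⟩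
    intro n P hP
    rw [formAbs_subst_of_le p γ hP]
    obtain ⟨m, rfl⟩ := Nat.exists_eq_add_of_le hP
    have hm : formAbs (mobius γ p) (P.natDegree + m) P =
        formAbs p P.natDegree (subst γ P.natDegree P) / formAbs p 1 (den γ) ^ P.natDegree := by
      unfold mobius
      rw [dif_neg h]
      rfl
    rw [hm, pow_add, Nat.add_sub_cancel_left]
    field_simp

/-- A point is determined by its absolute values of binary forms, up to scaling. -/
theorem eq_of_formAbs {p q : BerkovichP1 F} {c : ℝ} (hc : 0 < c)
    (h : ∀ (n : ℕ) (P : F[X]), P.natDegree ≤ n → formAbs p n P = c ^ n * formAbs q n P) :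
    p = q := by
  have h1 := h 1 1 (by simp)
  cases p with
  | infty =>
    cases q with
    | infty => rfl
    | aff w =>
      have : (0 : ℝ) = c * 1 := by
        simpa [formAbs, coeff_one, map_one w.seminorm] using h1
      linarith
  | aff z =>
    have hz : formAbs (aff z) 1 1 = 1 := map_one z.seminorm
    rw [hz] at h1
    cases q with
    | infty => simp [formAbs, coeff_one] at h1
    | aff w =>
      have hw : formAbs (aff w) 1 1 = 1 := map_one w.seminorm
      rw [hw, pow_one, mul_one] at h1
      congr 1
      refine BerkovichA1.ext' fun P => ?_
      have := h P.natDegree P le_rfl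
      rwa [← h1, one_pow, one_mul] at this

theorem mobius_scalar (u : Fˣ) (p : BerkovichP1 F) :
    mobius (Matrix.GeneralLinearGroup.scalar (Fin 2) u) p = p := by
  obtain ⟨c, hc, h⟩ := exists_formAbs_subst (Matrix.GeneralLinearGroup.scalar (Fin 2) u) p
  have hu : 0 < ‖(u : F)‖ := norm_pos_iff.mpr u.ne_zero
  refine eq_of_formAbs (c := ‖(u : F)‖ / c) (div_pos hu hc) fun n P hP => ?_
  have h' := h n P hP
  rw [subst_scalar u hP, formAbs_C_mul p n _ hP, norm_pow] at h'
  rw [div_pow, div_mul_eq_mul_div, h', mul_div_cancel_left₀ _ (pow_pos hc n).ne']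

theorem mobius_mul (γ δ : GL (Fin 2) F) (p : BerkovichP1 F) :
    mobius (γ * δ) p = mobius γ (mobius δ p) := by
  obtain ⟨a, ha, h1⟩ := exists_formAbs_subst (γ * δ) p
  obtain ⟨b, hb, h2⟩ := exists_formAbs_subst δ p
  obtain ⟨c, hc, h3⟩ := exists_formAbs_subst γ (mobius δ p)
  refine eq_of_formAbs (c := b * c / a) (div_pos (mul_pos hb hc) ha) fun n P hP => ?_
  have e := h1 n P hP
  rw [← subst_subst γ δ hP, h2 n _ (natDegree_subst γ hP), h3 n P hP] at e
  rw [div_pow, mul_pow, div_mul_eq_mul_div, mul_assoc, e,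
    mul_div_cancel_left₀ _ (pow_pos ha n).ne']

/-- The action of `GL₂(F)` on the Berkovich projective line by Möbius transformations. -/
instance : MulAction (GL (Fin 2) F) (BerkovichP1 F) where
  smul := mobius
  one_smul p := by
    have := mobius_scalar 1 p
    rwa [map_one] at this
  mul_smul := mobius_mul

/-- The action of `PGL₂(F)` on the Berkovich projective line by Möbius transformations. -/
instance : MulAction (PGL(2, F)) (BerkovichP1 F) :=
  Matrix.ProjGenLinGroup.mulActionOfGL mobius_scalar

/-! ### Disks -/

/-- The closed disk `D(a, r) = {|T - a| ≤ r}` in the affine line. -/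
def closedDisk (a : F) (r : ℝ) : Set (BerkovichP1 F) :=
  {p | ∃ z : BerkovichA1 F, p = aff z ∧ z (X - C a) ≤ r}

/-- The open disk `{|T - a| < r}` in the affine line. -/
def openDisk (a : F) (r : ℝ) : Set (BerkovichP1 F) :=
  {p | ∃ z : BerkovichA1 F, p = aff z ∧ z (X - C a) < r}

/-- The closed disks of the projective line: the sets which are of the form `{|T - a| ≤ r}`, with
`a ∈ F` and `r > 0`, for some choice of the coordinate function `T`. -/
def IsClosedDisk (D : Set (BerkovichP1 F)) : Prop :=
  ∃ (h : PGL(2, F)) (a : F) (r : ℝ), 0 < r ∧ D = (h • ·) '' closedDisk a r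

/-- The open disks of the projective line: the sets which are of the form `{|T - a| < r}`, with
`a ∈ F` and `r > 0`, for some choice of the coordinate function `T`. -/
def IsOpenDisk (U : Set (BerkovichP1 F)) : Prop :=
  ∃ (h : PGL(2, F)) (a : F) (r : ℝ), 0 < r ∧ U = (h • ·) '' openDisk a r

/-- `U` is a maximal open disk inside `D`. -/
def IsMaximalOpenDisk (U D : Set (BerkovichP1 F)) : Prop :=
  Maximal (fun V => IsOpenDisk V ∧ V ⊆ D) U

variable [IsUltrametricDist F]

/-- The point `η_{a,r}` of the affine line, `∑ cₙ (T - a)ⁿ ↦ maxₙ |cₙ| rⁿ`, for `r > 0`. -/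
def eta (a : F) (r : ℝ) (hr : 0 < r) : BerkovichA1 F :=
  have hna : IsNonarchimedean (NormedField.toAbsoluteValue F) :=
    IsUltrametricDist.isNonarchimedean_norm
  { seminorm :=
      { toFun := fun P => (taylor a P).gaussNorm (NormedField.toAbsoluteValue F) r
        map_zero' := by simp
        map_one' := by
          rw [taylor_one, gaussNorm_C]
          exact map_one _
        map_mul' := fun P Q => by rw [taylor_mul, gaussNorm_mul hna hr]
        neg' := fun P => by
          have h : ∀ Q : F[X], (-Q).gaussNorm (NormedField.toAbsoluteValue F) r =
              Q.gaussNorm (NormedField.toAbsoluteValue F) r := fun Q => by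
            simp only [gaussNorm, support_neg, coeff_neg, AbsoluteValue.map_neg]
          rw [map_neg, h]
        add_le' := fun P Q => by
          rw [map_add]
          exact (isNonarchimedean_gaussNorm _ hna hr.le _ _).trans
            (max_le_add_of_nonneg (gaussNorm_nonneg _ _ hr.le) (gaussNorm_nonneg _ _ hr.le)) }
    map_C := fun b => by
      change (taylor a (C b)).gaussNorm (NormedField.toAbsoluteValue F) r = ‖b‖
      rw [taylor_C, gaussNorm_C]
      rfl }

/-- `p` is the boundary point of the closed disk `D`: in some coordinate in which
`D = {|T - a| ≤ r}` it is the point `η_{a,r}`, the unique boundary point of `{|T - a| ≤ r}`. -/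
def IsBoundaryPoint (D : Set (BerkovichP1 F)) (p : BerkovichP1 F) : Prop :=
  ∃ (h : PGL(2, F)) (a : F) (r : ℝ) (hr : 0 < r),
    D = (h • ·) '' closedDisk a r ∧ p = h • aff (eta a r hr)

end BerkovichP1

/-! ## The hyperbolic space and its metric -/

section Hyperbolic

open Polynomial

variable (k : Type*) [NontriviallyNormedField k] [CompleteSpace k] [IsUltrametricDist k]

/-- The algebraic closure of `k` with the unique norm extending that of `k`. -/
instance : NormedField (AlgebraicClosure k) := spectralNorm.normedField k (AlgebraicClosure k)

instance : NormedAlgebra k (AlgebraicClosure k) :=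
  spectralNorm.normedAlgebra k (AlgebraicClosure k)

/-- The completion of the algebraic closure of `k`. -/
abbrev CompletedAlgClosure := UniformSpace.Completion (AlgebraicClosure k)

variable {k}

/-- `w` is a point of the affine line over the completed algebraic closure of `k` lying above the
point `z` of the affine line over `k`. -/
def BerkovichA1.LiesOver (w : BerkovichA1 (CompletedAlgClosure k)) (z : BerkovichA1 k) : Prop :=
  ∀ P : k[X], w (P.map (algebraMap k (CompletedAlgClosure k))) = z P

/-- The type 1 points of the projective line over `k`: the images of the points of the projective
line which are rational over the completed algebraic closure of `k`. -/
def BerkovichP1.IsTypeOne : BerkovichP1 k → Prop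
  | .infty => True
  | .aff z => ∃ c : CompletedAlgClosure k, ∀ P : k[X], z P = ‖aeval c P‖

variable (k) in
/-- The hyperbolic space over `k`: the points which are not of type 1. -/
def hyperbolicSpace : Set (BerkovichP1 k) := {p | ¬ p.IsTypeOne}

/-- The diameter of the smallest closed disk (with respect to the fixed coordinate) containing both
`z` and `w`, that is, the diameter of their join `z ∨ w`. For `z = w` it is the diameter of `z`. -/
def BerkovichA1.joinDiam {K : Type*} [NormedField K] (z w : BerkovichA1 K) : ℝ :=
  ⨅ a : K, max (z (X - C a)) (w (X - C a))

/-- The path distance `2 log diam(z ∨ w) - log diam(z) - log diam(w)` on the hyperbolic space over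
an algebraically closed field. -/
def BerkovichA1.pathDist {K : Type*} [NormedField K] (z w : BerkovichA1 K) : ℝ :=
  2 * Real.log (z.joinDiam w) - Real.log (z.joinDiam z) - Real.log (w.joinDiam w)

/-- The interval length metric on the hyperbolic space over `k`: the length of the path joining two
points, measured on a lift of this path to the projective line over the completed algebraic closure
of `k`. Equivalently, the least distance between two points lying above the given ones.
(The value `0` at `∞`, which is not a point of the hyperbolic space, is a convention.) -/
def BerkovichP1.rho : BerkovichP1 k → BerkovichP1 k → ℝ
  | .aff z, .aff w =>
    ⨅ q : {q : BerkovichA1 (CompletedAlgClosure k) × BerkovichA1 (CompletedAlgClosure k) //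
      q.1.LiesOver z ∧ q.2.LiesOver w}, q.1.1.pathDist q.1.2
  | _, _ => 0

end Hyperbolic

/-! ## Schottky figures -/

/-- The letters of the alphabet of `γ₁, …, γ_g` and their inverses: `(i, true)` stands for `γᵢ` and
`(i, false)` for `γᵢ⁻¹`. -/
abbrev Letter (g : ℕ) := Fin g × Bool

/-- The inverse letter. -/
def Letter.inv {g : ℕ} (a : Letter g) : Letter g := (a.1, !a.2)

/-- The group element denoted by a letter. -/
def Letter.val {g : ℕ} {G : Type*} [Group G] (γ : Fin g → G) (a : Letter g) : G :=
  if a.2 then γ a.1 else (γ a.1)⁻¹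

section Schottky

open BerkovichP1

variable {k : Type*} [NormedField k] {g : ℕ}

/-- The sets `D a` and `Do a`, for the letters `a` in `γ₁^{±1}, …, γ_g^{±1}`, form a Schottky figure
adapted to `(γ₁, …, γ_g)`: the `D a` are pairwise disjoint closed disks, `Do a` is a maximal open
disk inside `D a`, and `a` maps the complement of `D a⁻¹` onto `Do a`. -/
structure IsSchottkyFigure (γ : Fin g → PGL(2, k)) (D Do : Letter g → Set (BerkovichP1 k)) :
    Prop where
  isClosedDisk : ∀ a, IsClosedDisk (D a)
  isMaximalOpenDisk : ∀ a, IsMaximalOpenDisk (Do a) (D a)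
  disjoint : Pairwise fun a b => Disjoint (D a) (D b)
  image_compl : ∀ a, (a.val γ • ·) '' (D a.inv)ᶜ = Do a

/-- The fundamental domain: the complement of the closed disks of the `γᵢ` and of the open disks of
the `γᵢ⁻¹`. -/
def fundamentalDomain (D Do : Letter g → Set (BerkovichP1 k)) : Set (BerkovichP1 k) :=
  ((⋃ i : Fin g, D (i, true)) ∪ ⋃ i : Fin g, Do (i, false))ᶜ

end Schottky

/-! ## The Perron matrix

The matrix and vectors below have entries `e^{-sℓ}` with `ℓ` a distance. They are written for an
arbitrary function `E`, where `E ℓ` stands for `e^{-sℓ}`; it is taken to be the real or complex number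
`e^{-sℓ}`, or the formal exponential `q^ℓ`. -/

section Perron

open BerkovichP1

variable {k : Type*} [NontriviallyNormedField k] [CompleteSpace k] [IsUltrametricDist k] {g : ℕ}
  {R : Type*}

/-- The vector `X_x` with entries `e^{-sρ(x, ∂D_a)}`. -/
def vecX (E : ℝ → R) (b : Letter g → BerkovichP1 k) (x : BerkovichP1 k) : Letter g → R :=
  fun a => E (rho x (b a))

/-- The vector `Y_y` with entries `e^{-sρ(y, ∂D_{a⁻¹})}`. -/
def vecY (E : ℝ → R) (b : Letter g → BerkovichP1 k) (y : BerkovichP1 k) : Letter g → R :=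
  fun a => E (rho y (b a.inv))

/-- The matrix `M` with entries `e^{-sρ(∂D_{a⁻¹}, ∂D_c)}` if `a⁻¹ ≠ c`, and `0` otherwise. -/
def perronMatrix [Zero R] (E : ℝ → R) (b : Letter g → BerkovichP1 k) :
    Matrix (Letter g) (Letter g) R :=
  Matrix.of fun a c => if a.inv = c then 0 else E (rho (b a.inv) (b c))

/-- The bilinear expression `X_x Mⁿ Y_yᵗ`. -/
def powerTerm [CommRing R] (E : ℝ → R) (b : Letter g → BerkovichP1 k) (x y : BerkovichP1 k)
    (n : ℕ) : R :=
  vecX E b x ⬝ᵥ (perronMatrix E b ^ n *ᵥ vecY E b y)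

/-- The expression `X_x (I - M)⁻¹ Y_yᵗ`. -/
def resolventTerm [CommRing R] (E : ℝ → R) (b : Letter g → BerkovichP1 k)
    (x y : BerkovichP1 k) : R :=
  vecX E b x ⬝ᵥ ((1 - perronMatrix E b)⁻¹ *ᵥ vecY E b y)

/-- The formal exponential `q^ℓ` (with `q = e^{-s}`), an element of the ring of formal series
`∑ c_ℓ q^ℓ` with integer coefficients and well-ordered set of real exponents. -/
def formalExp (l : ℝ) : HahnSeries ℝ ℤ := HahnSeries.single l 1

/-- The exponential `e^{-sℓ}` for real `s`. -/
def realExp (s l : ℝ) : ℝ := Real.exp (-s * l)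

/-- The exponential `e^{-sℓ}` for complex `s`. -/
def complexExp (s : ℂ) (l : ℝ) : ℂ := Complex.exp (-s * l)

end Perron

end

/-! Write an element of Γ as a reduced word a₁⋯aₙ in the letters. Ping-pong places a₁⋯aₙy in the
disk of a₁, and x ∈ F lies on the other side, so the path from x to a₁⋯aₙy crosses x_{a₁}. The
translation by a₁⁻¹ takes x_{a₁} to x_{a₁⁻¹} and leaves the path from x_{a₁⁻¹} to a₂⋯aₙy, which
crosses x_{a₂} since a₂ ≠ a₁⁻¹, and so on. The distance is therefore ρ(x, x_{a₁}) + Σ ρ(x_{aᵢ⁻¹},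
x_{aᵢ₊₁}) + ρ(y, x_{aₙ⁻¹}) (`IsSchottkyFigure.rho_word`). Exponentials turn this sum into a product
of one entry of X, n - 1 entries of M and one entry of Y, and the zeros of M remove exactly the
non-reduced words. The words with n + 1 letters thus add up to X Mⁿ Yᵗ (`powerTerm_eq_sum`). The
empty word gives e^{-sρ(x,y)}, and distinct reduced words give distinct elements because ping-pong
also shows that Γ is free (`IsSchottkyFigure.lift_injective`).

The geometric input is that ρ is invariant under PGL₂ and additive across the boundary point of a
disk. For invariance, a point is viewed as a norm on linear forms up to scaling: the path distance
is the logarithmic distortion `formDist` between two such norms, which makes no reference to a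
coordinate. For additivity, all points above η_{c,r} over the completed algebraic closure take the
same values on linear forms, so distances to them do not depend on the lift, and the infima defining
ρ add up (`rho_add_of_eta`). That letters carry boundary points to boundary points uses that η_{c,r}
is determined by its values on linear forms together with an extremal property, `IsDominant`, which
is invariant under Möbius transformations.

The entries of M involve finitely many lengths, all at least some δ > 0
(`IsSchottkyFigure.exists_le_rho_boundary`). Formally, the remainder of the geometric series has
exponents tending to infinity. Analytically, the entries are at most e^{-δ Re s}, and the geometric
series converges once 2g e^{-δ Re s} < 1. Cramer's rule over a polynomial ring, specialized to
exponentials, gives both the meromorphy and the ratio of exponential polynomials. -/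

noncomputable section

open Polynomial
open scoped Pointwise

/-! ## Linear forms and the path distance -/

namespace BerkovichA1

variable {F : Type*} [NormedField F]

theorem seminorm_nonneg (z : BerkovichA1 F) (P : F[X]) : 0 ≤ z P := apply_nonneg z.seminorm P

theorem le_joinDiam {z w : BerkovichA1 F} {r : ℝ}
    (h : ∀ a, r ≤ max (z (X - C a)) (w (X - C a))) : r ≤ z.joinDiam w :=
  le_ciInf h

theorem joinDiam_comm (z w : BerkovichA1 F) : z.joinDiam w = w.joinDiam z := by
  simp only [joinDiam, max_comm]

theorem joinDiam_bddBelow (z w : BerkovichA1 F) :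
    BddBelow (Set.range fun a : F => max (z (X - C a)) (w (X - C a))) :=
  ⟨0, by rintro _ ⟨a, rfl⟩; exact le_max_of_le_left (z.seminorm_nonneg _)⟩

theorem joinDiam_le (z w : BerkovichA1 F) (a : F) :
    z.joinDiam w ≤ max (z (X - C a)) (w (X - C a)) :=
  ciInf_le (joinDiam_bddBelow z w) a

theorem diam_le (z : BerkovichA1 F) (a : F) : z.joinDiam z ≤ z (X - C a) := by
  simpa using joinDiam_le z z a

theorem diam_le_joinDiam (z w : BerkovichA1 F) : z.joinDiam z ≤ z.joinDiam w :=
  le_joinDiam fun a => (z.diam_le a).trans (le_max_left _ _)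

theorem pathDist_nonneg {z w : BerkovichA1 F} (hz : 0 < z.joinDiam z) (hw : 0 < w.joinDiam w) :
    0 ≤ z.pathDist w := by
  have h1 := Real.log_le_log hz (diam_le_joinDiam z w)
  have h2 := Real.log_le_log hw (diam_le_joinDiam w z)
  rw [joinDiam_comm w z] at h2
  rw [pathDist]
  linarith

theorem joinDiam_eq_of_lt {z p : BerkovichA1 F} {c : F} {r : ℝ}
    (hp : ∀ β, p (X - C β) = max r ‖β - c‖) (hr : 0 ≤ r) (hz : z (X - C c) ≤ r) :
    p.joinDiam z = r := by
  refine le_antisymm ((joinDiam_le p z c).trans (by simp [hp, hz, hr])) (le_joinDiam fun β => ?_)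
  rw [hp]
  exact le_max_of_le_left (le_max_left _ _)

variable [IsUltrametricDist F]

/-- Natural numbers have absolute value at most 1, so the binomial formula bounds the n-th power of
z(P + Q) by n + 1 times Mⁿ. The exponential growth of the quotient z(P + Q) / M, if it exceeded 1,
would beat the linear factor. -/
theorem isNonarchimedean (z : BerkovichA1 F) : IsNonarchimedean z.seminorm := by
  have hnat : ∀ n : ℕ, z (n : F[X]) ≤ 1 := fun n => by
    rw [← C_eq_natCast, z.map_C]
    exact IsUltrametricDist.norm_natCast_le_one F n
  have hsum : ∀ (s : Finset ℕ) (f : ℕ → F[X]), z (∑ i ∈ s, f i) ≤ ∑ i ∈ s, z (f i) := fun s f =>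
    Finset.le_sum_of_subadditive _ (map_zero z.seminorm).le (map_add_le_add z.seminorm) s f
  intro P Q
  set M := max (z P) (z Q) with hM
  have hM0 : 0 ≤ M := le_max_of_le_left (apply_nonneg z.seminorm P)
  have hpow : ∀ n : ℕ, z (P + Q) ^ n ≤ (n + 1 : ℕ) * M ^ n := fun n => by
    rw [← map_pow, add_pow]
    refine (hsum _ _).trans ?_
    rw [← nsmul_eq_mul]
    refine (Finset.sum_le_card_nsmul _ _ (M ^ n) fun i hi => ?_).trans (by simp)
    rw [map_mul, map_mul, map_pow, map_pow]
    have hi' : i ≤ n := by simpa [Nat.lt_succ_iff] using hi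
    calc z P ^ i * z Q ^ (n - i) * z (n.choose i : F[X])
        ≤ M ^ i * M ^ (n - i) * 1 := by
          gcongr
          · exact le_max_left _ _
          · exact le_max_right _ _
          · exact hnat _
      _ = M ^ n := by rw [mul_one, ← pow_add, Nat.add_sub_cancel' hi']
  rcases hM0.eq_or_lt with h0 | h0
  · have := hpow 1
    simpa [← h0] using this
  · by_contra! hlt
    have h1 : 1 < z (P + Q) / M := (one_lt_div h0).mpr hlt
    -- Since m + 1 ≤ 2m for m ≥ 1, a bound of 1/4 on m divided by the m-th power of the quotient
    -- contradicts the binomial estimate.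
    obtain ⟨n, hn⟩ := ((tendsto_pow_const_div_const_pow_of_one_lt 1 h1).eventually
      (gt_mem_nhds (show (0 : ℝ) < 1 / 4 by norm_num))).exists_forall_of_atTop
    obtain ⟨m, hmn, hm1⟩ : ∃ m, n ≤ m ∧ 1 ≤ m := ⟨n + 1, by omega, by omega⟩
    have h2 := hn m hmn
    have h3 := hpow m
    rw [div_pow, pow_one] at h2
    have hzp : 0 < z (P + Q) ^ m := pow_pos (h0.trans hlt) m
    have hMp : 0 < M ^ m := pow_pos h0 m
    rw [div_div_eq_mul_div, div_lt_iff₀ hzp] at h2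
    have hm1' : (1 : ℝ) ≤ m := by exact_mod_cast hm1
    push_cast at h3
    nlinarith

theorem add_le_max (z : BerkovichA1 F) (P Q : F[X]) : z (P + Q) ≤ max (z P) (z Q) :=
  z.isNonarchimedean P Q

theorem map_sub_C_le (z : BerkovichA1 F) (a b : F) : z (X - C a) ≤ max (z (X - C b)) ‖b - a‖ := by
  have := z.add_le_max (X - C b) (C (b - a))
  rw [z.map_C] at this
  simpa using this

theorem norm_sub_le (z : BerkovichA1 F) (a b : F) : ‖b - a‖ ≤ max (z (X - C a)) (z (X - C b)) := by
  have := z.add_le_max (X - C a) (-(X - C b))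
  rw [map_neg_eq_map] at this
  rw [← z.map_C]
  refine le_trans (le_of_eq ?_) this
  congr 1
  simp

/-- The join of `x` and `p` if `p` is the boundary point of a disk with center `c`
and `x` does not lie in the open disk. -/
theorem joinDiam_eq_of_le {x p : BerkovichA1 F} {c : F} {r : ℝ}
    (hp : ∀ β, p (X - C β) = max r ‖β - c‖) (hr : 0 ≤ r) (hx : r ≤ x (X - C c)) :
    x.joinDiam p = x (X - C c) := by
  refine le_antisymm ((joinDiam_le x p c).trans (by simp [hp, hx, hr])) (le_joinDiam fun β => ?_)
  rw [hp, norm_sub_rev]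
  exact (x.map_sub_C_le c β).trans (by
    rw [norm_sub_rev c β, norm_sub_rev β c, norm_sub_rev c β]
    refine max_le_max le_rfl ?_
    rw [norm_sub_rev]
    exact le_max_right _ _)

theorem joinDiam_eq_of_lt_of_le {x z : BerkovichA1 F} {c : F} {r : ℝ} (hz : z (X - C c) < r)
    (hx : r ≤ x (X - C c)) : x.joinDiam z = x (X - C c) := by
  refine le_antisymm ((joinDiam_le x z c).trans (by simp [hz.le.trans hx]))
    (le_joinDiam fun β => ?_)
  by_contra! hlt
  rw [max_lt_iff] at hlt
  have h1 := x.map_sub_C_le c β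
  have h2 := z.norm_sub_le c β
  rcases le_max_iff.mp h1 with h | h
  · linarith
  · rcases le_max_iff.mp h2 with h' | h' <;> linarith

/-- The boundary point of an open disk lies between the points inside and the points outside. -/
theorem pathDist_eq_add {x z p : BerkovichA1 F} {c : F} {r : ℝ} (hr : 0 ≤ r)
    (hp : ∀ β, p (X - C β) = max r ‖β - c‖) (hz : z (X - C c) < r)
    (hx : r ≤ x (X - C c)) : x.pathDist z = x.pathDist p + p.pathDist z := by
  have hpp : p.joinDiam p = r := joinDiam_eq_of_lt hp hr (by simp [hp, hr])
  rw [pathDist, pathDist, pathDist, joinDiam_eq_of_le hp hr hx, joinDiam_eq_of_lt hp hr hz.le,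
    joinDiam_eq_of_lt_of_le hz hx, hpp]
  ring

end BerkovichA1

/-! ### The Möbius-invariant distance between norms on linear forms -/

namespace BerkovichP1

variable {F : Type*} [NormedField F]

/-- The set of constants `c` with `|L|_p ≤ c |L|_q` for all linear forms `L`, bounded in terms of
the linear forms alone. -/
def FormLE (p q : BerkovichP1 F) (c : ℝ) : Prop :=
  ∀ L : F[X], L.natDegree ≤ 1 → formAbs p 1 L ≤ c * formAbs q 1 L

/-- The smallest `c` with `|L|_p ≤ c |L|_q` for all linear forms `L`. -/
def ratio (p q : BerkovichP1 F) : ℝ := sInf {c | 0 ≤ c ∧ FormLE p q c}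

/-- The logarithm of the distortion between the norms on linear forms. -/
def formDist (p q : BerkovichP1 F) : ℝ := Real.log (ratio p q) + Real.log (ratio q p)

/-- The linear forms have a norm, as opposed to a seminorm, bounded below. -/
def IsNormLike (p : BerkovichP1 F) : Prop :=
  ∃ c : ℝ, 0 < c ∧ ∀ L : F[X], L.natDegree ≤ 1 → c * (‖L.coeff 0‖ + ‖L.coeff 1‖) ≤ formAbs p 1 L

theorem exists_formAbs_smul (γ : GL (Fin 2) F) (p : BerkovichP1 F) :
    ∃ c : ℝ, 0 < c ∧ ∀ (n : ℕ) (P : F[X]), P.natDegree ≤ n →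
      formAbs p n (subst γ n P) = c ^ n * formAbs (γ • p) n P :=
  exists_formAbs_subst γ p

theorem subst_inv_subst (γ : GL (Fin 2) F) {n : ℕ} {P : F[X]} (hP : P.natDegree ≤ n) :
    subst γ n (subst γ⁻¹ n P) = P := by
  have h1 := subst_scalar (1 : Fˣ) hP
  rw [subst_subst _ _ hP, inv_mul_cancel]
  simpa using h1

theorem ratio_smul (γ : GL (Fin 2) F) (p q : BerkovichP1 F) {s : ℝ} (hs : 0 < s)
    (h : ∀ c, FormLE (γ • p) (γ • q) (s * c) ↔ FormLE p q c) :
    ratio (γ • p) (γ • q) = s * ratio p q := by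
  have : {c | 0 ≤ c ∧ FormLE (γ • p) (γ • q) c} = s • {c | 0 ≤ c ∧ FormLE p q c} := by
    ext c
    rw [Set.mem_smul_set]
    constructor
    · rintro ⟨h0, h1⟩
      refine ⟨s⁻¹ * c, ⟨by positivity, ?_⟩, by simp [hs.ne']⟩
      rw [← h, mul_inv_cancel_left₀ hs.ne']
      exact h1
    · rintro ⟨d, ⟨h0, h1⟩, rfl⟩
      exact ⟨by rw [smul_eq_mul]; positivity, (h d).mpr h1⟩
  rw [ratio, this, Real.sInf_smul_of_nonneg hs.le]
  rfl

theorem formAbs_le_of_natDegree (p : BerkovichP1 F) :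
    ∃ c : ℝ, 0 < c ∧ ∀ L : F[X], L.natDegree ≤ 1 →
      formAbs p 1 L ≤ c * (‖L.coeff 0‖ + ‖L.coeff 1‖) := by
  have h0 := formAbs_nonneg p 1 1
  have h1 := formAbs_nonneg p 1 X
  refine ⟨formAbs p 1 1 + formAbs p 1 X + 1, by positivity, fun L hL => ?_⟩
  conv_lhs => rw [eq_X_add_C_of_natDegree_le_one hL]
  refine (formAbs_add _ _ _ _).trans ?_
  rw [formAbs_C_mul _ _ _ (by simp), ← mul_one (C (L.coeff 0)), formAbs_C_mul _ _ _ (by simp)]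
  have h2 := norm_nonneg (L.coeff 0)
  have h3 := norm_nonneg (L.coeff 1)
  nlinarith [mul_nonneg h0 h3, mul_nonneg h1 h2]

theorem IsNormLike.exists_formLE {q : BerkovichP1 F} (hq : IsNormLike q) (p : BerkovichP1 F) :
    ∃ c : ℝ, 0 ≤ c ∧ FormLE p q c := by
  obtain ⟨d, hd, h⟩ := hq
  obtain ⟨c, hc, h'⟩ := formAbs_le_of_natDegree p
  refine ⟨c / d, by positivity, fun L hL => (h' L hL).trans ?_⟩
  rw [div_mul_eq_mul_div, le_div_iff₀ hd]
  nlinarith [h L hL]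

theorem formLE_ratio {p q : BerkovichP1 F} (hq : IsNormLike q) : FormLE p q (ratio p q) := by
  intro L hL
  have hne : {c | 0 ≤ c ∧ FormLE p q c}.Nonempty := hq.exists_formLE p
  rcases (formAbs_nonneg q 1 L).eq_or_lt with h | h
  · obtain ⟨c, hc⟩ := hne
    have := hc.2 L hL
    rw [← h] at this ⊢
    simpa using this
  · rw [← div_le_iff₀ h]
    exact le_csInf hne fun c hc => (div_le_iff₀ h).mpr (hc.2 L hL)

theorem ratio_nonneg (p q : BerkovichP1 F) : 0 ≤ ratio p q := Real.sInf_nonneg fun _ h => h.1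

theorem ratio_le {p q : BerkovichP1 F} {c : ℝ} (hc : 0 ≤ c) (h : FormLE p q c) : ratio p q ≤ c :=
  csInf_le ⟨0, fun _ h => h.1⟩ ⟨hc, h⟩

theorem ratio_pos {p q : BerkovichP1 F} (hp : IsNormLike p) (hq : IsNormLike q) :
    0 < ratio p q := by
  refine (ratio_nonneg p q).lt_of_ne fun h => ?_
  obtain ⟨d, hd, h'⟩ := hp
  have h1 := formLE_ratio (p := p) hq 1 (by simp)
  have h2 := h' 1 (by simp)
  rw [← h, zero_mul] at h1
  have h3 := h2.trans h1
  rw [coeff_one_zero, norm_one] at h3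
  nlinarith [norm_nonneg ((1 : F[X]).coeff 1)]

/-- A substitution is a bijection of the linear forms and multiplies the two norms by constants a
and b. The two ratios change by b / a and a / b, which cancel in the sum of logarithms. -/
theorem formDist_smul (γ : GL (Fin 2) F) {p q : BerkovichP1 F} (hp : IsNormLike p)
    (hq : IsNormLike q) : formDist (γ • p) (γ • q) = formDist p q := by
  obtain ⟨a, ha, h1⟩ := exists_formAbs_smul γ p
  obtain ⟨b, hb, h2⟩ := exists_formAbs_smul γ q
  have key : ∀ {p q : BerkovichP1 F} {a b : ℝ}, 0 < a → 0 < b →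
      (∀ (n : ℕ) (P : F[X]), P.natDegree ≤ n →
        formAbs p n (subst γ n P) = a ^ n * formAbs (γ • p) n P) →
      (∀ (n : ℕ) (P : F[X]), P.natDegree ≤ n →
        formAbs q n (subst γ n P) = b ^ n * formAbs (γ • q) n P) →
      ratio (γ • p) (γ • q) = b / a * ratio p q := by
    intro p q a b ha hb h1 h2
    refine ratio_smul γ p q (by positivity) fun c => ⟨fun h L hL => ?_, fun h L hL => ?_⟩
    · have hL' := natDegree_subst γ⁻¹ hL
      have e := h _ hL'
      have e1 := h1 1 _ hL'
      have e2 := h2 1 _ hL'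
      rw [subst_inv_subst γ hL, pow_one] at e1 e2
      rw [e1, e2]
      calc a * formAbs (γ • p) 1 (subst γ⁻¹ 1 L)
          ≤ a * (b / a * c * formAbs (γ • q) 1 (subst γ⁻¹ 1 L)) := by gcongr
        _ = _ := by field_simp
    · have e := h _ (natDegree_subst γ hL)
      rw [h1 1 _ hL, h2 1 _ hL, pow_one, pow_one] at e
      rw [div_mul_eq_mul_div, div_mul_eq_mul_div, le_div_iff₀ ha]
      linarith
  have hpq := ratio_pos hp hq
  have hqp := ratio_pos hq hp
  rw [formDist, formDist, key ha hb h1 h2, key hb ha h2 h1, Real.log_mul (by positivity) hpq.ne',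
    Real.log_mul (by positivity) hqp.ne', Real.log_div hb.ne' ha.ne', Real.log_div ha.ne' hb.ne']
  ring

theorem IsNormLike.smul (γ : GL (Fin 2) F) {p : BerkovichP1 F} (hp : IsNormLike p) :
    IsNormLike (γ • p) := by
  obtain ⟨d, hd, h⟩ := hp
  obtain ⟨a, ha, h1⟩ := exists_formAbs_smul γ p
  -- the coefficients of `L` are bounded in terms of those of its transform
  obtain ⟨K, hK, hK'⟩ : ∃ K : ℝ, 0 < K ∧ ∀ L : F[X], L.natDegree ≤ 1 →
      ‖L.coeff 0‖ + ‖L.coeff 1‖ ≤ K * (‖(subst γ 1 L).coeff 0‖ + ‖(subst γ 1 L).coeff 1‖) := by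
    have key : ∀ (δ : GL (Fin 2) F) (L : F[X]), L.natDegree ≤ 1 →
        ‖(subst δ 1 L).coeff 0‖ + ‖(subst δ 1 L).coeff 1‖ ≤
          (1 + ‖δ 0 0‖ + ‖δ 0 1‖ + ‖δ 1 0‖ + ‖δ 1 1‖) * (‖L.coeff 0‖ + ‖L.coeff 1‖) := by
      intro δ L hL
      have e : subst δ 1 L = C (L.coeff 1 * δ 0 0 + L.coeff 0 * δ 1 0) * X +
          C (L.coeff 1 * δ 0 1 + L.coeff 0 * δ 1 1) := by
        conv_lhs => rw [eq_X_add_C_of_natDegree_le_one hL]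
        rw [subst_add, ← pow_one (X : F[X]), subst_monomial δ le_rfl, subst_C]
        simp [num, den]
        ring
      have e0 : (subst δ 1 L).coeff 0 = L.coeff 1 * δ 0 1 + L.coeff 0 * δ 1 1 := by simp [e]
      have e1 : (subst δ 1 L).coeff 1 = L.coeff 1 * δ 0 0 + L.coeff 0 * δ 1 0 := by simp [e]
      rw [e0, e1]
      have i1 := norm_add_le (L.coeff 1 * δ 0 1) (L.coeff 0 * δ 1 1)
      have i2 := norm_add_le (L.coeff 1 * δ 0 0) (L.coeff 0 * δ 1 0)
      simp only [norm_mul] at i1 i2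
      have n0 := norm_nonneg (L.coeff 0)
      have n1 := norm_nonneg (L.coeff 1)
      have m1 := norm_nonneg (δ 0 0)
      have m2 := norm_nonneg (δ 0 1)
      have m3 := norm_nonneg (δ 1 0)
      have m4 := norm_nonneg (δ 1 1)
      nlinarith [mul_nonneg n0 m1, mul_nonneg n0 m2, mul_nonneg n0 m3, mul_nonneg n0 m4,
        mul_nonneg n1 m1, mul_nonneg n1 m2, mul_nonneg n1 m3, mul_nonneg n1 m4]
    refine ⟨1 + ‖γ⁻¹ 0 0‖ + ‖γ⁻¹ 0 1‖ + ‖γ⁻¹ 1 0‖ + ‖γ⁻¹ 1 1‖, by positivity, fun L hL => ?_⟩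
    have := key γ⁻¹ (subst γ 1 L) (natDegree_subst γ hL)
    have e := subst_inv_subst γ⁻¹ hL
    rw [inv_inv] at e
    rwa [e] at this
  refine ⟨d / (K * a), by positivity, fun L hL => ?_⟩
  have e1 := h _ (natDegree_subst γ hL)
  rw [h1 1 L hL, pow_one] at e1
  have e2 := hK' L hL
  rw [div_mul_eq_mul_div, div_le_iff₀ (by positivity)]
  calc d * (‖L.coeff 0‖ + ‖L.coeff 1‖)
      ≤ d * (K * (‖(subst γ 1 L).coeff 0‖ + ‖(subst γ 1 L).coeff 1‖)) := by gcongr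
    _ = K * (d * (‖(subst γ 1 L).coeff 0‖ + ‖(subst γ 1 L).coeff 1‖)) := by ring
    _ ≤ K * (a * formAbs (γ • p) 1 L) := by gcongr
    _ = _ := by ring

theorem not_isNormLike_infty : ¬ IsNormLike (infty : BerkovichP1 F) := by
  rintro ⟨c, hc, h⟩
  have := h 1 (by simp)
  simp [formAbs, coeff_one] at this
  linarith

variable [IsUltrametricDist F]

/-- A form uX + v with u ≠ 0 is u times X minus its root, so the diameter d bounds its value below
by ‖u‖ d. The ultrametric inequality then bounds the constant coefficient as well. -/
theorem isNormLike_aff {z : BerkovichA1 F} : IsNormLike (aff z) ↔ 0 < z.joinDiam z := by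
  constructor
  · rintro ⟨c, hc, h⟩
    refine hc.trans_le (BerkovichA1.le_joinDiam fun a => ?_)
    have := h (X - C a) (natDegree_X_sub_C_le a)
    rw [max_self]
    refine le_trans ?_ this
    have : (X - C a).coeff 1 = 1 := by simp
    rw [this, norm_one]
    nlinarith [norm_nonneg ((X - C a).coeff 0)]
  · intro hd
    set d := z.joinDiam z
    have key : ∀ a b : F, ‖a‖ * d ≤ z (C a * X + C b) := fun a b => by
      by_cases ha : a = 0
      · simp [ha, z.seminorm_nonneg]
      · have : C a * X + C b = C a * (X - C (-b / a)) := by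
          rw [mul_sub, ← C_mul, mul_div_cancel₀ _ ha]
          simp
        rw [this, map_mul, z.map_C]
        exact mul_le_mul_of_nonneg_left (z.diam_le _) (norm_nonneg _)
    have hX := z.seminorm_nonneg X
    have key2 : ∀ a b : F, ‖b‖ ≤ (1 + z X / d) * z (C a * X + C b) := fun a b => by
      have h1 := z.add_le_max (C a * X + C b) (-(C a * X))
      rw [map_neg_eq_map, map_mul, z.map_C, add_comm (C a * X), add_neg_cancel_right, z.map_C] at h1
      have h2 := key a b
      rw [add_comm (C a * X)] at h2 ⊢
      have h3 := z.seminorm_nonneg (C b + C a * X)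
      have h4 : ‖a‖ * z X ≤ z X / d * z (C b + C a * X) := by
        rw [div_mul_eq_mul_div, le_div_iff₀ hd]
        nlinarith
      have h5 : 0 ≤ z X / d * z (C b + C a * X) := by positivity
      rcases le_max_iff.mp h1 with h | h <;> nlinarith
    refine ⟨(1 + z X / d + 1 / d)⁻¹, by positivity, fun L hL => ?_⟩
    rw [inv_mul_le_iff₀ (by positivity)]
    have e := eq_X_add_C_of_natDegree_le_one hL
    have h1 := key (L.coeff 1) (L.coeff 0)
    have h2 := key2 (L.coeff 1) (L.coeff 0)
    rw [← e] at h1 h2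
    have h3 : ‖L.coeff 1‖ ≤ 1 / d * z L := by
      rw [div_mul_eq_mul_div, one_mul, le_div_iff₀ hd]
      exact h1
    calc ‖L.coeff 0‖ + ‖L.coeff 1‖ ≤ (1 + z X / d) * z L + 1 / d * z L := add_le_add h2 h3
      _ = _ := by rw [formAbs]; ring

/-- By the ultrametric inequality w(X - a) is at most the larger of the join diameter J and z(X -
a). The quotient w(X - a) / z(X - a) is thus largest, and close to J / d, when z(X - a) is close to
the diameter d of z. -/
theorem ratio_aff {z w : BerkovichA1 F} (hz : 0 < z.joinDiam z) :
    ratio (aff w) (aff z) = z.joinDiam w / z.joinDiam z := by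
  set d := z.joinDiam z with hd
  set J := z.joinDiam w with hJ
  have hJ0 : d ≤ J := BerkovichA1.diam_le_joinDiam z w
  have hsub : ∀ a, w (X - C a) ≤ max J (z (X - C a)) := fun a => by
    by_contra! hlt
    rw [max_lt_iff] at hlt
    obtain ⟨c, hc⟩ := exists_lt_of_ciInf_lt hlt.1
    rw [max_lt_iff] at hc
    have h1 := w.map_sub_C_le a c
    have h2 := z.norm_sub_le a c
    rcases le_max_iff.mp h1 with h | h
    · linarith
    · rcases le_max_iff.mp h2 with h' | h' <;> linarith
  refine le_antisymm (ratio_le (div_nonneg (hz.le.trans hJ0) hz.le) fun L hL => ?_) ?_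
  · change w L ≤ J / d * z L
    have h1J : 1 ≤ J / d := (one_le_div hz).mpr hJ0
    have e := eq_X_add_C_of_natDegree_le_one hL
    by_cases ha : L.coeff 1 = 0
    · rw [ha, C_0, zero_mul, zero_add] at e
      rw [e, w.map_C, z.map_C]
      nlinarith [norm_nonneg (L.coeff 0)]
    · have e' : L = C (L.coeff 1) * (X - C (-L.coeff 0 / L.coeff 1)) := by
        rw [mul_sub, ← C_mul, mul_div_cancel₀ _ ha]
        simpa using e
      rw [e', map_mul, map_mul, w.map_C, z.map_C]
      set a := -L.coeff 0 / L.coeff 1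
      have h2 := z.diam_le a
      have h3 : w (X - C a) ≤ J / d * z (X - C a) := by
        refine (hsub a).trans (max_le ?_ ?_)
        · rw [div_mul_eq_mul_div, le_div_iff₀ hz]
          exact mul_le_mul_of_nonneg_left h2 (hz.le.trans hJ0)
        · exact le_mul_of_one_le_left (z.seminorm_nonneg _) h1J
      nlinarith [norm_nonneg (L.coeff 1)]
  · have hle := formLE_ratio (p := aff w) (isNormLike_aff.mpr hz)
    set c := ratio (aff w) (aff z)
    have h1 : 1 ≤ c := by
      have := hle (C 1) (by simp)
      change w (C 1) ≤ c * z (C 1) at this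
      simpa [w.map_C, z.map_C] using this
    rw [div_le_iff₀ hz]
    refine le_of_forall_pos_le_add fun ε hε => ?_
    -- The diameter is an infimum that need not be attained; the slack ε / c becomes ε after
    -- multiplication by c.
    obtain ⟨a, ha⟩ := exists_lt_of_ciInf_lt (show z.joinDiam z < d + ε / c by
      rw [← hd]; linarith [show 0 < ε / c by positivity])
    rw [max_self] at ha
    have h2 := hle (X - C a) (natDegree_X_sub_C_le a)
    change w (X - C a) ≤ c * z (X - C a) at h2
    have h3 := BerkovichA1.joinDiam_le z w a
    have h4 : c * (d + ε / c) = c * d + ε := by field_simp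
    have h5 : c * z (X - C a) ≤ c * d + ε := by rw [← h4]; gcongr
    refine h3.trans (max_le ?_ (h2.trans h5))
    refine le_trans ?_ h5
    exact le_mul_of_one_le_left (z.seminorm_nonneg _) h1

theorem formDist_aff {z w : BerkovichA1 F} (hz : 0 < z.joinDiam z) (hw : 0 < w.joinDiam w) :
    formDist (aff z) (aff w) = z.pathDist w := by
  have h1 := hz.trans_le (BerkovichA1.diam_le_joinDiam z w)
  have h2 := hw.trans_le (BerkovichA1.diam_le_joinDiam w z)
  rw [formDist, ratio_aff hz, ratio_aff hw, BerkovichA1.pathDist, Real.log_div h1.ne' hz.ne',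
    Real.log_div h2.ne' hw.ne', BerkovichA1.joinDiam_comm w z]
  ring

end BerkovichP1
end

noncomputable section
open Polynomial
open scoped Pointwise

/-! ## Boundary points of disks -/

namespace BerkovichP1

section Normed

variable {F : Type*} [NormedField F]

theorem pgl_mk_smul (g : GL (Fin 2) F) (p : BerkovichP1 F) :
    (Matrix.ProjGenLinGroup.mk g : PGL(2, F)) • p = g • p := rfl

/-- The values of `p` on all forms are as large as its values on linear forms permit. -/
def IsDominant (p : BerkovichP1 F) : Prop :=
  ∀ (q : BerkovichP1 F) (s : ℝ), 0 < s →
    (∀ L : F[X], L.natDegree ≤ 1 → formAbs q 1 L ≤ s * formAbs p 1 L) →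
    ∀ (n : ℕ) (P : F[X]), P.natDegree ≤ n → formAbs q n P ≤ s ^ n * formAbs p n P

/-- Substitution preserves the degree filtration, and the scaling constants of the two points enter
in degree n with the exponent n, so they are absorbed in the constant s. -/
theorem IsDominant.smul (γ : GL (Fin 2) F) {p : BerkovichP1 F} (hp : IsDominant p) :
    IsDominant (γ • p) := by
  intro q s hs h n P hP
  obtain ⟨a, ha, h1⟩ := exists_formAbs_smul γ p
  obtain ⟨b, hb, h2⟩ := exists_formAbs_smul γ (γ⁻¹ • q)
  rw [smul_inv_smul] at h2
  have key := hp (γ⁻¹ • q) (b * s / a) (by positivity) (fun L hL => by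
    have e := h _ (natDegree_subst γ⁻¹ hL)
    have e1 := h1 1 _ (natDegree_subst γ⁻¹ hL)
    have e2 := h2 1 _ (natDegree_subst γ⁻¹ hL)
    rw [subst_inv_subst γ hL, pow_one] at e1 e2
    rw [e1, e2]
    calc b * formAbs q 1 (subst γ⁻¹ 1 L) ≤ b * (s * formAbs (γ • p) 1 (subst γ⁻¹ 1 L)) := by gcongr
      _ = _ := by field_simp) n _ (natDegree_subst γ hP)
  rw [h1 n P hP, h2 n P hP, div_pow, mul_pow, div_mul_eq_mul_div,
    le_div_iff₀ (by positivity)] at key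
  have hab : 0 < b ^ n * a ^ n := by positivity
  refine le_of_mul_le_mul_left ?_ hab
  linarith

/-- Proportional values on linear forms allow dominance to be used in both directions, with s and
with s⁻¹. Hence the values on all forms are proportional, which determines the point. -/
theorem IsDominant.eq {p q : BerkovichP1 F} (hp : IsDominant p) (hq : IsDominant q) {s : ℝ}
    (hs : 0 < s) (h : ∀ L : F[X], L.natDegree ≤ 1 → formAbs q 1 L ≤ s * formAbs p 1 L)
    (h' : ∀ L : F[X], L.natDegree ≤ 1 → s * formAbs p 1 L ≤ formAbs q 1 L) : p = q := by
  refine (eq_of_formAbs hs fun n P hP => le_antisymm (hp q s hs h n P hP) ?_).symm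
  have := hq p s⁻¹ (by positivity)
    (fun L hL => by rw [le_inv_mul_iff₀ hs]; exact h' L hL) n P hP
  rwa [inv_pow, le_inv_mul_iff₀ (by positivity)] at this

theorem mem_openDisk_iff {p : BerkovichP1 F} {c : F} {t : ℝ} :
    p ∈ openDisk c t ↔ formAbs p 1 (X - C c) < t * formAbs p 1 1 := by
  cases p with
  | infty => simp [openDisk, formAbs, coeff_one]
  | aff z =>
    have h1 : z (1 : F[X]) = 1 := map_one z.seminorm
    simp [openDisk, formAbs, h1]

theorem mem_closedDisk_iff {p : BerkovichP1 F} {c : F} {t : ℝ} :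
    p ∈ closedDisk c t ↔ formAbs p 1 (X - C c) ≤ t * formAbs p 1 1 := by
  cases p with
  | infty =>
    simp [closedDisk, formAbs, coeff_one]
  | aff z =>
    have h1 : z (1 : F[X]) = 1 := map_one z.seminorm
    simp [closedDisk, formAbs, h1]

theorem aff_mem_openDisk_iff {z : BerkovichA1 F} {c : F} {t : ℝ} :
    aff z ∈ openDisk c t ↔ z (X - C c) < t := by
  simp [openDisk]

theorem aff_mem_closedDisk_iff {z : BerkovichA1 F} {c : F} {t : ℝ} :
    aff z ∈ closedDisk c t ↔ z (X - C c) ≤ t := by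
  simp [closedDisk]

theorem infty_notMem_openDisk {c : F} {t : ℝ} : infty ∉ openDisk c t := by
  simp [openDisk]

theorem infty_notMem_closedDisk {c : F} {t : ℝ} : infty ∉ closedDisk c t := by
  simp [closedDisk]

/-- The linear form `u (X - c) + v`. -/
theorem exists_eq_sub (c : F) {L : F[X]} (hL : L.natDegree ≤ 1) :
    ∃ u v : F, L = C u * (X - C c) + C v :=
  ⟨L.coeff 1, L.coeff 0 + L.coeff 1 * c, by
    conv_lhs => rw [eq_X_add_C_of_natDegree_le_one hL]
    simp only [C_add, C_mul]
    ring⟩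

theorem subst_C_mul (γ : GL (Fin 2) F) (n : ℕ) (a : F) {P : F[X]} (hP : P.natDegree ≤ n) :
    subst γ n (C a * P) = C a * subst γ n P := by
  have := subst_mul γ (n := 0) (natDegree_C a).le hP
  rwa [Nat.zero_add, subst_C, pow_zero, mul_one] at this

theorem natDegree_combination_le (u v : F) {L M : F[X]} (hL : L.natDegree ≤ 1)
    (hM : M.natDegree ≤ 1) : (C u * L + C v * M).natDegree ≤ 1 :=
  natDegree_add_le_of_degree_le ((natDegree_C_mul_le _ _).trans hL)
    ((natDegree_C_mul_le _ _).trans hM)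

/-- The matrix of the Möbius transformation `T ↦ a + 1 / T`. -/
def inversionAt (a : F) : GL (Fin 2) F :=
  Matrix.GeneralLinearGroup.mkOfDetNeZero !![a, 1; 1, 0] (by simp [Matrix.det_fin_two])

/-- Under T ↦ a + 1 / T the form u (T - a) + v becomes u + v T after clearing the denominator. -/
theorem exists_formAbs_inversionAt (a : F) (p : BerkovichP1 F) :
    ∃ c : ℝ, 0 < c ∧ ∀ u v : F, formAbs p 1 (C u + C v * X) =
      c * formAbs (inversionAt a • p) 1 (C u * (X - C a) + C v) := by
  obtain ⟨c, hc, h⟩ := exists_formAbs_smul (inversionAt a) p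
  refine ⟨c, hc, fun u v => ?_⟩
  have hd : (C u * (X - C a) + C v : F[X]).natDegree ≤ 1 := by
    simpa using natDegree_combination_le u v (natDegree_X_sub_C_le a)
      (natDegree_one (R := F) |>.le.trans zero_le_one)
  have e := h 1 _ hd
  rw [pow_one] at e
  rw [← e]
  congr 1
  have : (C u * (X - C a) + C v : F[X]) = C u * X ^ 1 + C (v - u * a) := by
    simp only [pow_one, C_sub, C_mul]
    ring
  rw [this, subst_add, subst_monomial _ le_rfl, subst_C]
  simp [num, den, inversionAt, Matrix.GeneralLinearGroup.mkOfDetNeZero]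
  ring

/-- In the coordinate 1 / (T - a), the condition |T - a| > r reads |1 / (T - a)| < 1 / r, which also
covers the point at infinity. -/
theorem compl_closedDisk (a : F) {r : ℝ} (hr : 0 < r) :
    (closedDisk a r)ᶜ = (inversionAt a • ·) '' openDisk (0 : F) r⁻¹ := by
  ext p
  obtain ⟨q, rfl⟩ := MulAction.surjective (inversionAt a) p
  rw [(MulAction.injective (inversionAt a)).mem_set_image]
  obtain ⟨c, hc, h⟩ := exists_formAbs_inversionAt a q
  have h1 := h 1 0
  have h2 := h 0 1
  simp only [C_1, C_0, one_mul, zero_mul, add_zero, zero_add] at h1 h2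
  rw [Set.mem_compl_iff, mem_closedDisk_iff, mem_openDisk_iff, C_0, sub_zero, h1, h2, not_le,
    lt_inv_mul_iff₀ hr, ← mul_assoc, mul_comm r c, mul_assoc, mul_lt_mul_iff_right₀ hc]

end Normed

section Ultrametric

variable {F : Type*} [NormedField F] [IsUltrametricDist F]

theorem formAbs_add_le_max (p : BerkovichP1 F) (n : ℕ) (P Q : F[X]) :
    formAbs p n (P + Q) ≤ max (formAbs p n P) (formAbs p n Q) := by
  cases p with
  | infty => simpa [formAbs] using IsUltrametricDist.norm_add_le_max (P.coeff n) (Q.coeff n)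
  | aff z => exact z.add_le_max P Q

theorem formAbs_sum_le (p : BerkovichP1 F) (n : ℕ) {ι : Type*} (s : Finset ι) (f : ι → F[X])
    {B : ℝ} (hB : 0 ≤ B) (h : ∀ i ∈ s, formAbs p n (f i) ≤ B) :
    formAbs p n (∑ i ∈ s, f i) ≤ B := by
  classical
  induction s using Finset.induction_on with
  | empty => simpa [formAbs_zero] using hB
  | insert i s hi ih =>
    rw [Finset.sum_insert hi]
    exact (formAbs_add_le_max _ _ _ _).trans (max_le (h i (by simp))
      (ih fun j hj => h j (by simp [hj])))

theorem eta_apply (c : F) (r : ℝ) (hr : 0 < r) (P : F[X]) :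
    eta c r hr P = (taylor c P).gaussNorm (NormedField.toAbsoluteValue F) r := rfl

theorem le_eta (c : F) (r : ℝ) (hr : 0 < r) (P : F[X]) (i : ℕ) :
    ‖(taylor c P).coeff i‖ * r ^ i ≤ eta c r hr P :=
  le_gaussNorm (NormedField.toAbsoluteValue F) _ hr.le i

theorem eta_linear (c : F) (r : ℝ) (hr : 0 < r) (u v : F) :
    eta c r hr (C u * (X - C c) + C v) = max (‖u‖ * r) ‖v‖ := by
  have ht : taylor c (C u * (X - C c) + C v) = C u * X + C v := by simp [taylor_mul]
  refine le_antisymm ?_ (max_le ?_ ?_)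
  · refine ((eta c r hr).add_le_max _ _).trans (max_le_max (le_of_eq ?_) (le_of_eq ?_))
    · rw [map_mul, BerkovichA1.map_C, eta_apply]
      have : taylor c (X - C c) = monomial 1 1 := by simp [monomial_one_one_eq_X]
      rw [this, gaussNorm_monomial]
      simp
    · rw [BerkovichA1.map_C]
  · have := le_eta c r hr (C u * (X - C c) + C v) 1
    rw [ht] at this
    simpa using this
  · have := le_eta c r hr (C u * (X - C c) + C v) 0
    rw [ht] at this
    simpa using this

theorem eta_sub_C (c : F) (r : ℝ) (hr : 0 < r) (β : F) :
    eta c r hr (X - C β) = max r ‖β - c‖ := by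
  have : (X - C β : F[X]) = C 1 * (X - C c) + C (c - β) := by simp
  rw [this, eta_linear, norm_one, one_mul, norm_sub_rev]

/-- In the Taylor expansion at c, the monomials are products of the linear forms X - c and 1, whose
values at q are at most s r and s. The ultrametric inequality bounds the sum by the largest term,
and that maximum is the definition of the value at η_{c,r}. -/
theorem isDominant_eta (c : F) (r : ℝ) (hr : 0 < r) : IsDominant (aff (eta c r hr)) := by
  intro q s hs h n P hP
  have h1 : formAbs q 1 1 ≤ s := by
    have := h 1 (by simp)
    rwa [show formAbs (aff (eta c r hr)) 1 1 =
      1 from map_one (eta c r hr).seminorm, mul_one] at this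
  have hX : formAbs q 1 (X - C c) ≤ s * r := by
    have := h (X - C c) (natDegree_X_sub_C_le c)
    have e : formAbs (aff (eta c r hr)) 1 (X - C c) = r := by
      change eta c r hr (X - C c) = r
      rw [eta_sub_C]
      simp [hr.le]
    rwa [e] at this
  have hd : (taylor c P).natDegree ≤ n := by rwa [natDegree_taylor]
  have hP' : P = ∑ i ∈ Finset.range (n + 1), C ((taylor c P).coeff i) * (X - C c) ^ i := by
    conv_lhs => rw [← sum_taylor_eq P c]
    exact sum_over_range' _ (by simp) _ (Nat.lt_succ_of_le hd)
  conv_lhs => rw [hP']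
  refine formAbs_sum_le q n _ _ (mul_nonneg (by positivity) (formAbs_nonneg _ _ _)) fun i hi => ?_
  obtain ⟨m, rfl⟩ := Nat.exists_eq_add_of_le (Nat.lt_succ_iff.mp (Finset.mem_range.mp hi))
  have hdi : ((X - C c) ^ i : F[X]).natDegree ≤ i := by simp
  have hdm : ((1 : F[X]) ^ m).natDegree ≤ m := by simp
  have e : (C ((taylor c P).coeff i) * (X - C c) ^ i : F[X]) =
      C ((taylor c P).coeff i) * ((X - C c) ^ i * 1 ^ m) := by simp
  rw [e, formAbs_C_mul q (i + m) _ (natDegree_mul_le_of_le hdi hdm), formAbs_mul q hdi hdm,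
    formAbs_pow q (natDegree_X_sub_C_le c), formAbs_pow q (by simp)]
  calc ‖(taylor c P).coeff i‖ * (formAbs q 1 (X - C c) ^ i * formAbs q 1 1 ^ m)
      ≤ ‖(taylor c P).coeff i‖ * ((s * r) ^ i * s ^ m) := by
        have := formAbs_nonneg q 1 1
        have := formAbs_nonneg q 1 (X - C c)
        gcongr
    _ = s ^ (i + m) * (‖(taylor c P).coeff i‖ * r ^ i) := by ring
    _ ≤ s ^ (i + m) * formAbs (aff (eta c r hr)) (i + m) P := by
        gcongr
        exact le_eta c r hr P i

theorem eta_congr {c e : F} {r : ℝ} (hr : 0 < r) (h : ‖c - e‖ ≤ r) :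
    aff (eta c r hr) = aff (eta e r hr) := by
  have key : ∀ {c e : F}, ‖c - e‖ ≤ r → ∀ L : F[X], L.natDegree ≤ 1 →
      eta c r hr L ≤ eta e r hr L := by
    intro c e h L hL
    obtain ⟨u, v, rfl⟩ := exists_eq_sub e hL
    rw [eta_linear]
    refine ((eta c r hr).add_le_max _ _).trans (max_le_max ?_ ?_)
    · rw [map_mul, BerkovichA1.map_C, eta_sub_C, norm_sub_rev, max_eq_left h]
    · rw [BerkovichA1.map_C]
  refine (isDominant_eta c r hr).eq (isDominant_eta e r hr) one_pos (fun L hL => ?_)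
    (fun L hL => ?_)
  · rw [one_mul]
    exact key (by rwa [norm_sub_rev]) L hL
  · rw [one_mul]
    exact key h L hL

/-- `U` is an open disk with boundary point `p`. -/
def IsOpenBoundary (U : Set (BerkovichP1 F)) (p : BerkovichP1 F) : Prop :=
  ∃ (h : GL (Fin 2) F) (c : F) (r : ℝ) (hr : 0 < r),
    U = (h • ·) '' openDisk c r ∧ p = h • aff (eta c r hr)

theorem IsOpenBoundary.smul {U : Set (BerkovichP1 F)} {p : BerkovichP1 F}
    (h : IsOpenBoundary U p) (γ : GL (Fin 2) F) : IsOpenBoundary ((γ • ·) '' U) (γ • p) := by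
  obtain ⟨h, c, r, hr, rfl, rfl⟩ := h
  refine ⟨γ * h, c, r, hr, ?_, by rw [mul_smul]⟩
  rw [Set.image_image]
  simp only [mul_smul]

/-- Both points are dominant, so it is enough to compare linear forms, where each side is an
explicit maximum of two terms. -/
theorem inversionAt_smul_eta (a : F) {r : ℝ} (hr : 0 < r) :
    inversionAt a • aff (eta 0 r⁻¹ (inv_pos.mpr hr)) = aff (eta a r hr) := by
  obtain ⟨c, hc, h⟩ := exists_formAbs_inversionAt a (aff (eta 0 r⁻¹ (inv_pos.mpr hr)))
  have key : ∀ L : F[X], L.natDegree ≤ 1 → formAbs (aff (eta a r hr)) 1 L =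
      (r * c) * formAbs (inversionAt a • aff (eta 0 r⁻¹ (inv_pos.mpr hr))) 1 L := by
    intro L hL
    obtain ⟨u, v, rfl⟩ := exists_eq_sub a hL
    rw [mul_assoc, ← h]
    have e : (C u + C v * X : F[X]) = C v * (X - C 0) + C u := by simp [add_comm]
    rw [e]
    change eta a r hr _ = r * eta 0 r⁻¹ _ _
    rw [eta_linear, eta_linear, mul_max_of_nonneg _ _ hr.le, max_comm, mul_comm r ‖u‖]
    congr 1
    field_simp
  exact ((isDominant_eta _ _ _).smul _).eq (isDominant_eta _ _ _) (by positivity)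
    (fun L hL => (key L hL).le) (fun L hL => (key L hL).ge)

/-- The inversion at the center exhibits the complement as an open disk and carries η_{0,1/r} to
η_{a,r}. -/
theorem IsBoundaryPoint.compl {D : Set (BerkovichP1 F)} {p : BerkovichP1 F}
    (h : IsBoundaryPoint D p) : IsOpenBoundary Dᶜ p := by
  obtain ⟨h, a, r, hr, rfl, rfl⟩ := h
  obtain ⟨h, rfl⟩ := Matrix.ProjGenLinGroup.mk_surjective h
  simp only [pgl_mk_smul]
  rw [← Set.image_compl_eq (MulAction.bijective h), compl_closedDisk a hr,
    ← inversionAt_smul_eta a hr]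
  exact IsOpenBoundary.smul ⟨_, _, _, _, rfl, rfl⟩ h

/-- An open disk which does not contain `∞` is a disk with respect to the standard coordinate. -/
theorem IsOpenBoundary.exists_eq {U : Set (BerkovichP1 F)} {p : BerkovichP1 F}
    (hU : IsOpenBoundary U p) (hinf : infty ∉ U) :
    ∃ (e : F) (t : ℝ) (ht : 0 < t), U = openDisk e t ∧ p = aff (eta e t ht) := by
  obtain ⟨h, c, r, hr, rfl, rfl⟩ := hU
  set L₁ := subst h⁻¹ 1 (X - C c) with hL₁
  set L₂ := subst h⁻¹ 1 (1 : F[X]) with hL₂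
  have hd₁ : L₁.natDegree ≤ 1 := natDegree_subst _ (natDegree_X_sub_C_le c)
  have hd₂ : L₂.natDegree ≤ 1 := natDegree_subst _ (by simp)
  have hlin : ∀ u v : F, subst h⁻¹ 1 (C u * (X - C c) + C v) = C u * L₁ + C v * L₂ := by
    intro u v
    have h1 := subst_C_mul h⁻¹ 1 v (P := 1) (by simp)
    rw [mul_one] at h1
    rw [subst_add, subst_C_mul _ _ _ (natDegree_X_sub_C_le c), h1]
  have hind : ∀ u v : F, C u * L₁ + C v * L₂ = 0 → u = 0 ∧ v = 0 := by
    intro u v huv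
    have hd : (C u * (X - C c) + C v : F[X]).natDegree ≤ 1 := by
      simpa using natDegree_combination_le u v (natDegree_X_sub_C_le c)
        (natDegree_one (R := F) |>.le.trans zero_le_one)
    have e := subst_inv_subst h hd
    rw [hlin, huv, subst_zero] at e
    have e1 := congrArg (fun P => coeff P 1) e
    have e0 := congrArg (fun P => coeff P 0) e
    simp [coeff_C] at e1 e0
    rw [← e1] at e0
    simp at e0
    exact ⟨e1.symm, e0.symm⟩
  have hspan : ∀ L : F[X], L.natDegree ≤ 1 → ∃ u v, L = C u * L₁ + C v * L₂ := by
    intro L hL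
    obtain ⟨u, v, huv⟩ := exists_eq_sub c (natDegree_subst h hL)
    refine ⟨u, v, ?_⟩
    have e := subst_inv_subst h⁻¹ hL
    rw [inv_inv] at e
    rw [← hlin, ← huv, e]
  have hmem : ∀ p, p ∈ (h • ·) '' openDisk c r ↔ formAbs p 1 L₁ < r * formAbs p 1 L₂ := by
    intro p
    obtain ⟨q, rfl⟩ := MulAction.surjective h p
    rw [(MulAction.injective h).mem_set_image, mem_openDisk_iff]
    obtain ⟨s, hs, e⟩ := exists_formAbs_smul h⁻¹ (h • q)
    rw [inv_smul_smul] at e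
    rw [hL₁, hL₂, e 1 _ (natDegree_X_sub_C_le c), e 1 1 (by simp), pow_one, mul_left_comm,
      mul_lt_mul_iff_right₀ hs]
  have hηL : ∃ s, 0 < s ∧ ∀ u v : F, formAbs (h • aff (eta c r hr)) 1 (C u * L₁ + C v * L₂) =
      s * max (‖u‖ * r) ‖v‖ := by
    obtain ⟨s, hs, e⟩ := exists_formAbs_smul h⁻¹ (h • aff (eta c r hr))
    rw [inv_smul_smul] at e
    refine ⟨s, hs, fun u v => ?_⟩
    have hd : (C u * (X - C c) + C v : F[X]).natDegree ≤ 1 := by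
      simpa using natDegree_combination_le u v (natDegree_X_sub_C_le c)
        (natDegree_one (R := F) |>.le.trans zero_le_one)
    rw [← hlin, e 1 _ hd, pow_one]
    congr 1
    exact eta_linear c r hr u v
  obtain ⟨s, hs, hη⟩ := hηL
  set η := h • aff (eta c r hr) with hηdef
  have hηdom : IsDominant η := (isDominant_eta c r hr).smul h
  clear_value η L₁ L₂
  -- The value of a linear form at infinity is the absolute value of its leading coefficient. That
  -- infinity lies outside the disk is therefore an inequality between leading coefficients, and it
  -- makes L₂ have the constant value ‖l‖ on the disk |X - e| < r ‖l‖ / ‖α‖ below.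
  have hα0 : r * ‖L₂.coeff 1‖ ≤ ‖L₁.coeff 1‖ := by
    have := (hmem infty).not.mp hinf
    rwa [not_lt] at this
  set α := L₁.coeff 1 with hα
  set κ := L₂.coeff 1 with hκ
  have hαne : α ≠ 0 := by
    intro h0
    have hκ0 : κ = 0 := by
      rw [h0, norm_zero] at hα0
      have : ‖κ‖ ≤ 0 := by nlinarith [norm_nonneg κ]
      simpa using this
    have e1 := eq_X_add_C_of_natDegree_le_one hd₁
    have e2 := eq_X_add_C_of_natDegree_le_one hd₂
    rw [← hα, h0] at e1
    rw [← hκ, hκ0] at e2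
    have := hind (L₂.coeff 0) (-L₁.coeff 0) (by
      rw [e1, e2]
      simp
      ring)
    have h3 := hind 1 0 (by rw [e1, neg_eq_zero.mp this.2]; simp)
    exact one_ne_zero h3.1
  -- The new center e is the root of L₁, and l is the value of L₂ there.
  set e := -L₁.coeff 0 / α with he
  set l := L₂.coeff 0 + κ * e with hl
  have e1 : L₁ = C α * (X - C e) := by
    conv_lhs => rw [eq_X_add_C_of_natDegree_le_one hd₁]
    rw [mul_sub, ← C_mul, he, mul_div_cancel₀ _ hαne]
    simp [hα]
  have e2 : L₂ = C κ * (X - C e) + C l := by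
    conv_lhs => rw [eq_X_add_C_of_natDegree_le_one hd₂]
    rw [hl, C_add, C_mul]
    ring
  have hl0 : l ≠ 0 := by
    intro h0
    have := hind κ (-α) (by rw [e1, e2, h0]; simp; ring)
    exact hαne (neg_eq_zero.mp this.2)
  have hαp : 0 < ‖α‖ := norm_pos_iff.mpr hαne
  have hlp : 0 < ‖l‖ := norm_pos_iff.mpr hl0
  have ht : 0 < r * ‖l‖ / ‖α‖ := by positivity
  refine ⟨e, r * ‖l‖ / ‖α‖, ht, ?_, ?_⟩
  · ext p
    rw [hmem]
    cases p with
    | infty =>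
      rw [← not_iff_not]
      exact iff_of_true (by rw [← hmem]; exact hinf) infty_notMem_openDisk
    | aff z =>
      rw [aff_mem_openDisk_iff]
      change z L₁ < r * z L₂ ↔ _
      rw [e1, map_mul, z.map_C, lt_div_iff₀ hαp, mul_comm _ ‖α‖]
      have hz := z.seminorm_nonneg (X - C e)
      have b1 : z L₂ ≤ max (‖κ‖ * z (X - C e)) ‖l‖ := by
        have := z.add_le_max (C κ * (X - C e)) (C l)
        rwa [map_mul, z.map_C, z.map_C, ← e2] at this
      have b2 : ‖l‖ ≤ max (z L₂) (‖κ‖ * z (X - C e)) := by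
        have := z.add_le_max L₂ (-(C κ * (X - C e)))
        rw [map_neg_eq_map, map_mul, z.map_C] at this
        refine le_trans (le_of_eq ?_) this
        rw [← z.map_C, e2]
        congr 1
        ring
      have b3 : r * (‖κ‖ * z (X - C e)) ≤ ‖α‖ * z (X - C e) := by
        rw [← mul_assoc]; gcongr
      constructor
      · intro hlt
        rcases le_max_iff.mp b1 with hb | hb
        · nlinarith
        · nlinarith
      · intro hlt
        rcases le_max_iff.mp b2 with hb | hb
        · nlinarith
        · nlinarith
  · have hX : formAbs η 1 (X - C e) = s * r / ‖α‖ := by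
      have := hη 1 0
      rw [C_0, C_1, zero_mul, one_mul, add_zero, e1,
        formAbs_C_mul _ _ _ (natDegree_X_sub_C_le e)] at this
      rw [eq_div_iff hαp.ne', mul_comm, this]
      simp [hr.le]
    have h1 : formAbs η 1 1 = s / ‖l‖ := by
      have := hη (-κ / α) 1
      have e3 : C (-κ / α) * L₁ + C 1 * L₂ = C l * 1 := by
        rw [e1, e2, ← mul_assoc, ← C_mul, div_mul_cancel₀ _ hαne]
        simp
      rw [e3, formAbs_C_mul _ _ _ (by simp), norm_one, norm_div, norm_neg, max_eq_right, mul_one]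
        at this
      · rw [eq_div_iff hlp.ne', mul_comm, this]
      · rw [div_mul_eq_mul_div, div_le_one hαp, mul_comm]
        exact hα0
    -- Each of the two inequalities is checked in the basis of linear forms for which its larger
    -- side is exactly a maximum: X - e and 1 for η_{e,t}, then L₁ and L₂ for the given point.
    refine ((isDominant_eta _ _ _).eq hηdom (s := s / ‖l‖) (by positivity) (fun L hL => ?_)
      (fun L hL => ?_)).symm
    · obtain ⟨u, v, rfl⟩ := exists_eq_sub e hL
      refine (formAbs_add_le_max _ _ _ _).trans ?_
      change _ ≤ s / ‖l‖ * eta _ _ _ _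
      rw [eta_linear, formAbs_C_mul _ _ _ (natDegree_X_sub_C_le e), ← mul_one (C v),
        formAbs_C_mul _ _ _ (by simp), hX, h1, mul_max_of_nonneg _ _ (by positivity)]
      refine max_le_max (le_of_eq ?_) (le_of_eq ?_)
      · field_simp
      · ring
    · obtain ⟨u, v, rfl⟩ := hspan L hL
      rw [hη, div_mul_eq_mul_div, div_le_iff₀ hlp, mul_assoc]
      refine mul_le_mul_of_nonneg_left ?_ hs.le
      refine (formAbs_add_le_max _ _ _ _).trans ?_
      rw [formAbs_C_mul _ _ _ hd₁, formAbs_C_mul _ _ _ hd₂, max_mul_of_nonneg _ _ hlp.le]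
      refine max_le_max ?_ ?_
      · rw [mul_assoc]
        gcongr
        have : L₁ = C α * (X - C e) + C 0 := by rw [C_0, add_zero, e1]
        rw [this]
        change eta _ _ _ _ ≤ _
        rw [eta_linear]
        refine max_le (le_of_eq ?_) ?_
        · field_simp
        · rw [norm_zero]; positivity
      · gcongr
        rw [e2]
        change eta _ _ _ _ ≤ _
        rw [eta_linear]
        refine max_le ?_ le_rfl
        rw [← mul_div_assoc, div_le_iff₀ hαp, ← mul_assoc, mul_comm ‖κ‖ r, mul_comm ‖l‖]
        gcongr

/-- The points η_{e,s} with s < t serve as test points. They exist for every real s > 0, so the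
value group of the field plays no role. -/
theorem openDisk_subset_closedDisk {e a : F} {t r : ℝ} (ht : 0 < t)
    (h : openDisk e t ⊆ closedDisk a r) : t ≤ r ∧ ‖a - e‖ ≤ r := by
  have key : ∀ s, 0 < s → s < t → s ≤ r ∧ ‖a - e‖ ≤ r := by
    intro s hs hst
    have h1 : aff (eta e s hs) ∈ openDisk e t := by
      rw [aff_mem_openDisk_iff, eta_sub_C]
      simp [hst, ht]
    have h2 := h h1
    rw [aff_mem_closedDisk_iff, eta_sub_C] at h2
    exact max_le_iff.mp h2
  refine ⟨le_of_forall_lt_imp_le_of_dense fun s hs => ?_,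
    (key (t / 2) (by linarith) (by linarith)).2⟩
  rcases le_or_gt s 0 with h0 | h0
  · exact h0.trans ((half_pos ht).le.trans (key (t / 2) (by linarith) (by linarith)).1)
  · exact (key s h0 hs).1

theorem openDisk_subset_closedDisk_of_le {e a : F} {t r : ℝ} (ht : t ≤ r) (h : ‖a - e‖ ≤ r) :
    openDisk e t ⊆ closedDisk a r := by
  rintro _ ⟨z, rfl, hz⟩
  rw [aff_mem_closedDisk_iff]
  refine (z.map_sub_C_le a e).trans (max_le (hz.le.trans ht) ?_)
  rwa [norm_sub_rev]

/-- The boundary point of a closed disk is also the boundary point of its maximal open disks. -/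
theorem IsBoundaryPoint.eq_of_isMaximalOpenDisk {D U : Set (BerkovichP1 F)} {p q : BerkovichP1 F}
    (hp : IsBoundaryPoint D p) (hU : IsMaximalOpenDisk U D) (hq : IsOpenBoundary U q) : p = q := by
  obtain ⟨h, a, r, hr, rfl, rfl⟩ := hp
  obtain ⟨h, rfl⟩ := Matrix.ProjGenLinGroup.mk_surjective h
  simp only [pgl_mk_smul] at hU ⊢
  have hsub : (h⁻¹ • ·) '' U ⊆ closedDisk a r := by
    rintro _ ⟨x, hx, rfl⟩
    obtain ⟨y, hy, rfl⟩ := hU.prop.2 hx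
    simpa using hy
  obtain ⟨e, t, ht, h1, h2⟩ := (hq.smul h⁻¹).exists_eq fun hinf =>
    infty_notMem_closedDisk (hsub hinf)
  rw [h1] at hsub
  obtain ⟨htr, hea⟩ := openDisk_subset_closedDisk ht hsub
  have hUe : U = (h • ·) '' openDisk e t := by
    rw [← h1, Set.image_image]
    simp
  -- The open disk with the same center and the full radius r still lies in the closed disk, so
  -- maximality forces t = r.
  have hle := hU.le_of_ge (y := (h • ·) '' openDisk e r)
    ⟨⟨Matrix.ProjGenLinGroup.mk h, e, r, hr, rfl⟩,
      Set.image_mono (openDisk_subset_closedDisk_of_le le_rfl hea)⟩ (by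
        rw [hUe]
        refine Set.image_mono ?_
        rintro _ ⟨z, rfl, hz⟩
        exact aff_mem_openDisk_iff.mpr (hz.trans_le htr))
  rw [hUe] at hle
  have hle' : openDisk e r ⊆ openDisk e t :=
    (Set.image_subset_image_iff (MulAction.injective h)).mp hle
  have hrt := (openDisk_subset_closedDisk hr (hle'.trans
    (openDisk_subset_closedDisk_of_le (a := e) (r := t) le_rfl (by simpa using ht.le)))).1
  obtain rfl := le_antisymm hrt htr
  rw [eta_congr hr hea, ← h2, smul_inv_smul]

theorem IsOpenBoundary.smul_pgl {U : Set (BerkovichP1 F)} {p : BerkovichP1 F}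
    (h : IsOpenBoundary U p) (γ : PGL(2, F)) : IsOpenBoundary ((γ • ·) '' U) (γ • p) := by
  obtain ⟨γ, rfl⟩ := Matrix.ProjGenLinGroup.mk_surjective γ
  exact h.smul γ

end Ultrametric

end BerkovichP1

/-! ### Boundary points of a Schottky figure -/

section SchottkyBoundary

open BerkovichP1

variable {k : Type*} [NormedField k] [IsUltrametricDist k] {g : ℕ} {γ : Fin g → PGL(2, k)}
  {D Do : Letter g → Set (BerkovichP1 k)} {b : Letter g → BerkovichP1 k}

/-- The letter a maps the complement of D(a⁻¹), an open disk with the same boundary point as D(a⁻¹),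
onto the maximal open disk of D(a), and a maximal open disk shares the boundary point of its closed
disk. -/
theorem IsSchottkyFigure.smul_boundary (hfig : IsSchottkyFigure γ D Do)
    (hb : ∀ a, IsBoundaryPoint (D a) (b a)) (a : Letter g) : a.val γ • b a.inv = b a := by
  refine ((hb a).eq_of_isMaximalOpenDisk (hfig.isMaximalOpenDisk a) ?_).symm
  rw [← hfig.image_compl a]
  exact (hb a.inv).compl.smul_pgl _

theorem IsSchottkyFigure.isOpenBoundary (hfig : IsSchottkyFigure γ D Do)
    (hb : ∀ a, IsBoundaryPoint (D a) (b a)) (a : Letter g) : IsOpenBoundary (Do a) (b a) := by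
  rw [← hfig.image_compl a, ← hfig.smul_boundary hb a]
  exact (hb a.inv).compl.smul_pgl _

end SchottkyBoundary
end

noncomputable section
open Polynomial
open scoped Pointwise

/-! ## Restriction of points to a subfield -/

section Restrict

variable {F K : Type*} [NormedField F] [NormedField K] [NormedAlgebra F K]

/-- The point of the affine line over `F` below a point of the affine line over `K`. -/
def BerkovichA1.restrict (F : Type*) {K : Type*} [NormedField F] [NormedField K]
    [NormedAlgebra F K] (w : BerkovichA1 K) : BerkovichA1 F where
  seminorm :=
    { toFun := fun P => w (P.map (algebraMap F K))
      map_zero' := by simp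
      map_one' := by simp
      map_mul' := fun P Q => by simp
      neg' := fun P => by simp
      add_le' := fun P Q => by
        rw [Polynomial.map_add]
        exact map_add_le_add w.seminorm _ _ }
  map_C := fun a => by
    change w ((C a).map (algebraMap F K)) = ‖a‖
    rw [Polynomial.map_C, w.map_C, norm_algebraMap']

namespace BerkovichP1

/-- The point of the projective line over `F` below a point of the projective line over `K`. -/
def restrict (F : Type*) {K : Type*} [NormedField F] [NormedField K] [NormedAlgebra F K] :
    BerkovichP1 K → BerkovichP1 F
  | infty => infty
  | aff w => aff (w.restrict F)

theorem formAbs_restrict (p : BerkovichP1 K) (n : ℕ) (P : F[X]) :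
    formAbs (restrict F p) n P = formAbs p n (P.map (algebraMap F K)) := by
  cases p with
  | infty => simp [restrict, formAbs]
  | aff w => rfl

theorem map_subst (γ : GL (Fin 2) F) {n : ℕ} {P : F[X]} (hP : P.natDegree ≤ n) :
    (subst γ n P).map (algebraMap F K) =
      subst (γ.map (algebraMap F K)) n (P.map (algebraMap F K)) := by
  refine Polynomial.induction_with_natDegree_le (fun P => (subst γ n P).map (algebraMap F K) =
      subst (γ.map (algebraMap F K)) n (P.map (algebraMap F K))) n ?_ ?_ ?_ P hP
  · simp [subst_zero]
  · intro i a ha hi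
    have h := subst_monomial (γ.map (algebraMap F K)) hi (algebraMap F K a)
    simp only [Polynomial.map_mul, Polynomial.map_pow, Polynomial.map_C, map_X,
      subst_monomial γ hi, h]
    simp [num, den]
  · intro P Q hPQ hQ h1 h2
    rw [subst_add, Polynomial.map_add, Polynomial.map_add, subst_add, h1, h2]

theorem restrict_smul (γ : GL (Fin 2) F) (p : BerkovichP1 K) :
    restrict F (γ.map (algebraMap F K) • p) = γ • restrict F p := by
  obtain ⟨a, ha, h1⟩ := exists_formAbs_smul γ (restrict F p)
  obtain ⟨b, hb, h2⟩ := exists_formAbs_smul (γ.map (algebraMap F K)) p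
  refine eq_of_formAbs (c := a / b) (by positivity) fun n P hP => ?_
  have e1 := h1 n P hP
  have e2 := h2 n (P.map (algebraMap F K)) (natDegree_map_le.trans hP)
  rw [formAbs_restrict, map_subst γ hP, e2] at e1
  rw [formAbs_restrict, div_pow, div_mul_eq_mul_div, ← e1,
    mul_div_cancel_left₀ _ (by positivity)]

end BerkovichP1

end Restrict

/-! ## Points above a given point -/

section Lifts

variable {k : Type*} [NontriviallyNormedField k] [CompleteSpace k] [IsUltrametricDist k]

instance : IsUltrametricDist (CompletedAlgClosure k) := IsUltrametricDist.of_normedAlgebra k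

theorem norm_algebraicClosure_eq (x : AlgebraicClosure k) :
    ‖x‖ = spectralNorm k (AlgebraicClosure k) x := rfl

/-- An isometric embedding of `k` into a complete field extends to the completed algebraic
closures. -/
theorem exists_isometric_ringHom {H : Type*} [NontriviallyNormedField H] [CompleteSpace H]
    [IsUltrametricDist H] (φ : k →+* H) (hφ : ∀ a, ‖φ a‖ = ‖a‖) :
    ∃ ψ : CompletedAlgClosure k →+* CompletedAlgClosure H, (∀ x, ‖ψ x‖ = ‖x‖) ∧
      ∀ a : k, ψ (algebraMap k _ a) = algebraMap H _ (φ a) := by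
  let _ : Algebra k (AlgebraicClosure H) := ((algebraMap H (AlgebraicClosure H)).comp φ).toAlgebra
  let j : AlgebraicClosure k →ₐ[k] AlgebraicClosure H := IsAlgClosed.lift
  -- The norm pulled back along `j` is multiplicative and extends that of k, and over a complete
  -- field such an extension to an algebraic extension is unique.
  have hj : ∀ x, ‖j x‖ = ‖x‖ := by
    let f : AbsoluteValue (AlgebraicClosure k) ℝ :=
      { toFun := fun x => ‖j x‖
        map_mul' := by simp
        nonneg' := by simp
        eq_zero' := by simp
        add_le' := fun x y => by
          rw [map_add]
          exact norm_add_le _ _ }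
    intro x
    refine spectralNorm_unique_field_norm_ext (f := f) (fun a => ?_) x
    change ‖j (algebraMap k _ a)‖ = ‖a‖
    rw [j.commutes]
    change ‖algebraMap H (AlgebraicClosure H) (φ a)‖ = _
    rw [norm_algebraMap', hφ]
  have hiso : Isometry j.toRingHom := AddMonoidHomClass.isometry_of_norm j.toRingHom hj
  refine ⟨UniformSpace.Completion.mapRingHom j.toRingHom hiso.continuous, fun x => ?_, fun a => ?_⟩
  · induction x using UniformSpace.Completion.induction_on with
    | hp =>
      refine isClosed_eq (Continuous.norm ?_) continuous_norm
      exact UniformSpace.Completion.continuous_map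
    | ih x =>
      rw [UniformSpace.Completion.mapRingHom_coe, UniformSpace.Completion.norm_coe,
        UniformSpace.Completion.norm_coe]
      exact hj x
  · change UniformSpace.Completion.mapRingHom j.toRingHom hiso.continuous
      ((algebraMap k (AlgebraicClosure k) a : AlgebraicClosure k) : CompletedAlgClosure k) = _
    rw [UniformSpace.Completion.mapRingHom_coe]
    change ((j (algebraMap k (AlgebraicClosure k) a) : AlgebraicClosure H) :
      CompletedAlgClosure H) = _
    rw [j.commutes]
    rfl

/-- The evaluation of polynomials at a point of a normed extension field. -/
def BerkovichA1.ofEval {F L : Type*} [NormedField F] [NormedField L] (ψ : F →+* L)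
    (hψ : ∀ x, ‖ψ x‖ = ‖x‖) (τ : L) : BerkovichA1 F where
  seminorm :=
    { toFun := fun P => ‖P.eval₂ ψ τ‖
      map_zero' := by simp
      map_one' := by simp
      map_mul' := fun P Q => by simp [eval₂_mul]
      neg' := fun P => by simp
      add_le' := fun P Q => by
        rw [eval₂_add]
        exact norm_add_le _ _ }
  map_C := fun a => by
    change ‖(C a).eval₂ ψ τ‖ = ‖a‖
    rw [eval₂_C, hψ]

/-- Every point of the affine line over `k` is the evaluation at a point of some complete extension
of `k`. -/
theorem BerkovichA1.exists_eval.{u} {k : Type u} [NontriviallyNormedField k] [IsUltrametricDist k]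
    (z : BerkovichA1 k) :
    ∃ (H : Type u) (_ : NontriviallyNormedField H) (_ : CompleteSpace H)
      (_ : IsUltrametricDist H) (φ : k →+* H) (τ : H), (∀ a, ‖φ a‖ = ‖a‖) ∧
      ∀ P : k[X], z P = ‖P.eval₂ φ τ‖ := by
  -- The seminorm is a valuation on k[X]. Its kernel is divided out, and the fraction field of the
  -- quotient is completed; τ is the class of X.
  let v₀ : Valuation k[X] NNReal :=
    { toFun := fun P => ⟨z P, z.seminorm_nonneg P⟩
      map_zero' := by ext; exact map_zero z.seminorm
      map_one' := by ext; exact map_one z.seminorm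
      map_mul' := fun P Q => by ext; exact map_mul z.seminorm P Q
      map_add_le_max' := fun P Q => z.add_le_max P Q }
  let Q := k[X] ⧸ v₀.supp
  let v₁ : Valuation Q NNReal := v₀.onQuot le_rfl
  have hS : nonZeroDivisors Q ≤ v₁.supp.primeCompl := by
    intro x hx hx'
    have h0 : v₁.supp = 0 := Valuation.supp_quot_supp v₀
    rw [h0] at hx'
    exact nonZeroDivisors.ne_zero hx (by simpa using hx')
  let v : Valuation (FractionRing Q) NNReal := v₁.extendToLocalization hS (FractionRing Q)
  let f : AbsoluteValue (FractionRing Q) ℝ :=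
    { toFun := fun x => v x
      map_mul' := by simp
      nonneg' := by simp
      eq_zero' := by simp
      add_le' := fun x y => by
        have h1 : v (x + y) ≤ max (v x) (v y) := v.map_add x y
        have h2 : max (v x) (v y) ≤ v x + v y :=
          max_le (le_add_of_nonneg_right zero_le) (le_add_of_nonneg_left zero_le)
        exact_mod_cast h1.trans h2 }
  let ι : k[X] →+* f.Completion := UniformSpace.Completion.coeRingHom.comp
    (((WithAbs.equiv f).symm.toRingHom.comp (algebraMap Q (FractionRing Q))).comp
      (Ideal.Quotient.mk v₀.supp))
  have hι : ∀ P, ‖ι P‖ = z P := by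
    intro P
    have h1 : ‖ι P‖ = f (algebraMap Q (FractionRing Q) (Ideal.Quotient.mk v₀.supp P)) :=
      UniformSpace.Completion.norm_coe _
    rw [h1]
    change ((v₁.extendToLocalization hS (FractionRing Q) (algebraMap Q (FractionRing Q)
      (Ideal.Quotient.mk v₀.supp P)) : NNReal) : ℝ) = z P
    rw [Valuation.extendToLocalization_apply_map_apply]
    rfl
  let φ : k →+* f.Completion := ι.comp C
  have hφ : ∀ a, ‖φ a‖ = ‖a‖ := fun a => (hι (C a)).trans (z.map_C a)
  -- The norm on the completion is non-trivial because that of k is.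
  have hnon : ∃ x : f.Completion, x ≠ 0 ∧ ‖x‖ ≠ 1 := by
    obtain ⟨a, ha⟩ := NormedField.exists_one_lt_norm k
    refine ⟨φ a, fun h => ?_, by rw [hφ]; exact ha.ne'⟩
    have := hφ a
    rw [h, norm_zero] at this
    linarith
  refine ⟨f.Completion, NontriviallyNormedField.ofNormNeOne hnon, inferInstance,
    IsUltrametricDist.isUltrametricDist_of_forall_norm_natCast_le_one fun n => ?_, φ, ι X, hφ,
    fun P => ?_⟩
  · have := hφ n
    rw [map_natCast] at this
    refine le_trans (le_of_eq this) (IsUltrametricDist.norm_natCast_le_one k n)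
  · refine (hι P).symm.trans ?_
    congr 1
    have : eval₂RingHom φ (ι X) = ι := by
      ext <;> simp [φ]
    exact (congrArg (fun r => r P) this).symm

/-- If z is evaluation at τ in a complete field H, the completed algebraic closure of k embeds
isometrically in that of H, and evaluation at τ makes sense over the larger field. -/
theorem BerkovichA1.exists_restrict_eq (z : BerkovichA1 k) :
    ∃ w : BerkovichA1 (CompletedAlgClosure k), w.restrict k = z := by
  obtain ⟨H, _, _, _, φ, τ, hφ, hz⟩ := z.exists_eval
  obtain ⟨ψ, hψ, hψφ⟩ := exists_isometric_ringHom φ hφ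
  refine ⟨.ofEval ψ hψ (algebraMap H (CompletedAlgClosure H) τ), BerkovichA1.ext' fun P => ?_⟩
  rw [hz]
  change ‖(P.map (algebraMap k _)).eval₂ ψ _‖ = _
  have : ψ.comp (algebraMap k _) = (algebraMap H (CompletedAlgClosure H)).comp φ :=
    RingHom.ext hψφ
  rw [eval₂_map, this, ← hom_eval₂, norm_algebraMap']

theorem BerkovichP1.exists_restrict_eq (p : BerkovichP1 k) :
    ∃ u : BerkovichP1 (CompletedAlgClosure k), restrict k u = p := by
  cases p with
  | infty => exact ⟨infty, rfl⟩
  | aff z =>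
    obtain ⟨w, rfl⟩ := z.exists_restrict_eq
    exact ⟨aff w, rfl⟩

/-- A point of diameter zero over a complete field is a point of the field. -/
theorem BerkovichA1.exists_eq_norm_eval {K : Type*} [NormedField K] [CompleteSpace K]
    [IsUltrametricDist K] {w : BerkovichA1 K} (hw : w.joinDiam w ≤ 0) :
    ∃ c : K, ∀ P : K[X], w P = ‖P.eval c‖ := by
  have hlt : ∀ n : ℕ, ∃ a : K, w (X - C a) < 1 / ((n : ℝ) + 1) := fun n => by
    have := exists_lt_of_ciInf_lt (hw.trans_lt (Nat.one_div_pos_of_nat (α := ℝ) (n := n)))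
    simpa using this
  choose a ha using hlt
  have hcauchy : CauchySeq a := by
    refine cauchySeq_of_le_tendsto_0 (fun n : ℕ => 1 / ((n : ℝ) + 1)) (fun n m N hn hm => ?_)
      tendsto_one_div_add_atTop_nhds_zero_nat
    rw [dist_eq_norm]
    refine (w.norm_sub_le _ _).trans (max_le ?_ ?_)
    · exact (ha m).le.trans (Nat.one_div_le_one_div hm)
    · exact (ha n).le.trans (Nat.one_div_le_one_div hn)
  obtain ⟨c, hc⟩ := cauchySeq_tendsto_of_complete hcauchy
  have h0 : w (X - C c) = 0 := by
    refine le_antisymm ?_ (w.seminorm_nonneg _)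
    have h1 : Filter.Tendsto (fun n : ℕ => 1 / ((n : ℝ) + 1) + ‖a n - c‖)
      Filter.atTop (nhds 0) := by
      simpa using tendsto_one_div_add_atTop_nhds_zero_nat.add
        (tendsto_iff_norm_sub_tendsto_zero.mp hc)
    refine ge_of_tendsto' h1 fun n => (w.map_sub_C_le c (a n)).trans (max_le ?_ ?_)
    · linarith [ha n, norm_nonneg (a n - c)]
    · linarith [Nat.one_div_pos_of_nat (α := ℝ) (n := n)]
  refine ⟨c, fun P => ?_⟩
  -- The seminorm kills X - c, hence P - P(c), and so it depends on P(c) only.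
  obtain ⟨Q, hQ⟩ := X_sub_C_dvd_sub_C_eval (a := c) (p := P)
  have h1 : w (P - C (P.eval c)) = 0 := by rw [hQ, map_mul, h0, zero_mul]
  rw [← w.map_C]
  refine le_antisymm ?_ ?_
  · have := map_add_le_add w.seminorm (P - C (P.eval c)) (C (P.eval c))
    rwa [sub_add_cancel, h1, zero_add] at this
  · have := map_add_le_add w.seminorm (-(P - C (P.eval c))) P
    rwa [map_neg_eq_map, h1, zero_add, neg_sub, sub_add_cancel] at this

open BerkovichP1

/-- The points of the hyperbolic space, in terms of the norms on linear forms above them. -/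
def BerkovichP1.IsHyperbolic (p : BerkovichP1 k) : Prop :=
  ∀ u : BerkovichP1 (CompletedAlgClosure k), restrict k u = p → IsNormLike u

/-- A lift that is not norm-like is either infinity or a point of diameter zero; the latter is a
rational point by completeness, so in both cases p is of type 1. -/
theorem BerkovichP1.isHyperbolic_of_mem {p : BerkovichP1 k} (hp : p ∈ hyperbolicSpace k) :
    IsHyperbolic p := by
  rintro u rfl
  cases u with
  | infty => exact (hp trivial).elim
  | aff w =>
    rw [isNormLike_aff]
    by_contra! h
    obtain ⟨c, hc⟩ := BerkovichA1.exists_eq_norm_eval h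
    refine hp ⟨c, fun P => ?_⟩
    rw [← eval_map_algebraMap]
    exact hc _

theorem BerkovichP1.restrict_smul_eq_iff (γ : GL (Fin 2) k)
    (u : BerkovichP1 (CompletedAlgClosure k)) (p : BerkovichP1 k) :
    restrict k (γ.map (algebraMap k (CompletedAlgClosure k)) • u) = γ • p ↔ restrict k u = p := by
  rw [restrict_smul]
  exact (MulAction.injective γ).eq_iff

theorem BerkovichP1.IsHyperbolic.smul {p : BerkovichP1 k} (hp : IsHyperbolic p)
    (γ : GL (Fin 2) k) : IsHyperbolic (γ • p) := by
  intro u hu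
  obtain ⟨u, rfl⟩ := MulAction.surjective (γ.map (algebraMap k (CompletedAlgClosure k))) u
  exact (hp u ((restrict_smul_eq_iff γ u p).mp hu)).smul _

theorem BerkovichP1.IsHyperbolic.exists_aff {p : BerkovichP1 k} (hp : IsHyperbolic p) :
    ∃ z, p = aff z := by
  cases p with
  | infty => exact (not_isNormLike_infty (hp infty rfl)).elim
  | aff z => exact ⟨z, rfl⟩

/-- The distance is the infimum of the distances between the points above. -/
theorem BerkovichP1.isGLB_rho {p q : BerkovichP1 k} (hp : IsHyperbolic p) (hq : IsHyperbolic q) :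
    IsGLB {d | ∃ u v : BerkovichP1 (CompletedAlgClosure k),
      restrict k u = p ∧ restrict k v = q ∧ d = formDist u v} (rho p q) := by
  obtain ⟨z, rfl⟩ := hp.exists_aff
  obtain ⟨w, rfl⟩ := hq.exists_aff
  have hpos : ∀ {z : BerkovichA1 k} {u : BerkovichA1 (CompletedAlgClosure k)},
      IsHyperbolic (aff z) → u.LiesOver z → 0 < u.joinDiam u := fun {z u} hz hu => by
    rw [← isNormLike_aff]
    exact hz _ (congrArg aff (BerkovichA1.ext' hu))
  have hset : {d | ∃ u v : BerkovichP1 (CompletedAlgClosure k),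
      restrict k u = aff z ∧ restrict k v = aff w ∧ d = formDist u v} =
      Set.range fun q : {q : BerkovichA1 (CompletedAlgClosure k) ×
        BerkovichA1 (CompletedAlgClosure k) // q.1.LiesOver z ∧ q.2.LiesOver w} =>
        q.1.1.pathDist q.1.2 := by
    ext d
    constructor
    · rintro ⟨u, v, hu, hv, rfl⟩
      obtain ⟨u, rfl⟩ : ∃ u', u = aff u' := by
        cases u with
        | infty => cases hu
        | aff u => exact ⟨u, rfl⟩
      obtain ⟨v, rfl⟩ : ∃ u', v = aff u' := by
        cases v with
        | infty => cases hv
        | aff u => exact ⟨u, rfl⟩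
      have hu' : u.LiesOver z := by
        have : u.restrict k = z := by simpa [restrict] using hu
        rw [← this]
        exact fun P => rfl
      have hv' : v.LiesOver w := by
        have : v.restrict k = w := by simpa [restrict] using hv
        rw [← this]
        exact fun P => rfl
      exact ⟨⟨(u, v), hu', hv'⟩, (formDist_aff (hpos hp hu') (hpos hq hv')).symm⟩
    · rintro ⟨⟨⟨u, v⟩, hu, hv⟩, rfl⟩
      exact ⟨aff u, aff v, congrArg aff (BerkovichA1.ext' hu), congrArg aff (BerkovichA1.ext' hv),
        (formDist_aff (hpos hp hu) (hpos hq hv)).symm⟩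
  rw [hset]
  obtain ⟨u, hu⟩ := z.exists_restrict_eq
  obtain ⟨v, hv⟩ := w.exists_restrict_eq
  have : Nonempty {q : BerkovichA1 (CompletedAlgClosure k) ×
      BerkovichA1 (CompletedAlgClosure k) // q.1.LiesOver z ∧ q.2.LiesOver w} :=
    ⟨⟨(u, v), by rw [← hu]; exact fun P => rfl, by rw [← hv]; exact fun P => rfl⟩⟩
  refine isGLB_ciInf ⟨0, ?_⟩
  rintro _ ⟨⟨⟨u, v⟩, hu, hv⟩, rfl⟩
  exact BerkovichA1.pathDist_nonneg (hpos hp hu) (hpos hq hv)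

/-- The matrix γ permutes the lifts compatibly with restriction, and `formDist` is invariant
upstairs. The two infima are therefore taken over the same set. -/
theorem BerkovichP1.rho_smul {p q : BerkovichP1 k} (hp : IsHyperbolic p) (hq : IsHyperbolic q)
    (γ : GL (Fin 2) k) : rho (γ • p) (γ • q) = rho p q := by
  refine (isGLB_rho (hp.smul γ) (hq.smul γ)).unique ?_
  suffices h : {d | ∃ u v : BerkovichP1 (CompletedAlgClosure k),
      restrict k u = γ • p ∧ restrict k v = γ • q ∧ d = formDist u v} =
      {d | ∃ u v : BerkovichP1 (CompletedAlgClosure k),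
        restrict k u = p ∧ restrict k v = q ∧ d = formDist u v} by
    rw [h]
    exact isGLB_rho hp hq
  ext d
  constructor
  · rintro ⟨u, v, hu, hv, rfl⟩
    obtain ⟨u, rfl⟩ := MulAction.surjective (γ.map (algebraMap k (CompletedAlgClosure k))) u
    obtain ⟨v, rfl⟩ := MulAction.surjective (γ.map (algebraMap k (CompletedAlgClosure k))) v
    rw [restrict_smul_eq_iff] at hu hv
    exact ⟨u, v, hu, hv, formDist_smul _ (hp u hu) (hq v hv)⟩
  · rintro ⟨u, v, hu, hv, rfl⟩
    exact ⟨_, _, (restrict_smul_eq_iff γ u p).mpr hu, (restrict_smul_eq_iff γ v q).mpr hv,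
      (formDist_smul _ (hp u hu) (hq v hv)).symm⟩

theorem BerkovichP1.formDist_comm {F : Type*} [NormedField F] (p q : BerkovichP1 F) :
    formDist p q = formDist q p := add_comm _ _

theorem BerkovichP1.rho_comm {p q : BerkovichP1 k} (hp : IsHyperbolic p) (hq : IsHyperbolic q) :
    rho p q = rho q p := by
  refine (isGLB_rho hp hq).unique ?_
  suffices h : {d | ∃ u v : BerkovichP1 (CompletedAlgClosure k),
      restrict k u = p ∧ restrict k v = q ∧ d = formDist u v} =
      {d | ∃ u v : BerkovichP1 (CompletedAlgClosure k),
        restrict k u = q ∧ restrict k v = p ∧ d = formDist u v} by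
    rw [h]
    exact isGLB_rho hq hp
  ext d
  constructor <;>
  · rintro ⟨u, v, hu, hv, rfl⟩
    exact ⟨v, u, hv, hu, formDist_comm _ _⟩

theorem BerkovichP1.formDist_nonneg {F : Type*} [NormedField F] [IsUltrametricDist F]
    {p q : BerkovichP1 F} (hp : IsNormLike p) (hq : IsNormLike q) : 0 ≤ formDist p q := by
  cases p with
  | infty => exact (not_isNormLike_infty hp).elim
  | aff z =>
    cases q with
    | infty => exact (not_isNormLike_infty hq).elim
    | aff w =>
      rw [isNormLike_aff] at hp hq
      rw [formDist_aff hp hq]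
      exact BerkovichA1.pathDist_nonneg hp hq

theorem BerkovichP1.rho_nonneg {p q : BerkovichP1 k} (hp : IsHyperbolic p) (hq : IsHyperbolic q) :
    0 ≤ rho p q := by
  refine (isGLB_rho hp hq).2 ?_
  rintro _ ⟨u, v, rfl, rfl, rfl⟩
  exact formDist_nonneg (hp u rfl) (hq v rfl)

end Lifts
end

noncomputable section
open Polynomial
open scoped Pointwise

/-! ## Distances to boundary points of disks -/

section BoundaryDistance

open BerkovichP1

variable {k : Type*} [NontriviallyNormedField k] [CompleteSpace k] [IsUltrametricDist k]

theorem Multiset.prod_map_le_pow_card_of_nonneg {ι : Type*} (t : Multiset ι) (f : ι → ℝ) {r : ℝ}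
    (hr : 0 ≤ r) (h : ∀ x ∈ t, 0 ≤ f x ∧ f x ≤ r) :
    0 ≤ (t.map f).prod ∧ (t.map f).prod ≤ r ^ card t := by
  induction t using Multiset.induction_on with
  | empty => simp
  | cons a t ih =>
    obtain ⟨h1, h2⟩ := ih fun x hx => h x (mem_cons_of_mem hx)
    obtain ⟨h3, h4⟩ := h a (mem_cons_self a t)
    rw [map_cons, prod_cons, card_cons, pow_succ']
    exact ⟨mul_nonneg h3 h1, mul_le_mul h4 h2 h1 hr⟩

/-- The minimal polynomial of b, evaluated at X - c, has coefficients in k, and its value is at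
least rⁿ because of the leading term. Over the closure it splits into n factors, one for each
conjugate of b, each of value at most r; so no factor can be smaller than r. -/
theorem BerkovichA1.le_of_restrict_eq_eta {w : BerkovichA1 (CompletedAlgClosure k)} {c : k} {r : ℝ}
    {hr : 0 < r} (hw : w.restrict k = eta c r hr) (b : AlgebraicClosure k) (hb : ‖b‖ ≤ r) :
    r ≤ w (X - C (algebraMap k (CompletedAlgClosure k) c) - C (b : CompletedAlgClosure k)) := by
  set c' := algebraMap k (CompletedAlgClosure k) c with hc'
  have hval : ∀ P : k[X], w (P.map (algebraMap k (CompletedAlgClosure k))) = eta c r hr P :=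
    fun P => by rw [← hw]; rfl
  have hwc : w (X - C c') = r := by
    have := hval (X - C c)
    rw [eta_sub_C, sub_self, norm_zero, max_eq_left hr.le] at this
    simpa using this
  let coe : AlgebraicClosure k →+* CompletedAlgClosure k := UniformSpace.Completion.coeRingHom
  have hcoe : ∀ x, ‖coe x‖ = ‖x‖ := UniformSpace.Completion.norm_coe
  let g : (AlgebraicClosure k)[X] →+* (CompletedAlgClosure k)[X] :=
    (compRingHom (X - C c')).comp (mapRingHom coe)
  have hg : ∀ x, g (X - C x) = X - C c' - C (coe x) := fun x => by simp [g]
  have hint : IsIntegral k b := (Algebra.IsAlgebraic.isAlgebraic b).isIntegral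
  set P := minpoly k b with hP
  have hmonic : P.Monic := minpoly.monic hint
  set n := P.natDegree
  set roots := (P.map (algebraMap k (AlgebraicClosure k))).roots with hroots
  have hsplit : P.map (algebraMap k (AlgebraicClosure k)) =
      (roots.map fun x => X - C x).prod :=
    (IsAlgClosed.splits _).eq_prod_roots_of_monic (hmonic.map _)
  have hcard : roots.card = n := by
    change roots.card = P.natDegree
    rw [← natDegree_map (algebraMap k (AlgebraicClosure k))]
    exact (IsAlgClosed.splits _).natDegree_eq_card_roots.symm
  have hgP : g (P.map (algebraMap k (AlgebraicClosure k))) =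
      (P.comp (X - C c)).map (algebraMap k (CompletedAlgClosure k)) := by
    have : coe.comp (algebraMap k (AlgebraicClosure k)) =
      algebraMap k (CompletedAlgClosure k) := rfl
    simp [g, Polynomial.map_map, this, map_comp, hc']
  have hlow : r ^ n ≤ w (g (P.map (algebraMap k (AlgebraicClosure k)))) := by
    rw [hgP, hval]
    have := le_eta c r hr (P.comp (X - C c)) n
    have ht : taylor c (P.comp (X - C c)) = P := by
      rw [taylor_apply, comp_assoc]
      simp
    rw [ht, show P.coeff n = 1 from hmonic.coeff_natDegree, norm_one, one_mul] at this
    exact this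
  have hbroot : b ∈ roots := by
    rw [hroots, mem_roots ((hmonic.map _).ne_zero), IsRoot, eval_map_algebraMap]
    exact minpoly.aeval k b
  -- The spectral norm is computed from the minimal polynomial, which conjugates share.
  have hnorm : ∀ x ∈ roots, ‖x‖ = ‖b‖ := by
    intro x hx
    rw [hroots, mem_roots ((hmonic.map _).ne_zero), IsRoot, eval_map_algebraMap] at hx
    have : P = minpoly k x :=
      minpoly.eq_of_irreducible_of_monic (minpoly.irreducible hint) hx hmonic
    rw [norm_algebraicClosure_eq, norm_algebraicClosure_eq, spectralNorm, spectralNorm, ← this, hP]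
  have hle : ∀ x ∈ roots, 0 ≤ w (g (X - C x)) ∧ w (g (X - C x)) ≤ r := by
    intro x hx
    refine ⟨w.seminorm_nonneg _, ?_⟩
    have h1 := w.add_le_max (X - C c') (-C (coe x))
    rw [map_neg_eq_map, w.map_C, hwc, hcoe, hnorm x hx, max_eq_left hb] at h1
    rw [hg, sub_eq_add_neg]
    exact h1
  obtain ⟨t, ht⟩ := Multiset.exists_cons_of_mem hbroot
  rw [hsplit, map_multiset_prod, map_multiset_prod, Multiset.map_map, Multiset.map_map, ht,
    Multiset.map_cons, Multiset.prod_cons] at hlow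
  have h2 := (Multiset.prod_map_le_pow_card_of_nonneg t (fun x => w (g (X - C x))) hr.le
    fun x hx => hle x (by rw [ht]; exact Multiset.mem_cons_of_mem hx)).2
  have h3 : n = t.card + 1 := by rw [← hcard, ht, Multiset.card_cons]
  rw [h3, pow_succ'] at hlow
  have h4 := hlow.trans (mul_le_mul_of_nonneg_left h2 (hle b hbroot).1)
  change r ≤ w (X - C c' - C (coe b))
  rw [← hg]
  exact le_of_mul_le_mul_right h4 (by positivity)

/-- A point above `η_{c,r}` has the same values on linear forms as `η_{c,r}`. -/
theorem BerkovichA1.apply_sub_C_of_restrict_eq_eta {w : BerkovichA1 (CompletedAlgClosure k)} {c : k}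
    {r : ℝ} {hr : 0 < r} (hw : w.restrict k = eta c r hr) (β : CompletedAlgClosure k) :
    w (X - C β) = max r ‖β - algebraMap k (CompletedAlgClosure k) c‖ := by
  set c' := algebraMap k (CompletedAlgClosure k) c with hc'
  have hwc : w (X - C c') = r := by
    have h1 : w.restrict k (X - C c) = r := by
      rw [hw, eta_sub_C, sub_self, norm_zero, max_eq_left hr.le]
    change w ((X - C c).map _) = r at h1
    simpa using h1
  refine le_antisymm ?_ ?_
  · refine (w.map_sub_C_le β c').trans ?_
    rw [hwc, norm_sub_rev]
  · rcases lt_or_ge r ‖β - c'‖ with h | h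
    · have := w.norm_sub_le c' β
      rw [hwc] at this
      refine max_le ?_ ?_
      · rcases le_max_iff.mp this with h' | h' <;> linarith
      · rcases le_max_iff.mp this with h' | h' <;> linarith
    · rw [max_eq_left h]
      -- The algebraic closure is dense. An algebraic b at distance less than r from β - c replaces
      -- it: an error smaller than r cannot affect the lower bound r.
      obtain ⟨b, hb⟩ := Metric.denseRange_iff.mp
        (UniformSpace.Completion.denseRange_coe (α := AlgebraicClosure k)) (β - c') r hr
      rw [dist_eq_norm] at hb
      have hbn : ‖b‖ ≤ r := by
        rw [← UniformSpace.Completion.norm_coe]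
        have h1 := IsUltrametricDist.norm_add_le_max (β - c')
          (-(β - c' - (b : CompletedAlgClosure k)))
        rw [← sub_eq_add_neg, sub_sub_cancel, norm_neg] at h1
        exact h1.trans (max_le h hb.le)
      have h1 := le_of_restrict_eq_eta hw b hbn
      have h2 := w.add_le_max (X - C β) (C (β - c' - (b : CompletedAlgClosure k)))
      rw [w.map_C] at h2
      have e : (X - C β + C (β - c' - (b : CompletedAlgClosure k)) :
          (CompletedAlgClosure k)[X]) = X - C c' - C (b : CompletedAlgClosure k) := by
        simp only [C_sub]
        ring
      rw [e] at h2
      rcases le_max_iff.mp h2 with h' | h' <;> linarith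

theorem BerkovichA1.diam_of_restrict_eq_eta {w : BerkovichA1 (CompletedAlgClosure k)} {c : k}
    {r : ℝ} {hr : 0 < r} (hw : w.restrict k = eta c r hr) : w.joinDiam w = r :=
  joinDiam_eq_of_lt (w.apply_sub_C_of_restrict_eq_eta hw) hr.le
    (by simp [w.apply_sub_C_of_restrict_eq_eta hw, hr.le])

namespace BerkovichP1

theorem exists_aff_of_restrict_eq {u : BerkovichP1 (CompletedAlgClosure k)} {z : BerkovichA1 k}
    (h : restrict k u = aff z) : ∃ w : BerkovichA1 (CompletedAlgClosure k),
      u = aff w ∧ w.restrict k = z := by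
  cases u with
  | infty => cases h
  | aff w => exact ⟨w, rfl, by simpa [restrict] using h⟩

theorem isHyperbolic_eta (c : k) (r : ℝ) (hr : 0 < r) : IsHyperbolic (aff (eta c r hr)) := by
  intro u hu
  obtain ⟨w, rfl, hw⟩ := exists_aff_of_restrict_eq hu
  rw [isNormLike_aff, BerkovichA1.diam_of_restrict_eq_eta hw]
  exact hr

theorem IsOpenBoundary.isHyperbolic {U : Set (BerkovichP1 k)} {p : BerkovichP1 k}
    (h : IsOpenBoundary U p) : IsHyperbolic p := by
  obtain ⟨h, c, r, hr, rfl, rfl⟩ := h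
  exact (isHyperbolic_eta c r hr).smul h

theorem IsHyperbolic.smul_pgl {p : BerkovichP1 k} (hp : IsHyperbolic p) (γ : PGL(2, k)) :
    IsHyperbolic (γ • p) := by
  obtain ⟨γ, rfl⟩ := Matrix.ProjGenLinGroup.mk_surjective γ
  exact hp.smul γ

theorem rho_smul_pgl {p q : BerkovichP1 k} (hp : IsHyperbolic p) (hq : IsHyperbolic q)
    (γ : PGL(2, k)) : rho (γ • p) (γ • q) = rho p q := by
  obtain ⟨γ, rfl⟩ := Matrix.ProjGenLinGroup.mk_surjective γ
  exact rho_smul hp hq γ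

/-- The values on linear forms, hence the path distances, are the same for all lifts m and m' of
η_{c,r}. So the distance of any lifts u and v splits as a term in u plus a term in v, and the
infimum over independent choices is the sum of the infima. -/
theorem rho_add_of_eta {x z : BerkovichA1 k} (hx : IsHyperbolic (aff x))
    (hz : IsHyperbolic (aff z)) {c : k} {r : ℝ} (hr : 0 < r) (hxr : r ≤ x (X - C c))
    (hzr : z (X - C c) < r) :
    rho (aff x) (aff z) =
      rho (aff x) (aff (eta c r hr)) + rho (aff (eta c r hr)) (aff z) := by
  have hp := isHyperbolic_eta c r hr
  have hval : ∀ {w : BerkovichA1 (CompletedAlgClosure k)} {y : BerkovichA1 k},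
      w.restrict k = y → w (X - C (algebraMap k (CompletedAlgClosure k) c)) = y (X - C c) := by
    rintro w _ rfl
    change _ = w ((X - C c).map _)
    simp
  have key : ∀ {u v m m' : BerkovichP1 (CompletedAlgClosure k)}, restrict k u = aff x →
      restrict k v = aff z → restrict k m = aff (eta c r hr) → restrict k m' = aff (eta c r hr) →
      formDist u v = formDist u m + formDist m' v := by
    intro u v m m' hu hv hm hm'
    have hu' := hx u hu
    have hv' := hz v hv
    obtain ⟨u, rfl, hux⟩ := exists_aff_of_restrict_eq hu
    obtain ⟨v, rfl, hvz⟩ := exists_aff_of_restrict_eq hv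
    obtain ⟨m, rfl, hmp⟩ := exists_aff_of_restrict_eq hm
    obtain ⟨m', rfl, hmp'⟩ := exists_aff_of_restrict_eq hm'
    rw [isNormLike_aff] at hu' hv'
    have dm := m.diam_of_restrict_eq_eta hmp
    have dm' := m'.diam_of_restrict_eq_eta hmp'
    rw [formDist_aff hu' hv', formDist_aff hu' (by rwa [dm]), formDist_aff (by rwa [dm']) hv',
      BerkovichA1.pathDist_eq_add hr.le (m.apply_sub_C_of_restrict_eq_eta hmp)
        (by rwa [hval hvz]) (by rwa [hval hux])]
    congr 1
    simp only [BerkovichA1.pathDist, BerkovichA1.joinDiam, m.apply_sub_C_of_restrict_eq_eta hmp,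
      m'.apply_sub_C_of_restrict_eq_eta hmp']
  obtain ⟨g1, l1⟩ := isGLB_rho hx hz
  obtain ⟨g2, l2⟩ := isGLB_rho hx hp
  obtain ⟨g3, l3⟩ := isGLB_rho hp hz
  refine le_antisymm ?_ (l1 ?_)
  · suffices rho (aff x) (aff z) - rho (aff x) (aff (eta c r hr)) ≤
      rho (aff (eta c r hr)) (aff z) by linarith
    refine l3 ?_
    rintro _ ⟨m', v, hm', hv, rfl⟩
    suffices rho (aff x) (aff z) - formDist m' v ≤ rho (aff x) (aff (eta c r hr)) by linarith
    refine l2 ?_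
    rintro _ ⟨u, m, hu, hm, rfl⟩
    have := g1 ⟨u, v, hu, hv, rfl⟩
    rw [key hu hv hm hm'] at this
    linarith
  · rintro _ ⟨u, v, hu, hv, rfl⟩
    obtain ⟨m, hm⟩ := exists_restrict_eq (aff (eta c r hr))
    rw [key hu hv hm hm]
    exact add_le_add (g2 ⟨u, m, hu, hm, rfl⟩) (g3 ⟨m, v, hm, hv, rfl⟩)

/-- The boundary point of an open disk lies between the points inside and the points outside. -/
theorem IsOpenBoundary.rho_eq_add {U : Set (BerkovichP1 k)} {p x z : BerkovichP1 k}
    (h : IsOpenBoundary U p) (hx : IsHyperbolic x) (hz : IsHyperbolic z) (hxU : x ∉ U)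
    (hzU : z ∈ U) : rho x z = rho x p + rho p z := by
  obtain ⟨h, c, r, hr, rfl, rfl⟩ := h
  obtain ⟨z, hz', rfl⟩ := hzU
  obtain ⟨x, rfl⟩ := MulAction.surjective h x
  have hx2 : IsHyperbolic x := by simpa using hx.smul h⁻¹
  have hz2 : IsHyperbolic z := by simpa using hz.smul h⁻¹
  have hp := isHyperbolic_eta c r hr
  rw [(MulAction.injective h).mem_set_image] at hxU
  simp only
  rw [rho_smul hx2 hz2, rho_smul hx2 hp, rho_smul hp hz2]
  obtain ⟨x, rfl⟩ := hx2.exists_aff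
  obtain ⟨z, rfl⟩ := hz2.exists_aff
  rw [aff_mem_openDisk_iff] at hxU hz'
  exact rho_add_of_eta hx2 hz2 hr (not_lt.mp hxU) hz'

/-- Every pair of lifts is at distance at least log(q(X - c) / r): their join has diameter q(X - c),
while the lift of q has at most this diameter and the lift of η_{c,r} has diameter r. A uniform
bound is needed, since ρ is an infimum. -/
theorem rho_pos_of_eta {q : BerkovichA1 k} (hq : IsHyperbolic (aff q)) {c : k} {r : ℝ}
    (hr : 0 < r) (hqr : r < q (X - C c)) : 0 < rho (aff (eta c r hr)) (aff q) := by
  have hp := isHyperbolic_eta c r hr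
  refine (Real.log_pos ((one_lt_div hr).mpr hqr)).trans_le ((isGLB_rho hp hq).2 ?_)
  rintro _ ⟨m, v, hm, hv, rfl⟩
  have hv' := hq v hv
  obtain ⟨m, rfl, hmp⟩ := exists_aff_of_restrict_eq hm
  obtain ⟨v, rfl, rfl⟩ := exists_aff_of_restrict_eq hv
  rw [isNormLike_aff] at hv'
  have dm := m.diam_of_restrict_eq_eta hmp
  have hval : v.restrict k (X - C c) = v (X - C (algebraMap k (CompletedAlgClosure k) c)) := by
    change v ((X - C c).map _) = _
    simp
  rw [hval] at hqr ⊢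
  have hJ : v.joinDiam m = v (X - C (algebraMap k (CompletedAlgClosure k) c)) :=
    BerkovichA1.joinDiam_eq_of_le (m.apply_sub_C_of_restrict_eq_eta hmp) hr.le hqr.le
  have h1 := Real.log_le_log hv' (v.diam_le (algebraMap k (CompletedAlgClosure k) c))
  rw [formDist_aff (by rwa [dm]) hv', BerkovichA1.pathDist, m.joinDiam_comm, hJ, dm,
    Real.log_div (hr.trans hqr).ne' hr.ne']
  linarith

theorem IsBoundaryPoint.rho_pos {D : Set (BerkovichP1 k)} {p q : BerkovichP1 k}
    (h : IsBoundaryPoint D p) (hq : IsHyperbolic q) (hqD : q ∉ D) : 0 < rho p q := by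
  obtain ⟨h, c, r, hr, rfl, rfl⟩ := h
  obtain ⟨h, rfl⟩ := Matrix.ProjGenLinGroup.mk_surjective h
  simp only [pgl_mk_smul] at hqD ⊢
  obtain ⟨q, rfl⟩ := MulAction.surjective h q
  have hq2 : IsHyperbolic q := by simpa using hq.smul h⁻¹
  rw [(MulAction.injective h).mem_set_image] at hqD
  rw [rho_smul (isHyperbolic_eta c r hr) hq2]
  obtain ⟨q, rfl⟩ := hq2.exists_aff
  rw [aff_mem_closedDisk_iff] at hqD
  exact rho_pos_of_eta hq2 hr (not_le.mp hqD)

theorem IsBoundaryPoint.mem {F : Type*} [NormedField F] [IsUltrametricDist F]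
    {D : Set (BerkovichP1 F)} {p : BerkovichP1 F} (h : IsBoundaryPoint D p) : p ∈ D := by
  obtain ⟨h, c, r, hr, rfl, rfl⟩ := h
  refine ⟨_, ?_, rfl⟩
  rw [aff_mem_closedDisk_iff, eta_sub_C]
  simp [hr.le]

end BerkovichP1

end BoundaryDistance
end

noncomputable section
open scoped Pointwise

/-! ## Reduced words and the fundamental domain -/

section Words

open BerkovichP1

namespace Letter

variable {g : ℕ}

@[simp]
theorem inv_inv (a : Letter g) : a.inv.inv = a := by
  simp [Letter.inv]

theorem val_inv {G : Type*} [Group G] (γ : Fin g → G) (a : Letter g) :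
    a.inv.val γ = (a.val γ)⁻¹ := by
  obtain ⟨i, s⟩ := a
  cases s <;> simp [Letter.inv, Letter.val]

theorem inv_ne_iff {a c : Letter g} : a.inv ≠ c ↔ (a.1 = c.1 → a.2 = c.2) := by
  obtain ⟨i, s⟩ := a
  obtain ⟨j, t⟩ := c
  cases s <;> cases t <;> simp [Letter.inv]

end Letter

/-- The group element denoted by a word. -/
def wordVal {g : ℕ} {G : Type*} [Group G] (γ : Fin g → G) (l : List (Letter g)) : G :=
  (l.map (Letter.val γ)).prod

@[simp]
theorem wordVal_cons {g : ℕ} {G : Type*} [Group G] (γ : Fin g → G) (a : Letter g)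
    (l : List (Letter g)) : wordVal γ (a :: l) = a.val γ * wordVal γ l := by
  simp [wordVal]

@[simp]
theorem wordVal_nil {g : ℕ} {G : Type*} [Group G] (γ : Fin g → G) : wordVal γ [] = 1 := by
  simp [wordVal]

theorem lift_mk_eq_wordVal {g : ℕ} {G : Type*} [Group G] (γ : Fin g → G) (l : List (Letter g)) :
    FreeGroup.lift γ (FreeGroup.mk l) = wordVal γ l := by
  rw [FreeGroup.lift_mk, wordVal]
  congr 2
  funext a
  obtain ⟨i, s⟩ := a
  cases s <;> simp [Letter.val]

section Figure

variable {k : Type*} [NormedField k] {g : ℕ} {γ : Fin g → PGL(2, k)}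
  {D Do : Letter g → Set (BerkovichP1 k)}

namespace IsSchottkyFigure

variable (hfig : IsSchottkyFigure γ D Do)

include hfig

theorem smul_mem_open {a : Letter g} {z : BerkovichP1 k} (hz : z ∉ D a.inv) :
    a.val γ • z ∈ Do a := by
  rw [← hfig.image_compl a]
  exact ⟨z, hz, rfl⟩

theorem smul_mem {a : Letter g} {z : BerkovichP1 k} (hz : z ∉ Do a.inv) : a.val γ • z ∈ D a := by
  by_contra h
  have := hfig.smul_mem_open (a := a.inv) (z := a.val γ • z) (by simpa using h)
  rw [Letter.val_inv, inv_smul_smul] at this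
  exact hz this

theorem open_subset (a : Letter g) : Do a ⊆ D a := (hfig.isMaximalOpenDisk a).prop.2

/-- Ping-pong, from the last letter to the first. A point of the domain may lie in D(i, false)
outside Do(i, false), so a single positive letter only leads into the closed disk; all other words
lead into the open one. The sharper conclusion for negative letters matches the half-open domain. -/
theorem word_smul_mem {y : BerkovichP1 k} (hy : y ∈ fundamentalDomain D Do) (a : Letter g)
    (l : List (Letter g)) (h : FreeGroup.IsReduced (a :: l)) :
    wordVal γ (a :: l) • y ∈ D a ∧ (a.2 = false → wordVal γ (a :: l) • y ∈ Do a) := by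
  simp only [fundamentalDomain, Set.mem_compl_iff, Set.mem_union, Set.mem_iUnion, not_or,
    not_exists] at hy
  induction l generalizing a with
  | nil =>
    obtain ⟨i, s⟩ := a
    simp only [wordVal_cons, wordVal_nil, mul_one]
    cases s with
    | false =>
      have := hfig.smul_mem_open (a := (i, false)) (hy.1 i)
      exact ⟨hfig.open_subset _ this, fun _ => this⟩
    | true => exact ⟨hfig.smul_mem (a := (i, true)) (hy.2 i), by simp⟩
  | cons c l ih =>
    rw [FreeGroup.isReduced_cons_cons] at h
    have hc := (ih c h.2).1
    have hn : wordVal γ (c :: l) • y ∉ D a.inv := fun hmem =>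
      Set.disjoint_left.mp (hfig.disjoint (Letter.inv_ne_iff.mpr h.1)) hmem hc
    have := hfig.smul_mem_open hn
    rw [wordVal_cons γ a, mul_smul]
    exact ⟨hfig.open_subset _ this, fun _ => this⟩

theorem notMem_of_mem {x : BerkovichP1 k} (hx : x ∈ fundamentalDomain D Do) (a : Letter g) :
    x ∉ Do a ∧ (a.2 = true → x ∉ D a) := by
  simp only [fundamentalDomain, Set.mem_compl_iff, Set.mem_union, Set.mem_iUnion, not_or,
    not_exists] at hx
  obtain ⟨i, s⟩ := a
  cases s with
  | false => exact ⟨hx.2 i, by simp⟩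
  | true => exact ⟨fun h => hx.1 i (hfig.open_subset _ h), fun _ => hx.1 i⟩

theorem boundary_notMem [IsUltrametricDist k] {b : Letter g → BerkovichP1 k}
    (hb : ∀ a, IsBoundaryPoint (D a) (b a)) {a c : Letter g} (h : a ≠ c) : b a ∉ D c := fun hmem =>
  Set.disjoint_left.mp (hfig.disjoint h) (hb a).mem hmem

/-- A word acting trivially would leave x in place, but the disk into which the word moves x is one
that the domain avoids: the open disk for a negative first letter, the closed one for a positive
one. -/
theorem wordVal_ne_one {x : BerkovichP1 k} (hx : x ∈ fundamentalDomain D Do) (a : Letter g)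
    (l : List (Letter g)) (h : FreeGroup.IsReduced (a :: l)) : wordVal γ (a :: l) ≠ 1 := by
  intro h1
  have hm := hfig.word_smul_mem hx a l h
  have hn := hfig.notMem_of_mem hx a
  rw [h1, one_smul] at hm
  cases ha : a.2 with
  | false => exact hn.1 (hm.2 ha)
  | true => exact hn.2 ha hm.1

theorem lift_injective {x : BerkovichP1 k} (hx : x ∈ fundamentalDomain D Do) :
    Function.Injective (FreeGroup.lift γ) := by
  rw [injective_iff_map_eq_one]
  intro w hw
  rw [← FreeGroup.mk_toWord (x := w), lift_mk_eq_wordVal] at hw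
  have hr : FreeGroup.IsReduced w.toWord := FreeGroup.isReduced_toWord
  rw [← FreeGroup.toWord_eq_nil_iff]
  cases hl : w.toWord with
  | nil => rfl
  | cons a l =>
    rw [hl] at hw hr
    exact (hfig.wordVal_ne_one hx a l hr hw).elim

end IsSchottkyFigure

end Figure

/-! ## The length of the path of a reduced word -/

section Length

variable {k : Type*} [NontriviallyNormedField k] [CompleteSpace k] [IsUltrametricDist k] {g : ℕ}
  {γ : Fin g → PGL(2, k)} {D Do : Letter g → Set (BerkovichP1 k)} {b : Letter g → BerkovichP1 k}

/-- The length of the path from the boundary point of the disk of `a` to the translate of `y` by the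
word `a :: l`. -/
def chainLength (b : Letter g → BerkovichP1 k) (y : BerkovichP1 k) :
    Letter g → List (Letter g) → ℝ
  | a, [] => rho y (b a.inv)
  | a, c :: l => rho (b a.inv) (b c) + chainLength b y c l

theorem BerkovichP1.IsBoundaryPoint.isHyperbolic {D : Set (BerkovichP1 k)} {p : BerkovichP1 k}
    (h : IsBoundaryPoint D p) : IsHyperbolic p :=
  h.compl.isHyperbolic

theorem BerkovichP1.IsBoundaryPoint.rho_eq_add {D : Set (BerkovichP1 k)} {p x z : BerkovichP1 k}
    (h : IsBoundaryPoint D p) (hx : IsHyperbolic x) (hz : IsHyperbolic z) (hxD : x ∉ D)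
    (hzD : z ∈ D) : rho x z = rho x p + rho p z := by
  rw [rho_comm hx hz, h.compl.rho_eq_add hz hx (by simpa using hzD) hxD, rho_comm hz h.isHyperbolic,
    rho_comm h.isHyperbolic hx, add_comm]

/-- Linear growth in the word length makes every bounded range of lengths come from finitely many
elements, as the formal sum over Γ requires. -/
theorem le_chainLength (hb : ∀ a, IsBoundaryPoint (D a) (b a)) {δ : ℝ}
    (hδ : ∀ a c : Letter g, a.inv ≠ c → δ ≤ rho (b a.inv) (b c))
    {y : BerkovichP1 k} (hyp : IsHyperbolic y) (a : Letter g) (l : List (Letter g))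
    (h : FreeGroup.IsReduced (a :: l)) : l.length * δ ≤ chainLength b y a l := by
  induction l generalizing a with
  | nil => simpa [chainLength] using rho_nonneg hyp (hb a.inv).isHyperbolic
  | cons c l ih =>
    rw [FreeGroup.isReduced_cons_cons] at h
    have h1 := ih c h.2
    have h2 := hδ a c (Letter.inv_ne_iff.mpr h.1)
    simp only [chainLength, List.length_cons]
    push_cast
    linarith

namespace IsSchottkyFigure

variable (hfig : IsSchottkyFigure γ D Do) (hb : ∀ a, IsBoundaryPoint (D a) (b a))

include hfig hb

/-- Translating by a⁻¹ moves the starting point to the boundary point of D(a⁻¹). This point lies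
outside D(c) for the next letter c, whereas the rest of the word moves y into D(c), so the distance
splits at the boundary point of D(c). -/
theorem rho_boundary_word {y : BerkovichP1 k} (hy : y ∈ fundamentalDomain D Do)
    (hyp : IsHyperbolic y) (a : Letter g) (l : List (Letter g))
    (h : FreeGroup.IsReduced (a :: l)) :
    rho (b a) (wordVal γ (a :: l) • y) = chainLength b y a l := by
  induction l generalizing a with
  | nil =>
    rw [wordVal_cons, wordVal_nil, mul_one, ← hfig.smul_boundary hb a,
      rho_smul_pgl (hb _).isHyperbolic hyp, rho_comm (hb _).isHyperbolic hyp]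
    rfl
  | cons c l ih =>
    rw [FreeGroup.isReduced_cons_cons] at h
    rw [wordVal_cons, mul_smul, ← hfig.smul_boundary hb a,
      rho_smul_pgl (hb _).isHyperbolic (hyp.smul_pgl _),
      (hb c).rho_eq_add (hb _).isHyperbolic (hyp.smul_pgl _)
        (hfig.boundary_notMem hb (Letter.inv_ne_iff.mpr h.1)) (hfig.word_smul_mem hy c l h.2).1,
      ih c h.2]
    rfl

theorem rho_word {x y : BerkovichP1 k} (hx : x ∈ fundamentalDomain D Do) (hxp : IsHyperbolic x)
    (hy : y ∈ fundamentalDomain D Do) (hyp : IsHyperbolic y) (a : Letter g) (l : List (Letter g))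
    (h : FreeGroup.IsReduced (a :: l)) :
    rho x (wordVal γ (a :: l) • y) = rho x (b a) + chainLength b y a l := by
  rw [← hfig.rho_boundary_word hb hy hyp a l h]
  have hm := hfig.word_smul_mem hy a l h
  have hn := hfig.notMem_of_mem hx a
  cases ha : a.2 with
  | false =>
    exact (hfig.isOpenBoundary hb a).rho_eq_add hxp (hyp.smul_pgl _) hn.1 (hm.2 ha)
  | true => exact (hb a).rho_eq_add hxp (hyp.smul_pgl _) (hn.2 ha) hm.1

theorem exists_le_rho_boundary :
    ∃ δ : ℝ, 0 < δ ∧ ∀ a c : Letter g, a.inv ≠ c → δ ≤ rho (b a.inv) (b c) := by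
  rcases isEmpty_or_nonempty (Letter g × Letter g) with h | h
  · exact ⟨1, one_pos, fun a c => (h.false (a, c)).elim⟩
  -- The excluded pairs get the dummy value 1, so that the minimum over all pairs remains positive.
  · obtain ⟨i, hi⟩ := Finite.exists_min
      (fun i : Letter g × Letter g => if i.1.inv = i.2 then 1 else rho (b i.1.inv) (b i.2))
    refine ⟨_, ?_, fun a c hac => (hi (a, c)).trans (by simp [hac])⟩
    split_ifs with h
    · exact one_pos
    · exact (hb _).rho_pos (hb _).isHyperbolic (hfig.boundary_notMem hb (Ne.symm h))

end IsSchottkyFigure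

/-! ## The powers of the Perron matrix -/

/-- The words `l` of length `n` such that `a :: l` is reduced. -/
def reducedTails : ℕ → Letter g → Finset (List (Letter g))
  | 0, _ => {[]}
  | n + 1, a => (Finset.univ.filter fun c => a.inv ≠ c).biUnion fun c =>
      (reducedTails n c).image (c :: ·)

theorem mem_reducedTails {n : ℕ} {a : Letter g} {l : List (Letter g)} :
    l ∈ reducedTails n a ↔ l.length = n ∧ FreeGroup.IsReduced (a :: l) := by
  induction n generalizing a l with
  | zero =>
    rw [reducedTails, Finset.mem_singleton, List.length_eq_zero_iff]
    constructor
    · rintro rfl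
      exact ⟨rfl, FreeGroup.IsReduced.singleton⟩
    · exact fun h => h.1
  | succ n ih =>
    simp only [reducedTails, Finset.mem_biUnion, Finset.mem_filter, Finset.mem_univ, true_and,
      Finset.mem_image, ih]
    constructor
    · rintro ⟨c, hac, l, ⟨h1, h2⟩, rfl⟩
      exact ⟨by simp [h1], FreeGroup.isReduced_cons_cons.mpr ⟨Letter.inv_ne_iff.mp hac, h2⟩⟩
    · rintro ⟨h1, h2⟩
      cases l with
      | nil => simp at h1
      | cons c l =>
        rw [FreeGroup.isReduced_cons_cons] at h2
        exact ⟨c, Letter.inv_ne_iff.mpr h2.1, l, ⟨by simpa using h1, h2.2⟩, rfl⟩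

theorem sum_reducedTails_succ {M : Type*} [AddCommMonoid M] (n : ℕ) (a : Letter g)
    (f : List (Letter g) → M) : ∑ l ∈ reducedTails (n + 1) a, f l =
      ∑ c ∈ Finset.univ.filter fun c => a.inv ≠ c, ∑ l ∈ reducedTails n c, f (c :: l) := by
  rw [reducedTails, Finset.sum_biUnion]
  · refine Finset.sum_congr rfl fun c _ => Finset.sum_image fun l _ l' _ h => ?_
    simpa using h
  · intro c _ c' _ hcc
    simp only [Function.onFun, Finset.disjoint_left, Finset.mem_image]
    rintro _ ⟨l, _, rfl⟩ ⟨l', _, h⟩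
    simp only [List.cons.injEq] at h
    exact hcc h.1.symm

/-- Expanding the matrix power gives a sum over walks on letters that start at a. The zero entries
discard the walks with cancellation, and multiplicativity of E turns the product along a walk into E
of its length. -/
theorem perronMatrix_pow_mulVec {R : Type*} [CommRing R] {E : ℝ → R}
    (hE : ∀ l m, E (l + m) = E l * E m) (y : BerkovichP1 k) (n : ℕ) (a : Letter g) :
    (perronMatrix E b ^ n *ᵥ vecY E b y) a =
      ∑ l ∈ reducedTails n a, E (chainLength b y a l) := by
  induction n generalizing a with
  | zero => simp [reducedTails, vecY, chainLength]
  | succ n ih =>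
    rw [pow_succ', ← Matrix.mulVec_mulVec, sum_reducedTails_succ, Matrix.mulVec, dotProduct,
      Finset.sum_filter]
    refine Finset.sum_congr rfl fun c _ => ?_
    rw [ih, perronMatrix, Matrix.of_apply]
    by_cases h : a.inv = c
    · simp [h]
    · simp [h, chainLength, hE, Finset.mul_sum]

theorem powerTerm_eq_sum {R : Type*} [CommRing R] {E : ℝ → R}
    (hE : ∀ l m, E (l + m) = E l * E m) (x y : BerkovichP1 k) (n : ℕ) :
    powerTerm E b x y n =
      ∑ a : Letter g, ∑ l ∈ reducedTails n a, E (rho x (b a) + chainLength b y a l) := by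
  rw [powerTerm, dotProduct]
  refine Finset.sum_congr rfl fun a _ => ?_
  rw [perronMatrix_pow_mulVec hE, vecX, Finset.mul_sum]
  simp only [hE]

/-- The elements of word length `n`. -/
def wordSphere (g : ℕ) : ℕ → Finset (FreeGroup (Fin g))
  | 0 => {1}
  | n + 1 => Finset.univ.biUnion fun a : Letter g =>
      (reducedTails n a).image fun l => FreeGroup.mk (a :: l)

theorem mem_wordSphere {n : ℕ} {w : FreeGroup (Fin g)} : w ∈ wordSphere g n ↔ w.norm = n := by
  cases n with
  | zero => rw [wordSphere, Finset.mem_singleton, FreeGroup.norm_eq_zero]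
  | succ n =>
    simp only [wordSphere, Finset.mem_biUnion, Finset.mem_univ, true_and, Finset.mem_image,
      mem_reducedTails]
    constructor
    · rintro ⟨a, l, ⟨h1, h2⟩, rfl⟩
      rw [FreeGroup.norm, FreeGroup.toWord_mk, h2.reduce_eq, List.length_cons, h1]
    · intro h
      have hr : FreeGroup.IsReduced w.toWord := FreeGroup.isReduced_toWord
      rw [FreeGroup.norm] at h
      cases hl : w.toWord with
      | nil => simp [hl] at h
      | cons a l =>
        rw [hl] at h hr
        exact ⟨a, l, ⟨by simpa using h, hr⟩, by rw [← hl, FreeGroup.mk_toWord]⟩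

theorem sum_wordSphere_succ {M : Type*} [AddCommMonoid M] (n : ℕ)
    (f : FreeGroup (Fin g) → M) : ∑ w ∈ wordSphere g (n + 1), f w =
      ∑ a : Letter g, ∑ l ∈ reducedTails n a, f (FreeGroup.mk (a :: l)) := by
  have hinj : ∀ {a a' : Letter g} {l l' : List (Letter g)}, l ∈ reducedTails n a →
      l' ∈ reducedTails n a' → FreeGroup.mk (a :: l) = FreeGroup.mk (a' :: l') →
      a :: l = a' :: l' := by
    intro a a' l l' h h' heq
    rw [← (mem_reducedTails.mp h).2.reduce_eq, ← (mem_reducedTails.mp h').2.reduce_eq]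
    exact FreeGroup.reduce.sound heq
  rw [wordSphere, Finset.sum_biUnion]
  · refine Finset.sum_congr rfl fun a _ => Finset.sum_image fun l hl l' hl' h => ?_
    exact (List.cons.inj (hinj hl hl' h)).2
  · intro a _ a' _ haa
    simp only [Function.onFun, Finset.disjoint_left, Finset.mem_image]
    rintro _ ⟨l, hl, rfl⟩ ⟨l', hl', h⟩
    exact haa (List.cons.inj (hinj hl' hl h)).1.symm

/-- The terms of the Poincaré series, grouped by word length, are the terms of the geometric series
of the Perron matrix. -/
theorem IsSchottkyFigure.exists_wordLength (hfig : IsSchottkyFigure γ D Do)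
    (hb : ∀ a, IsBoundaryPoint (D a) (b a)) {Γ : Subgroup (PGL(2, k))}
    (hΓ : Γ = Subgroup.closure (Set.range γ)) {x y : BerkovichP1 k}
    (hx : x ∈ fundamentalDomain D Do) (hxp : IsHyperbolic x)
    (hy : y ∈ fundamentalDomain D Do) (hyp : IsHyperbolic y) :
    ∃ (N : Γ → ℕ) (S : ℕ → Finset Γ), (∀ n σ, σ ∈ S n ↔ N σ = n) ∧ S 0 = {1} ∧
      (∃ δ : ℝ, 0 < δ ∧ ∀ σ n, N σ = n + 1 → n * δ ≤ rho x (σ • y)) ∧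
      ∀ {R : Type} [CommRing R] {E : ℝ → R}, (∀ l m, E (l + m) = E l * E m) → ∀ n,
        powerTerm E b x y n = ∑ σ ∈ S (n + 1), E (rho x (σ • y)) := by
  have hrange : (FreeGroup.lift γ).range = Γ := by rw [hΓ, FreeGroup.range_lift_eq_closure]
  let e : FreeGroup (Fin g) ≃* Γ :=
    (MonoidHom.ofInjective (hfig.lift_injective hx)).trans (MulEquiv.subgroupCongr hrange)
  have he : ∀ (w : FreeGroup (Fin g)) (z : BerkovichP1 k), e w • z = FreeGroup.lift γ w • z :=
    fun w z => rfl
  -- The n-th power of M accounts for n transitions between letters, hence for words with n + 1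
  -- letters; level 0 holds the identity alone and is not reached by any power.
  refine ⟨fun σ => (e.symm σ).norm, fun n => (wordSphere g n).map e.toEquiv.toEmbedding,
    fun n σ => ?_, ?_, ?_, fun {R _ E} hE n => ?_⟩
  · rw [← mem_wordSphere, Finset.mem_map_equiv]
    rfl
  · simp [wordSphere]
  · obtain ⟨δ, hδ0, hδ⟩ := hfig.exists_le_rho_boundary hb
    refine ⟨δ, hδ0, fun σ n hn => ?_⟩
    obtain ⟨w, rfl⟩ := e.surjective σ
    simp only [e.symm_apply_apply] at hn
    have hr : FreeGroup.IsReduced w.toWord := FreeGroup.isReduced_toWord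
    rw [FreeGroup.norm] at hn
    rw [he, ← FreeGroup.mk_toWord (x := w), lift_mk_eq_wordVal]
    cases hl : w.toWord with
    | nil => simp [hl] at hn
    | cons a l =>
      rw [hl] at hr hn
      rw [hfig.rho_word hb hx hxp hy hyp a l hr]
      have h1 := le_chainLength hb hδ hyp a l hr
      have h2 := rho_nonneg hxp (hb a).isHyperbolic
      rw [show l.length = n by simpa using hn] at h1
      linarith
  · rw [powerTerm_eq_sum hE, Finset.sum_map]
    change _ = ∑ w ∈ wordSphere g (n + 1), E (rho x (FreeGroup.lift γ w • y))
    rw [sum_wordSphere_succ]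
    refine Finset.sum_congr rfl fun a _ => Finset.sum_congr rfl fun l hl => ?_
    rw [lift_mk_eq_wordVal, hfig.rho_word hb hx hxp hy hyp a l (mem_reducedTails.mp hl).2]

end Length

end Words
end

noncomputable section
open scoped Pointwise

/-! ## Sums over a set with a length function with finite fibers -/

section Levels

variable {G : Type*} {N : G → ℕ} {S : ℕ → Finset G}

theorem hasSum_level {M : Type*} [AddCommMonoid M] [TopologicalSpace M]
    (hS : ∀ n σ, σ ∈ S n ↔ N σ = n) (f : G → M) (n : ℕ) :
    HasSum (fun σ : {σ // N σ = n} => f σ) (∑ σ ∈ S n, f σ) :=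
  (Equiv.subtypeEquivRight fun σ => hS n σ).hasSum_iff.mp (Finset.hasSum (S n) f)

theorem tsum_eq_tsum_levels (hS : ∀ n σ, σ ∈ S n ↔ N σ = n) (f : G → ENNReal) :
    ∑' σ, f σ = ∑' n, ∑ σ ∈ S n, f σ := by
  rw [← (Equiv.sigmaFiberEquiv N).tsum_eq, ENNReal.tsum_sigma']
  exact tsum_congr fun n => (hasSum_level hS f n).tsum_eq

/-- Absolute summability, level by level, is what permits passing from the grouped sum to the
unordered sum. -/
theorem HasSum.of_levels (hS : ∀ n σ, σ ∈ S n ↔ N σ = n) {f : G → ℂ} {a : ℂ}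
    (hn : Summable fun n => ∑ σ ∈ S n, ‖f σ‖) (ha : HasSum (fun n => ∑ σ ∈ S n, f σ) a) :
    HasSum f a := by
  have hnorm : Summable fun x : (n : ℕ) × {σ // N σ = n} => ‖f x.2‖ := by
    rw [summable_sigma_of_nonneg fun _ => norm_nonneg _]
    refine ⟨fun n => (hasSum_level hS (fun σ => ‖f σ‖) n).summable, ?_⟩
    simpa only [(hasSum_level hS (fun σ => ‖f σ‖) _).tsum_eq] using hn
  have hsum : Summable (f ∘ Equiv.sigmaFiberEquiv N) := hnorm.of_norm
  have h := hsum.hasSum.sigma fun n => hasSum_level hS f n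
  rw [← (Equiv.sigmaFiberEquiv N).hasSum_iff]
  have h2 := hsum.hasSum
  rwa [h.unique ha] at h2

end Levels

/-! ## Formal series with supports bounded below -/

section Hahn

open HahnSeries

/-- The formal series all of whose exponents are at least `c`. -/
def seriesGE (c : ℝ) : AddSubgroup (HahnSeries ℝ ℤ) where
  carrier := {f | ∀ e < c, f.coeff e = 0}
  zero_mem' := by simp
  add_mem' := fun {f h} hf hh e he => by simp [hf e he, hh e he]
  neg_mem' := fun {f} hf e he => by simp [hf e he]

theorem seriesGE_anti {c d : ℝ} (h : c ≤ d) : seriesGE d ≤ seriesGE c :=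
  fun _ hf e he => hf e (he.trans_le h)

theorem mul_mem_seriesGE {c d : ℝ} {f h : HahnSeries ℝ ℤ} (hf : f ∈ seriesGE c)
    (hh : h ∈ seriesGE d) : f * h ∈ seriesGE (c + d) := by
  intro e he
  rw [coeff_mul]
  refine Finset.sum_eq_zero fun ij hij => ?_
  rw [Finset.mem_antidiagonal] at hij
  rcases lt_or_ge ij.1 c with h1 | h1
  · rw [hf _ h1, zero_mul]
  · rw [hh ij.2 (by linarith [hij.2.2]), mul_zero]

theorem exists_mem_seriesGE (f : HahnSeries ℝ ℤ) : ∃ c, f ∈ seriesGE c :=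
  ⟨f.order, fun _ he => coeff_eq_zero_of_lt_order he⟩

theorem formalExp_mem_seriesGE {c l : ℝ} (h : c ≤ l) : formalExp l ∈ seriesGE c := fun _ he =>
  coeff_single_of_ne (he.trans_le h).ne

theorem formalExp_add (l m : ℝ) : formalExp (l + m) = formalExp l * formalExp m := by
  simp [formalExp, single_mul_single]

/-- A strictly decreasing sequence would put infinitely many elements below its first term. -/
theorem isPWO_of_finite_le {s : Set ℝ} (h : ∀ c, (s ∩ Set.Iic c).Finite) : s.IsPWO := by
  refine Set.IsWF.isPWO (Set.isWF_iff_no_descending_seq.mpr fun f hf hfs => ?_)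
  exact Set.infinite_of_injective_forall_mem (s := s ∩ Set.Iic (f 0)) hf.injective
    (fun n => ⟨hfs n, hf.antitone (Nat.zero_le n)⟩) (h (f 0))

theorem pow_apply_mem_seriesGE {n : Type*} [Fintype n] [DecidableEq n] {c : ℝ}
    {M : Matrix n n (HahnSeries ℝ ℤ)} (hM : ∀ a b, M a b ∈ seriesGE c) (K : ℕ) (a b : n) :
    (M ^ K) a b ∈ seriesGE (K * c) := by
  induction K generalizing a b with
  | zero =>
    rw [pow_zero, Matrix.one_apply, Nat.cast_zero, zero_mul]
    split_ifs
    · exact formalExp_mem_seriesGE (l := 0) le_rfl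
    · exact zero_mem _
  | succ K ih =>
    rw [pow_succ, Matrix.mul_apply]
    refine sum_mem fun d _ => ?_
    have := mul_mem_seriesGE (ih a d) (hM d b)
    push_cast
    rwa [add_mul, one_mul]

/-- Every non-constant monomial contains a factor with exponents at least c, and the other factors
do not lower them since c ≥ 0. Applied to det(I - M), whose constant coefficient is 1. -/
theorem aeval_sub_constantCoeff_mem_seriesGE {ι : Type*} {c : ℝ} (hc : 0 ≤ c)
    {f : ι → HahnSeries ℝ ℤ} (hf : ∀ i, f i ∈ seriesGE c) (P : MvPolynomial ι ℤ) :
    MvPolynomial.aeval f P - ((MvPolynomial.constantCoeff P : ℤ) : HahnSeries ℝ ℤ) ∈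
        seriesGE c := by
  induction P using MvPolynomial.induction_on with
  | C a => simp
  | add P Q hP hQ =>
    rw [map_add, map_add, Int.cast_add, add_sub_add_comm]
    exact add_mem hP hQ
  | mul_X P i hP =>
    have h0 : MvPolynomial.aeval f P ∈ seriesGE 0 := by
      rw [← sub_add_cancel (MvPolynomial.aeval f P)
        ((MvPolynomial.constantCoeff P : ℤ) : HahnSeries ℝ ℤ)]
      refine add_mem (seriesGE_anti hc hP) fun e he => ?_
      rw [← Int.cast_id (n := MvPolynomial.constantCoeff P), ← map_intCast (C (Γ := ℝ) (R := ℤ))]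
      exact coeff_single_of_ne he.ne
    have := mul_mem_seriesGE h0 (hf i)
    simpa using this

theorem isUnit_of_sub_one_mem_seriesGE {c : ℝ} (hc : 0 < c) {f : HahnSeries ℝ ℤ}
    (h : f - 1 ∈ seriesGE c) : IsUnit f := by
  refine isUnit_of_orderTop_pos (lt_of_lt_of_le (WithTop.coe_pos.mpr hc) ?_)
  rw [le_orderTop_iff_forall]
  exact fun j hj => h j (WithTop.coe_lt_coe.mp hj)

end Hahn

/-! ## The Perron matrix over a polynomial ring -/

section PolyExp

open MvPolynomial

/-- The formal version of `ℓ ↦ e^{-sℓ}` with one variable for each of the lengths in `Λ`. -/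
def polyExp (Λ : Finset ℝ) (l : ℝ) : MvPolynomial Λ ℤ :=
  if h : l ∈ Λ then X ⟨l, h⟩ else 1

/-- Lengths equal to zero have no variable and are represented by 1, which keeps the exponents of
the final formula strictly positive. -/
theorem aeval_polyExp {R : Type*} [CommRing R] {E : ℝ → R} (hE : E 0 = 1) {Λ : Finset ℝ} {l : ℝ}
    (hl : l ∈ Λ ∨ l = 0) : aeval (fun i : Λ => E i) (polyExp Λ l) = E l := by
  unfold polyExp
  split_ifs with h
  · rw [aeval_X]
  · rw [map_one, hl.resolve_left h, hE]

end PolyExp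

section PerronPoly

open BerkovichP1 MvPolynomial

variable {k : Type*} [NontriviallyNormedField k] [CompleteSpace k] [IsUltrametricDist k] {g : ℕ}
  {R : Type*} [CommRing R] {b : Letter g → BerkovichP1 k} {x y : BerkovichP1 k}

/-- `det (I - M)`. -/
def perronDet (E : ℝ → R) (b : Letter g → BerkovichP1 k) : R := (1 - perronMatrix E b).det

/-- `X_x adj(I - M) Y_yᵗ`. -/
def perronNum (E : ℝ → R) (b : Letter g → BerkovichP1 k) (x y : BerkovichP1 k) : R :=
  vecX E b x ⬝ᵥ ((1 - perronMatrix E b).adjugate *ᵥ vecY E b y)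

/-- Cramer's rule. It holds also where the determinant vanishes, both sides being 0 by the
conventions for inverses. -/
theorem resolventTerm_eq_div {K : Type*} [Field K] (E : ℝ → K) :
    resolventTerm E b x y = perronNum E b x y / perronDet E b := by
  rw [resolventTerm, Matrix.inv_def, Ring.inverse_eq_inv', Matrix.smul_mulVec, dotProduct_smul,
    smul_eq_mul, ← div_eq_inv_mul]
  rfl

theorem map_perronMatrix {R' : Type*} [CommRing R'] (φ : R →+* R') {E : ℝ → R} {E' : ℝ → R'}
    (h : ∀ a c : Letter g, φ (E (rho (b a.inv) (b c))) = E' (rho (b a.inv) (b c))) :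
    φ.mapMatrix (1 - perronMatrix E b) = 1 - perronMatrix E' b := by
  rw [map_sub, map_one]
  congr 1
  ext a c
  rw [RingHom.mapMatrix_apply, Matrix.map_apply, perronMatrix, perronMatrix, Matrix.of_apply,
    Matrix.of_apply]
  split_ifs
  · exact map_zero φ
  · exact h a c

theorem map_perronDet {R' : Type*} [CommRing R'] (φ : R →+* R') {E : ℝ → R} {E' : ℝ → R'}
    (h : ∀ a c : Letter g, φ (E (rho (b a.inv) (b c))) = E' (rho (b a.inv) (b c))) :
    φ (perronDet E b) = perronDet E' b := by
  rw [perronDet, RingHom.map_det, map_perronMatrix φ h, perronDet]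

theorem map_perronNum {R' : Type*} [CommRing R'] (φ : R →+* R') {E : ℝ → R} {E' : ℝ → R'}
    (h : ∀ a c : Letter g, φ (E (rho (b a.inv) (b c))) = E' (rho (b a.inv) (b c)))
    (hx : ∀ a, φ (E (rho x (b a))) = E' (rho x (b a)))
    (hy : ∀ a, φ (E (rho y (b a))) = E' (rho y (b a))) :
    φ (perronNum E b x y) = perronNum E' b x y := by
  have hX : φ ∘ vecX E b x = vecX E' b x := funext fun a => hx a
  have hY : φ ∘ vecY E b y = vecY E' b y := funext fun a => hy a.inv
  have hA := RingHom.map_adjugate φ (1 - perronMatrix E b)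
  rw [map_perronMatrix φ h, RingHom.mapMatrix_apply] at hA
  rw [perronNum, RingHom.map_dotProduct, hX, perronNum]
  congr 1
  funext a
  rw [Function.comp_apply, RingHom.map_mulVec, hA, hY]

end PerronPoly
end

noncomputable section
open scoped Pointwise

/-! ## The formal identities -/

section Formal

open HahnSeries BerkovichP1

variable {G : Type*} {N : G → ℕ} {S : ℕ → Finset G}

theorem finite_le_of_levels (hS : ∀ n σ, σ ∈ S n ↔ N σ = n) {L : G → ℝ} {δ : ℝ} (hδ : 0 < δ)
    (hL : ∀ σ n, N σ = n + 1 → n * δ ≤ L σ) (c : ℝ) : {σ | L σ ≤ c}.Finite := by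
  obtain ⟨K, hK⟩ := exists_nat_gt (c / δ)
  rw [div_lt_iff₀ hδ] at hK
  refine ((Finset.range (K + 1)).finite_toSet.biUnion fun n _ => (S n).finite_toSet).subset ?_
  intro σ hσ
  simp only [Set.mem_iUnion, Finset.mem_coe, Finset.mem_range, hS, exists_prop, exists_eq_right']
  by_contra! h
  obtain ⟨m, hm⟩ := Nat.exists_eq_add_of_le h
  have h1 := hL σ (K + m) (by omega)
  push_cast at h1
  have h2 : (0 : ℝ) ≤ m * δ := by positivity
  have h3 : L σ ≤ c := hσ
  linarith

theorem coeff_formalExp (l e : ℝ) : (formalExp l).coeff e = if e = l then 1 else 0 :=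
  coeff_single ..

/-- Finitely many elements have length below a given bound, so both families are summable, and each
coefficient is a finite sum that can be regrouped by level. -/
theorem exists_summableFamily (hS : ∀ n σ, σ ∈ S n ↔ N σ = n) {σ₀ : G} (h0 : S 0 = {σ₀})
    {L : G → ℝ} {δ : ℝ} (hδ : 0 < δ) (hL : ∀ σ n, N σ = n + 1 → n * δ ≤ L σ) :
    ∃ (p : SummableFamily ℝ ℤ G) (t : SummableFamily ℝ ℤ ℕ),
      (∀ σ, p σ = formalExp (L σ)) ∧ (∀ n, t n = ∑ σ ∈ S (n + 1), formalExp (L σ)) ∧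
      p.hsum = t.hsum + formalExp (L σ₀) := by
  have hfin := finite_le_of_levels hS hδ hL
  have hpwo : (Set.range L).IsPWO := isPWO_of_finite_le fun c => by
    refine ((hfin c).image L).subset ?_
    rintro _ ⟨⟨σ, rfl⟩, hσ⟩
    exact ⟨σ, hσ, rfl⟩
  have hfinp : ∀ e, {σ | (formalExp (L σ)).coeff e ≠ 0}.Finite := fun e => by
    refine (hfin e).subset fun σ hσ => ?_
    rw [Set.mem_ofPred_eq, coeff_formalExp] at hσ
    simp only [ne_eq, ite_eq_right_iff, one_ne_zero, imp_false, not_not] at hσ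
    exact hσ.ge
  have hnonzero : ∀ {e n}, (∑ σ ∈ S (n + 1), formalExp (L σ)).coeff e ≠ 0 →
      ∃ σ ∈ S (n + 1), (formalExp (L σ)).coeff e ≠ 0 := fun {e n} h => by
    rw [coeff_sum] at h
    exact Finset.exists_ne_zero_of_sum_ne_zero h
  have hmem : ∀ {e σ}, (formalExp (L σ)).coeff e ≠ 0 → e ∈ Set.range L := fun {e σ} h => by
    rw [coeff_formalExp] at h
    simp only [ne_eq, ite_eq_right_iff, one_ne_zero, imp_false, not_not] at h
    exact ⟨σ, h.symm⟩
  let p : SummableFamily ℝ ℤ G :=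
    { toFun := fun σ => formalExp (L σ)
      isPWO_iUnion_support' := hpwo.mono (Set.iUnion_subset fun σ e he => hmem he)
      finite_co_support' := hfinp }
  let t : SummableFamily ℝ ℤ ℕ :=
    { toFun := fun n => ∑ σ ∈ S (n + 1), formalExp (L σ)
      isPWO_iUnion_support' := hpwo.mono (Set.iUnion_subset fun n e he => by
        obtain ⟨σ, -, hσ⟩ := hnonzero he
        exact hmem hσ)
      finite_co_support' := fun e => by
        refine (((hfinp e).image N).image Nat.pred).subset fun n hn => ?_
        obtain ⟨σ, hσ, hσe⟩ := hnonzero hn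
        exact ⟨n + 1, ⟨σ, hσe, (hS _ _).mp hσ⟩, rfl⟩ }
  refine ⟨p, t, fun σ => rfl, fun n => rfl, ?_⟩
  ext e
  -- K bounds the levels that contribute to the exponent e; splitting off level 0 from the range up
  -- to K isolates the term of σ₀.
  obtain ⟨K, hK⟩ := ((hfinp e).image N).bddAbove
  have hdisj : ∀ n ∈ Finset.range (K + 1), ∀ m ∈ Finset.range (K + 1), n ≠ m →
      Disjoint (S n) (S m) := fun n _ m _ hnm => Finset.disjoint_left.mpr fun σ h h' =>
    hnm (((hS _ _).mp h).symm.trans ((hS _ _).mp h'))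
  classical
  have hp : p.hsum.coeff e =
      ∑ σ ∈ (Finset.range (K + 1)).biUnion S, (formalExp (L σ)).coeff e := by
    refine SummableFamily.coeff_hsum_eq_sum_of_subset fun σ hσ => ?_
    rw [Finset.mem_coe, Finset.mem_biUnion]
    exact ⟨N σ, Finset.mem_range_succ_iff.mpr (hK ⟨σ, hσ, rfl⟩), (hS _ _).mpr rfl⟩
  have ht : t.hsum.coeff e =
      ∑ n ∈ Finset.range K, (∑ σ ∈ S (n + 1), formalExp (L σ)).coeff e := by
    refine SummableFamily.coeff_hsum_eq_sum_of_subset fun n hn => ?_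
    obtain ⟨σ, hσ, hσe⟩ := hnonzero hn
    have := hK ⟨σ, hσe, (hS _ _).mp hσ⟩
    simpa using this
  rw [coeff_add, hp, ht, Finset.sum_biUnion hdisj, Finset.sum_range_succ', h0,
    Finset.sum_singleton]
  simp only [coeff_sum]

variable {k : Type*} [NontriviallyNormedField k] [CompleteSpace k] [IsUltrametricDist k] {g : ℕ}
  {b : Letter g → BerkovichP1 k} {x y : BerkovichP1 k}

theorem exists_forall_mem_seriesGE {ι : Type*} [Finite ι] (f : ι → HahnSeries ℝ ℤ) :
    ∃ c, ∀ i, f i ∈ seriesGE c := by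
  choose c hc using fun i => exists_mem_seriesGE (f i)
  obtain ⟨d, hd⟩ := (Set.finite_range c).bddBelow
  exact ⟨d, fun i => seriesGE_anti (hd ⟨i, rfl⟩) (hc i)⟩

theorem perronMatrix_mem_seriesGE {δ : ℝ}
    (hδ : ∀ a c : Letter g, a.inv ≠ c → δ ≤ rho (b a.inv) (b c)) (a c : Letter g) :
    perronMatrix formalExp b a c ∈ seriesGE δ := by
  rw [perronMatrix, Matrix.of_apply]
  split_ifs with h
  · exact zero_mem _
  · exact formalExp_mem_seriesGE (hδ a c h)

/-- The determinant of I minus the matrix of independent variables has constant coefficient 1. After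
specialization, det(I - M) - 1 has only exponents at least δ > 0, so the determinant is a unit over
ℤ. -/
theorem isUnit_one_sub_perronMatrix_formalExp {δ : ℝ} (hδ0 : 0 < δ)
    (hδ : ∀ a c : Letter g, a.inv ≠ c → δ ≤ rho (b a.inv) (b c)) :
    IsUnit (1 - perronMatrix formalExp b) := by
  rw [Matrix.isUnit_iff_isUnit_det]
  let M : Matrix (Letter g) (Letter g) (MvPolynomial (Letter g × Letter g) ℤ) :=
    Matrix.of fun a c => if a.inv = c then 0 else MvPolynomial.X (a, c)
  let f : Letter g × Letter g → HahnSeries ℝ ℤ := fun i => perronMatrix formalExp b i.1 i.2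
  have h1 : MvPolynomial.aeval f (1 - M).det = (1 - perronMatrix formalExp b).det := by
    rw [AlgHom.map_det, map_sub, map_one]
    congr 2
    ext1 a c
    by_cases h : a.inv = c <;> simp [M, f, perronMatrix, h]
  have h2 : MvPolynomial.constantCoeff (1 - M).det = 1 := by
    have hM : MvPolynomial.constantCoeff.mapMatrix M = 0 := by
      ext a c
      simp only [M, RingHom.mapMatrix_apply, Matrix.map_apply, Matrix.of_apply, Matrix.zero_apply]
      split_ifs <;> simp
    rw [RingHom.map_det, map_sub, map_one, hM, sub_zero, Matrix.det_one]
  refine isUnit_of_sub_one_mem_seriesGE hδ0 ?_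
  have := aeval_sub_constantCoeff_mem_seriesGE hδ0.le (f := f)
    (fun i => perronMatrix_mem_seriesGE hδ i.1 i.2) (1 - M).det
  rwa [h1, h2, Int.cast_one] at this

theorem inv_one_sub_eq {n R : Type*} [Fintype n] [DecidableEq n] [CommRing R] {M : Matrix n n R}
    (h : IsUnit (1 - M)) (K : ℕ) :
    (1 - M)⁻¹ = ∑ i ∈ Finset.range K, M ^ i + (1 - M)⁻¹ * M ^ K := by
  have h1 := mul_neg_geom_sum M K
  have h2 : (1 - M)⁻¹ * ((1 - M) * ∑ i ∈ Finset.range K, M ^ i) =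
      ∑ i ∈ Finset.range K, M ^ i := by
    rw [← mul_assoc, Matrix.nonsing_inv_mul _ ((Matrix.isUnit_iff_isUnit_det _).mp h), one_mul]
  rw [← h2, h1, mul_sub, mul_one, sub_add_cancel]

theorem resolventTerm_eq_sum_add {R : Type*} [CommRing R] {E : ℝ → R}
    (h : IsUnit (1 - perronMatrix E b)) (K : ℕ) :
    resolventTerm E b x y = ∑ n ∈ Finset.range K, powerTerm E b x y n +
      vecX E b x ⬝ᵥ (((1 - perronMatrix E b)⁻¹ * perronMatrix E b ^ K) *ᵥ vecY E b y) := by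
  rw [resolventTerm]
  conv_lhs => rw [inv_one_sub_eq h K]
  rw [Matrix.add_mulVec, dotProduct_add, Matrix.sum_mulVec, dotProduct_sum]
  rfl

/-- The remainder after K terms has exponents at least c + Kδ, where c depends only on X, (I - M)⁻¹
and Y. Each fixed coefficient is unaffected by it for K large. -/
theorem hsum_eq_resolventTerm {δ : ℝ} (hδ0 : 0 < δ)
    (hδ : ∀ a c : Letter g, a.inv ≠ c → δ ≤ rho (b a.inv) (b c))
    (t : SummableFamily ℝ ℤ ℕ) (ht : ∀ n, t n = powerTerm formalExp b x y n) :
    t.hsum = resolventTerm formalExp b x y := by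
  have hu := isUnit_one_sub_perronMatrix_formalExp hδ0 hδ
  set M := perronMatrix formalExp b with hM
  set W := (1 - M)⁻¹
  obtain ⟨c, hc⟩ := exists_forall_mem_seriesGE fun i : Letter g × Letter g × Letter g =>
    vecX formalExp b x i.1 * W i.1 i.2.1 * vecY formalExp b y i.2.2
  have hrest : ∀ K : ℕ, vecX formalExp b x ⬝ᵥ ((W * M ^ K) *ᵥ vecY formalExp b y) ∈
      seriesGE (c + K * δ) := by
    intro K
    have hterm : vecX formalExp b x ⬝ᵥ ((W * M ^ K) *ᵥ vecY formalExp b y) =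
        ∑ i, ∑ j, ∑ l, vecX formalExp b x i * W i l * vecY formalExp b y j * (M ^ K) l j := by
      simp only [dotProduct, Matrix.mulVec, Matrix.mul_apply, Finset.mul_sum, Finset.sum_mul]
      refine Finset.sum_congr rfl fun i _ => Finset.sum_congr rfl fun j _ =>
        Finset.sum_congr rfl fun l _ => by ring
    rw [hterm]
    exact sum_mem fun i _ => sum_mem fun j _ => sum_mem fun l _ =>
      mul_mem_seriesGE (hc (i, l, j))
        (pow_apply_mem_seriesGE (perronMatrix_mem_seriesGE hδ) K l j)
  ext e
  -- Terms beyond K₀ do not contribute to the exponent e, and K₁ terms push the remainder past e.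
  obtain ⟨K₀, hK₀⟩ := (t.finite_co_support e).bddAbove
  obtain ⟨K₁, hK₁⟩ := exists_nat_gt ((e - c) / δ)
  set K := max (K₀ + 1) K₁
  have hK : e < c + K * δ := by
    rw [div_lt_iff₀ hδ0] at hK₁
    have : (K₁ : ℝ) ≤ K := by exact_mod_cast le_max_right _ _
    nlinarith
  have hs : t.hsum.coeff e = ∑ n ∈ Finset.range K, (t n).coeff e := by
    refine SummableFamily.coeff_hsum_eq_sum_of_subset fun n hn => ?_
    rw [Finset.mem_coe, Finset.mem_range]
    exact (Nat.lt_succ_of_le (hK₀ hn)).trans_le (le_max_left _ _)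
  rw [hs, resolventTerm_eq_sum_add hu K, coeff_add, hrest K e hK, add_zero, coeff_sum]
  simp only [ht]

end Formal

/-! ## Convergence -/

section Convergence

variable {n : Type*} [Fintype n] {M : Matrix n n ℂ} {q : ℝ}

theorem norm_mulVec_le (hq : 0 ≤ q) (hM : ∀ a c, ‖M a c‖ ≤ q) (v : n → ℂ) :
    ‖M *ᵥ v‖ ≤ Fintype.card n * q * ‖v‖ := by
  refine (pi_norm_le_iff_of_nonneg (by positivity)).mpr fun a => ?_
  refine (norm_sum_le _ _).trans ?_
  rw [mul_assoc, ← nsmul_eq_mul, ← Finset.card_univ]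
  refine Finset.sum_le_card_nsmul _ _ _ fun c _ => ?_
  rw [norm_mul]
  exact mul_le_mul (hM a c) (norm_le_pi_norm v c) (norm_nonneg _) hq

variable [DecidableEq n]

/-- A kernel vector would satisfy v = Mv, but M contracts the sup norm. -/
theorem isUnit_one_sub_of_norm_le (hq : 0 ≤ q) (hM : ∀ a c, ‖M a c‖ ≤ q)
    (hlt : Fintype.card n * q < 1) : IsUnit (1 - M) := by
  rw [Matrix.isUnit_iff_isUnit_det, isUnit_iff_ne_zero]
  intro hdet
  obtain ⟨v, hv, h⟩ := Matrix.exists_mulVec_eq_zero_iff.mpr hdet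
  rw [Matrix.sub_mulVec, Matrix.one_mulVec, sub_eq_zero] at h
  have h1 := norm_mulVec_le hq hM v
  rw [← h] at h1
  have h2 : 0 < ‖v‖ := norm_pos_iff.mpr hv
  nlinarith

theorem norm_pow_mulVec_le (hq : 0 ≤ q) (hM : ∀ a c, ‖M a c‖ ≤ q) (v : n → ℂ) (K : ℕ) :
    ‖M ^ K *ᵥ v‖ ≤ (Fintype.card n * q) ^ K * ‖v‖ := by
  induction K with
  | zero => simp
  | succ K ih =>
    rw [pow_succ', ← Matrix.mulVec_mulVec]
    refine (norm_mulVec_le hq hM _).trans ?_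
    rw [pow_succ', mul_assoc (Fintype.card n * q)]
    gcongr

theorem hasSum_pow_mulVec (hq : 0 ≤ q) (hM : ∀ a c, ‖M a c‖ ≤ q)
    (hlt : Fintype.card n * q < 1) (v : n → ℂ) :
    HasSum (fun K : ℕ => M ^ K *ᵥ v) ((1 - M)⁻¹ *ᵥ v) := by
  have hr : 0 ≤ Fintype.card n * q := by positivity
  have hsum : Summable fun K : ℕ => M ^ K *ᵥ v :=
    Summable.of_norm_bounded ((summable_geometric_of_lt_one hr hlt).mul_right ‖v‖)
      (norm_pow_mulVec_le hq hM v)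
  rw [hsum.hasSum_iff_tendsto_nat]
  have hpart : ∀ K, ∑ i ∈ Finset.range K, M ^ i *ᵥ v =
      (1 - M)⁻¹ *ᵥ v - (1 - M)⁻¹ *ᵥ (M ^ K *ᵥ v) := fun K => by
    rw [Matrix.mulVec_mulVec, eq_sub_iff_add_eq, ← Matrix.sum_mulVec, ← Matrix.add_mulVec,
      ← inv_one_sub_eq (isUnit_one_sub_of_norm_le hq hM hlt) K]
  simp only [hpart]
  have hcont : Continuous fun w : n → ℂ => (1 - M)⁻¹ *ᵥ w := by fun_prop
  have := (hcont.tendsto 0).comp hsum.tendsto_atTop_zero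
  simpa using tendsto_const_nhds.sub this

end Convergence
end

noncomputable section
open scoped Pointwise

/-! ## The exponential functions -/

section Exp

theorem realExp_add (s l m : ℝ) : realExp s (l + m) = realExp s l * realExp s m := by
  rw [realExp, realExp, realExp, ← Real.exp_add, mul_add]

theorem complexExp_add (s : ℂ) (l m : ℝ) :
    complexExp s (l + m) = complexExp s l * complexExp s m := by
  rw [complexExp, complexExp, complexExp, ← Complex.exp_add, Complex.ofReal_add, mul_add]

theorem complexExp_zero (s : ℂ) : complexExp s 0 = 1 := by simp [complexExp]

theorem norm_complexExp (s : ℂ) (l : ℝ) : ‖complexExp s l‖ = realExp s.re l := by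
  rw [complexExp, Complex.norm_exp, realExp, Complex.re_mul_ofReal, Complex.neg_re]

theorem complexExp_ofReal (s l : ℝ) : complexExp s l = realExp s l := by
  simp [complexExp, realExp]

theorem analyticAt_complexExp (l : ℝ) (s : ℂ) : AnalyticAt ℂ (complexExp · l) s := by
  unfold complexExp
  fun_prop

end Exp

/-! ### Convergence and continuation for the Perron matrix; the main theorem -/

section Main

open BerkovichP1

variable {k : Type*} [NontriviallyNormedField k] [CompleteSpace k] [IsUltrametricDist k] {g : ℕ}
  {b : Letter g → BerkovichP1 k} {x y : BerkovichP1 k}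

theorem norm_perronMatrix_le {δ : ℝ}
    (hδ : ∀ a c : Letter g, a.inv ≠ c → δ ≤ rho (b a.inv) (b c)) {s : ℂ} (hs : 0 ≤ s.re)
    (a c : Letter g) : ‖perronMatrix (complexExp s) b a c‖ ≤ realExp s.re δ := by
  rw [perronMatrix, Matrix.of_apply]
  split_ifs with h
  · rw [norm_zero]
    exact (Real.exp_pos _).le
  · rw [norm_complexExp]
    exact Real.exp_le_exp.mpr (by nlinarith [hδ a c h])

/-- This is the choice of s₀ with n = 2g letters; the logarithm of n + 1 instead of n keeps s₀
nonnegative and meaningful when there are no letters. -/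
theorem card_mul_realExp_lt {n : ℕ} {δ s : ℝ} (hδ : 0 < δ) (hs : Real.log (n + 1) / δ < s) :
    n * realExp s δ < 1 := by
  rw [div_lt_iff₀ hδ] at hs
  have h1 : ((n : ℝ) + 1) < Real.exp (s * δ) := by
    rwa [← Real.log_lt_iff_lt_exp (by positivity)]
  rw [realExp, neg_mul, Real.exp_neg, ← div_eq_mul_inv, div_lt_one (Real.exp_pos _)]
  linarith

theorem hasSum_powerTerm {δ : ℝ} (hδ0 : 0 < δ)
    (hδ : ∀ a c : Letter g, a.inv ≠ c → δ ≤ rho (b a.inv) (b c)) {s : ℂ}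
    (hs : Real.log (Fintype.card (Letter g) + 1) / δ < s.re) :
    IsUnit (1 - perronMatrix (complexExp s) b) ∧
      HasSum (powerTerm (complexExp s) b x y) (resolventTerm (complexExp s) b x y) := by
  have hs0 : 0 ≤ s.re := le_trans (div_nonneg (Real.log_nonneg (by simp)) hδ0.le) hs.le
  have hlt := card_mul_realExp_lt hδ0 hs
  have hq : 0 ≤ realExp s.re δ := (Real.exp_pos _).le
  have hM := norm_perronMatrix_le hδ hs0
  refine ⟨isUnit_one_sub_of_norm_le hq hM hlt, ?_⟩
  have h := hasSum_pow_mulVec hq hM hlt (vecY (complexExp s) b y)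
  exact hasSum_sum fun a _ => (Pi.hasSum.mp h a).mul_left _

/-- The determinant and the adjugate formula are computed once over ℤ with one variable per length,
and a ring homomorphism then specializes them for every s at once. -/
theorem exists_exponentialPolynomial (hxp : IsHyperbolic x) (hyp : IsHyperbolic y)
    (hbp : ∀ a, IsHyperbolic (b a)) :
    ∃ (m : ℕ) (l : Fin m → ℝ) (P Q : MvPolynomial (Fin m) ℤ), (∀ i, 0 < l i) ∧ ∀ s : ℂ,
      MvPolynomial.aeval (fun i => complexExp s (l i)) P = perronNum (complexExp s) b x y +
        perronDet (complexExp s) b * complexExp s (rho x y) ∧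
      MvPolynomial.aeval (fun i => complexExp s (l i)) Q = perronDet (complexExp s) b := by
  -- Only positive lengths are kept; a length 0, for instance ρ(x, y) when x = y, contributes the
  -- constant 1.
  let Λ : Finset ℝ := ({rho x y} ∪
    (Set.finite_range fun i : Letter g × Letter g => rho (b i.1) (b i.2)).toFinset ∪
    (Set.finite_range fun a => rho x (b a)).toFinset ∪
    (Set.finite_range fun a => rho y (b a)).toFinset).filter (0 < ·)
  have hmem : ∀ {l : ℝ}, 0 ≤ l → (l = rho x y ∨ (∃ a c, rho (b a) (b c) = l) ∨
      (∃ a, rho x (b a) = l) ∨ ∃ a, rho y (b a) = l) → l ∈ Λ ∨ l = 0 := fun {l} h0 h => by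
    refine h0.eq_or_lt.symm.imp (fun h1 => ?_) Eq.symm
    simpa [Λ, h1, or_assoc] using h
  let e := Λ.equivFin
  have hev : ∀ (s : ℂ) (P : MvPolynomial Λ ℤ),
      MvPolynomial.aeval (fun i => complexExp s (e.symm i : ℝ)) (MvPolynomial.rename e P) =
        MvPolynomial.aeval (fun i : Λ => complexExp s i) P := fun s P => by
    rw [MvPolynomial.aeval_rename]
    congr 2
    funext i
    simp
  have hE : ∀ (s : ℂ) {l : ℝ}, 0 ≤ l → (l = rho x y ∨ (∃ a c, rho (b a) (b c) = l) ∨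
      (∃ a, rho x (b a) = l) ∨ ∃ a, rho y (b a) = l) →
      (MvPolynomial.aeval fun i : Λ => complexExp s i).toRingHom (polyExp Λ l) = complexExp s l :=
    fun s l h0 h => aeval_polyExp (complexExp_zero s) (hmem h0 h)
  have hM : ∀ (s : ℂ) (a c : Letter g),
      (MvPolynomial.aeval fun i : Λ => complexExp s i).toRingHom
        (polyExp Λ (rho (b a.inv) (b c))) = complexExp s (rho (b a.inv) (b c)) := fun s a c =>
    hE s (rho_nonneg (hbp _) (hbp _)) (.inr (.inl ⟨_, _, rfl⟩))
  refine ⟨Λ.card, fun i => e.symm i,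
    MvPolynomial.rename e (perronNum (polyExp Λ) b x y +
      perronDet (polyExp Λ) b * polyExp Λ (rho x y)),
    MvPolynomial.rename e (perronDet (polyExp Λ) b),
    fun i => (Finset.mem_filter.mp (e.symm i).2).2, fun s => ?_⟩
  have hdet := map_perronDet _ (hM s)
  have hnum := map_perronNum (x := x) (y := y) _ (hM s)
    (fun a => hE s (rho_nonneg hxp (hbp a)) (.inr (.inr (.inl ⟨_, rfl⟩))))
    (fun a => hE s (rho_nonneg hyp (hbp a)) (.inr (.inr (.inr ⟨_, rfl⟩))))
  have hxy := hE s (rho_nonneg hxp hyp) (.inl rfl)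
  rw [hev, hev]
  refine ⟨?_, hdet⟩
  rw [map_add, map_mul]
  exact congrArg₂ (· + ·) hnum (congrArg₂ (· * ·) hdet hxy)

end Main

theorem mainTheorem5 {k : Type*} [NontriviallyNormedField k] [CompleteSpace k]
    [IsUltrametricDist k] {g : ℕ} (γ : Fin g → PGL(2, k))
    (D Do : Letter g → Set (BerkovichP1 k)) (hfig : IsSchottkyFigure γ D Do)
    (b : Letter g → BerkovichP1 k) (hb : ∀ a, BerkovichP1.IsBoundaryPoint (D a) (b a))
    (Γ : Subgroup (PGL(2, k))) (hΓ : Γ = Subgroup.closure (Set.range γ))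
    (x y : BerkovichP1 k)
    (hx : x ∈ hyperbolicSpace k ∩ fundamentalDomain D Do)
    (hy : y ∈ hyperbolicSpace k ∩ fundamentalDomain D Do) :
    -- the identities of formal series in `q = e^{-s}`
    (∃ (p : HahnSeries.SummableFamily ℝ ℤ Γ) (t : HahnSeries.SummableFamily ℝ ℤ ℕ),
      (∀ σ : Γ, p σ = formalExp (BerkovichP1.rho x (σ • y))) ∧
      (∀ n : ℕ, t n = powerTerm formalExp b x y n) ∧
      p.hsum = t.hsum + formalExp (BerkovichP1.rho x y) ∧
      IsUnit (1 - perronMatrix formalExp b) ∧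
      p.hsum = resolventTerm formalExp b x y + formalExp (BerkovichP1.rho x y)) ∧
    -- the first identity for every real `s ≥ 0`, as sums of nonnegative terms in `[0, ∞]`
    (∀ s : ℝ, 0 ≤ s →
      (∀ n : ℕ, 0 ≤ powerTerm (realExp s) b x y n) ∧
      ∑' σ : Γ, ENNReal.ofReal (realExp s (BerkovichP1.rho x (σ • y))) =
        ∑' n : ℕ, ENNReal.ofReal (powerTerm (realExp s) b x y n) +
          ENNReal.ofReal (realExp s (BerkovichP1.rho x y))) ∧
    -- meromorphy of the closed formula on the whole plane
    MeromorphicOn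
      (fun s : ℂ => resolventTerm (complexExp s) b x y + complexExp s (BerkovichP1.rho x y))
      Set.univ ∧
    ∃ s₀ : ℝ,
      -- convergence of both series for `Re s > s₀`, with the expected sums
      (∀ s : ℂ, s₀ < s.re →
        IsUnit (1 - perronMatrix (complexExp s) b) ∧
        HasSum (fun n : ℕ => powerTerm (complexExp s) b x y n)
          (resolventTerm (complexExp s) b x y) ∧
        HasSum (fun σ : Γ => complexExp s (BerkovichP1.rho x (σ • y)))
          (resolventTerm (complexExp s) b x y + complexExp s (BerkovichP1.rho x y))) ∧
      -- the continuation is a ratio of exponential polynomials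
      ∃ (m : ℕ) (l : Fin m → ℝ) (P Q : MvPolynomial (Fin m) ℤ),
        (∀ i, 0 < l i) ∧
        (∀ s : ℂ, s₀ < s.re → MvPolynomial.aeval (fun i => complexExp s (l i)) Q ≠ 0) ∧
        ∀ s : ℂ, MvPolynomial.aeval (fun i => complexExp s (l i)) Q ≠ 0 →
          resolventTerm (complexExp s) b x y + complexExp s (BerkovichP1.rho x y) =
            MvPolynomial.aeval (fun i => complexExp s (l i)) P /
              MvPolynomial.aeval (fun i => complexExp s (l i)) Q := by
  have hxp := BerkovichP1.isHyperbolic_of_mem hx.1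
  have hyp := BerkovichP1.isHyperbolic_of_mem hy.1
  have hbp := fun a => (hb a).isHyperbolic
  obtain ⟨N, S, hS, hS0, ⟨δ₁, hδ₁, hN⟩, hT⟩ := hfig.exists_wordLength hb hΓ hx.2 hxp hy.2 hyp
  obtain ⟨δ, hδ0, hδ⟩ := hfig.exists_le_rho_boundary hb
  have hone : ((1 : Γ) • y) = y := one_smul Γ y
  obtain ⟨m, l, P, Q, hl, hPQ⟩ := exists_exponentialPolynomial hxp hyp hbp
  refine ⟨?_, fun s _ => ⟨fun n => ?_, ?_⟩, fun s _ => ?_,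
    Real.log (Fintype.card (Letter g) + 1) / δ, fun s hs => ?_, m, l, P, Q, hl, fun s hs => ?_,
    fun s hs => ?_⟩
  · obtain ⟨p, t, hp, ht, hpt⟩ := exists_summableFamily hS hS0 hδ₁ hN
    have ht' : ∀ n, t n = powerTerm formalExp b x y n := fun n =>
      (ht n).trans (hT formalExp_add n).symm
    rw [hone] at hpt
    refine ⟨p, t, hp, ht', hpt, isUnit_one_sub_perronMatrix_formalExp hδ0 hδ, ?_⟩
    rw [hpt, hsum_eq_resolventTerm hδ0 hδ t ht']
  · rw [hT (realExp_add s)]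
    exact Finset.sum_nonneg fun σ _ => (Real.exp_pos _).le
  · rw [tsum_eq_tsum_levels hS, tsum_eq_zero_add' ENNReal.summable, hS0, Finset.sum_singleton,
      hone, add_comm]
    congr 1
    refine tsum_congr fun n => ?_
    rw [hT (realExp_add s)]
    exact (ENNReal.ofReal_sum_of_nonneg fun σ _ => (Real.exp_pos _).le).symm
  · have hev : ∀ R : MvPolynomial (Fin m) ℤ,
        MeromorphicAt (fun s => MvPolynomial.aeval (fun i => complexExp s (l i)) R) s := fun R =>
      (AnalyticAt.aeval_mvPolynomial (fun i => analyticAt_complexExp (l i) s) R).meromorphicAt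
    have hE := (analyticAt_complexExp (BerkovichP1.rho x y) s).meromorphicAt
    -- The function is presented as (P - Q e^{-sρ(x,y)}) / Q + e^{-sρ(x,y)}, not as P / Q, because
    -- this equals the closed formula at every point, zeros of Q included.
    refine ((((hev P).sub ((hev Q).mul hE)).div (hev Q)).add hE).congr (.of_forall fun z => ?_)
    simp only [Pi.add_apply, Pi.div_apply, Pi.sub_apply, Pi.mul_apply, (hPQ z).1, (hPQ z).2,
      resolventTerm_eq_div, add_sub_cancel_right]
  · obtain ⟨hu, hsum⟩ := hasSum_powerTerm (x := x) (y := y) hδ0 hδ hs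
    refine ⟨hu, hsum, HasSum.of_levels hS ?_ ?_⟩
    -- The norms of the terms at s are the terms at Re s, so absolute convergence is the convergence
    -- already known at the real point Re s.
    · rw [← summable_nat_add_iff 1, ← Complex.summable_ofReal]
      have hre : Real.log (Fintype.card (Letter g) + 1) / δ < (s.re : ℂ).re := by
        rwa [Complex.ofReal_re]
      refine (hasSum_powerTerm (x := x) (y := y) hδ0 hδ hre).2.summable.congr fun n => ?_
      rw [hT (complexExp_add _), Complex.ofReal_sum]
      simp only [norm_complexExp, complexExp_ofReal]
    -- Removing level 0 cancels e^{-sρ(x,y)}, and level n + 1 is the n-th power term.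
    · rw [← hasSum_nat_add_iff' 1, Finset.sum_range_one, hS0, Finset.sum_singleton, hone,
        add_sub_cancel_right]
      rwa [funext fun n => (hT (complexExp_add s) n).symm]
  · rw [(hPQ s).2]
    exact ((Matrix.isUnit_iff_isUnit_det _).mp
      (hasSum_powerTerm (x := x) (y := y) hδ0 hδ hs).1).ne_zero
  · rw [(hPQ s).2] at hs
    rw [(hPQ s).1, (hPQ s).2, resolventTerm_eq_div, add_div, mul_div_cancel_left₀ _ hs]
end
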